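/- **Symmetric triples.** A *symmetric triple* $\tau=(\mathfrak g,\sigma,B)$ consists of a finite-dimensional real Lie algebra $\mathfrak g$, an involutive automorphism $\sigma$ of $\mathfrak g$ and a non-degenerate symmetric bilinear form $B$ on $\mathfrak g$ which is invariant under $\sigma$ and under $\mathrm{ad}(\mathfrak g)$, such that the eigenspaces $\mathfrak h$ (eigenvalue $1$) and $\mathfrak m$ (eigenvalue $-1$) of $\sigma$ satisfy $\mathfrak h=[\mathfrak m,\mathfrak m]$. Isomorphisms are the Lie algebra isomorphisms that respect $\sigma$ and $B$. The triple has *signature* $(p,q)$ if $B|_{\mathfrak m\times\mathfrak m}$ has $p$ negative and $q$ positive squares. It is *indecomposable* if there is no subspace $0\ne\mathfrak m'\subsetneq\mathfrak m$ that is $\mathrm{ad}(\mathfrak h)$-invariant and on which $B$ is non-degenerate. Let $\mathfrak z$ be the centre of $\mathfrak g$. An *adapted decomposition* is a decomposition $\mathfrak m=\mathfrak z\oplus W\oplus E$ with $[\mathfrak h,\mathfrak m]=\mathfrak z\oplus W$, with $\mathfrak z$ and $E$ totally isotropic and with $W\perp\mathfrak z\oplus E$. The triple is *least nilpotent* if it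 has an adapted decomposition for which no $w\in W\setminus\{0\}$ is annihilated by all the operators $\mathrm{pr}_W\circ\mathrm{ad}(x)\circ\mathrm{ad}(y)|_W$, $x,y\in E$. For $1\le p\le q$ let $\mathcal T_{p,q}$ be the class of indecomposable solvable symmetric triples of signature $(p,q)$ with $\dim\mathfrak z=p$ which are least nilpotent. **Normal forms.** Let $1\le p\le q$, $n=q-p$, and let $\mathfrak z$ be a real vector space of dimension $p$ with dual space $\mathfrak z^*$. Let $\mathcal R_b$ be an algebraic curvature tensor on $\mathfrak z^*$, i.e. a symmetric bilinear form on $\Lambda^2(\mathfrak z^*)$ that satisfies the first Bianchi identity; let $\epsilon\in\{\pm1\}^n$ and $\Lambda_1,\dots,\Lambda_n\in\mathfrak z\setminus\{0\}$. Put $Y=\Lambda^2(\mathfrak z^*)/\ker\mathcal R_b$, with projection $\pi:\Lambda^2(\mathfrak z^*)\to Y$ and the non-degenerate form $B_Y$ induced by $\mathcal R_b$, and define $b:Y\times\mathfrak z^*\to\mathfrak z$ by $f_4\big(b(\pi(f_1\wedge f_2),f_3)\big)=\mathcal R_b(f_1\wedge f_2,f_3\wedge f_4)$. Let $W=\mathbb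 R^n$ be Euclidean with orthonormal basis $(W_\alpha)$, and let $W^*$ have a basis $(W^*_\alpha)$ with $B(W^*_\alpha,W^*_\beta)=\epsilon_\alpha\delta_{\alpha\beta}$. If $$b(Y,\mathfrak z^*)+\mathrm{span}\{\Lambda_\alpha\}=\mathfrak z ,$$ where $b(Y,\mathfrak z^*)$ means the span of the values of $b$, then $\tau_{p,q}(\mathcal R_b,\epsilon,\Lambda)$ is the symmetric triple with $\mathfrak h=Y\oplus W^*$ and $\mathfrak m=\mathfrak z\oplus W\oplus\mathfrak z^*$, with $B$ the orthogonal sum of $B_Y$, of the forms on $W^*$ and $W$ and of the canonical pairing on $\mathfrak z\oplus\mathfrak z^*$ ($B(f,x)=f(x)$, $\mathfrak z$ and $\mathfrak z^*$ isotropic), and with the brackets (the only ones on generators that can be non-zero) $$[f,g]=\pi(f\wedge g),\quad [f,W_\alpha]=f(\Lambda_\alpha)W^*_\alpha,\quad [y,f]=b(y,f),\quad [W^*_\alpha,f]=\epsilon_\alpha f(\Lambda_\alpha)W_\alpha,\quad [W^*_\alpha,W_\beta]=-\epsilon_\alpha\delta_{\alpha\beta}\Lambda_\alpha$$ for $f,g\in\mathfrak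 z^*$, $y\in Y$. Let $\mathcal N_{p,q}$ be the class of these triples. For $P\in GL(\mathfrak z)$ let $P^*:\mathfrak z^*\to\mathfrak z^*$, $f\mapsto f\circ P$, and let $P^*\cdot\mathcal R_b$ be the pull-back of $\mathcal R_b$ by the map that $P^*$ induces on $\Lambda^2(\mathfrak z^*)$. **Theorem.** Let $1\le p\le q$. (i) Every $\tau\in\mathcal T_{p,q}$ is isomorphic to some $\tau_{p,q}(\mathcal R_b,\epsilon,\Lambda)\in\mathcal N_{p,q}$. (ii) Every $\tau\in\mathcal N_{p,q}$ is isomorphic to a direct sum $\tau_1\oplus\dots\oplus\tau_s$ with $\tau_i\in\mathcal T_{p_i,q_i}$, $1\le p_i\le q_i$; and whenever $\tau\in\mathcal N_{p,q}$ is isomorphic to a direct sum of non-zero indecomposable symmetric triples, each summand lies in some $\mathcal T_{p',q'}$. If $\dim Y>p(p-2)/2$, then $\tau_{p,q}(\mathcal R_b,\epsilon,\Lambda)$ is indecomposable. (iii) Two indecomposable triples $\tau_{p,q}(\mathcal R_b,\epsilon,\Lambda)$ and $\tau_{p,q}(\widetilde{\mathcal R}_b,\widetilde\epsilon,\widetilde\Lambda)$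 in $\mathcal N_{p,q}$ are isomorphic if and only if there are a permutation $\Pi\in\mathcal S_{q-p}$ and $P\in GL(\mathfrak z)$ with $$P^*\cdot\mathcal R_b=\widetilde{\mathcal R}_b,\qquad \epsilon_\alpha=\widetilde\epsilon_{\Pi(\alpha)},\qquad P(\Lambda_\alpha)=\pm\widetilde\Lambda_{\Pi(\alpha)}\quad\text{for all }\alpha$$ (the sign may depend on $\alpha$). (iv) Let $\tau=\tau_{p,q}(\mathcal R_b,\epsilon,\Lambda)\in\mathcal N_{p,q}$. Let $\mathrm{Aut}(\tau)$ be the group of linear automorphisms of $\mathfrak m$ that preserve $B$ and the triple bracket $[[\cdot,\cdot],\cdot]$. Let $\Gamma$ be the group of isometries of $(\mathfrak m,B)$ that preserve $F=[\mathfrak h,\mathfrak m]$; let $\Gamma_{decomp}\subset\Gamma$ be the subgroup of those elements that act as the identity on $F\cap F^\perp$, on $F/(F\cap F^\perp)$ and on $F^\perp/(F\cap F^\perp)$ (with $F^\perp$ taken in $\mathfrak m$); and let $\Gamma_{basis}\subset\Gamma$ be the subgroup that preserves each of $\mathfrak z$, $W$, $\mathfrak z^*$. For $L\in\mathrm{Hom}(W,\mathfrak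 z)$ with transpose $L^t:\mathfrak z^*\to W$, $L^tf=\sum_\alpha f(LW_\alpha)W_\alpha$, let $\rho_L$ be the identity on $\mathfrak z$, $\rho_L(w)=w+Lw$ on $W$ and $\rho_L(f)=f-L^tf-\tfrac12LL^tf$ on $\mathfrak z^*$. For $S\in\mathrm{Skew}(\mathfrak z^*,\mathfrak z)$, i.e. $S:\mathfrak z^*\to\mathfrak z$ linear with $f(Sg)+g(Sf)=0$, let $\rho_S$ be the identity on $\mathfrak z\oplus W$ and $\rho_S(f)=f+Sf$. Let $W_1,\dots,W_s\subset W$ be the simultaneous eigenspaces of the operators $\mathrm{pr}_W\circ\mathrm{ad}(f)^2|_W$, $f\in\mathfrak z^*$, and let $O(W_1)\times\dots\times O(W_s)$ be the group of orthogonal maps of $W$ that preserve each $W_i$. For a permutation $\Pi$ let $Q_\Pi(W_\alpha)=W_{\Pi(\alpha)}$. Then: * $\mathrm{Aut}(\tau)\subset\Gamma=\Gamma_{decomp}\rtimes\Gamma_{basis}$, and $\mathrm{Aut}(\tau)$ is generated by $\mathrm{Aut}(\tau)\cap\Gamma_{decomp}$ and $\mathrm{Aut}(\tau)\cap\Gamma_{basis}$.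 * $(L,S)\mapsto\rho_L\circ\rho_S$ is a bijection from $\{L\in\mathrm{Hom}(W,\mathfrak z): L(W_\alpha)=c_\alpha\Lambda_\alpha,\ c\in\mathbb R^{q-p}\}\times\mathrm{Skew}(\mathfrak z^*,\mathfrak z)$ onto $\mathrm{Aut}(\tau)\cap\Gamma_{decomp}$. * $(P,Q)\mapsto P\oplus Q\oplus(P^*)^{-1}$ is a bijection from the set of pairs $(P,Q)\in GL(\mathfrak z)\times GL(W)$ for which there is a permutation $\Pi$ with $P^*\cdot\mathcal R_b=\mathcal R_b$, $\epsilon_\alpha=\epsilon_{\Pi(\alpha)}$, $P(\Lambda_\alpha)=\pm\Lambda_{\Pi(\alpha)}$ for all $\alpha$, and $Q\in Q_\Pi\circ\big(O(W_1)\times\dots\times O(W_s)\big)$, onto $\mathrm{Aut}(\tau)\cap\Gamma_{basis}$. It restricts to a bijection from $$\{P\in GL(\mathfrak z): P(\Lambda_\alpha)=\pm\Lambda_\alpha\ \text{for all }\alpha,\ P^*\cdot\mathcal R_b=\mathcal R_b\}\times O(W_1)\times\dots\times O(W_s)$$ onto the subgroup of those elements of $\mathrm{Aut}(\tau)\cap\Gamma_{basis}$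 that preserve each $W_i$. * $\mathrm{ad}(a)|_{\mathfrak m}$ is nilpotent for all $a\in\mathfrak h$. One has $\exp(\mathrm{ad}(Y)|_{\mathfrak m})\subset\{\rho_S: S\in\mathrm{Skew}(\mathfrak z^*,\mathfrak z)\}$, with equality if and only if $\dim Y=p(p-1)/2$. The map $c\mapsto\exp\big(\mathrm{ad}(\sum_\alpha c_\alpha W^*_\alpha)|_{\mathfrak m}\big)$ is an injective homomorphism on $(\mathbb R^{q-p},+)$ with image $\{\rho_L: L(W_\alpha)=c_\alpha\Lambda_\alpha,\ c\in\mathbb R^{q-p}\}$. -/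

import Mathlib

universe u v

open Module

noncomputable section

/-- A symmetric triple `(𝔤, σ, B)`: a finite-dimensional real Lie algebra `𝔤` with an involutive
automorphism `σ` and a non-degenerate symmetric bilinear form `B` that is invariant under `σ` and
under `ad 𝔤`, such that the eigenspaces `𝔥` (eigenvalue `1`) and `𝔪` (eigenvalue `-1`) of `σ`
satisfy `𝔥 = [𝔪, 𝔪]`. -/
structure SymmetricTriple where
  carrier : Type u
  [lieRing : LieRing carrier]
  [lieAlgebra : LieAlgebra ℝ carrier]
  [finiteDimensional : FiniteDimensional ℝ carrier]
  σ : carrier →ₗ⁅ℝ⁆ carrier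
  σ_σ : ∀ x : carrier, σ (σ x) = x
  B : LinearMap.BilinForm ℝ carrier
  B_symm : ∀ x y : carrier, B x y = B y x
  B_nondeg : ∀ x : carrier, (∀ y : carrier, B x y = 0) → x = 0
  B_σ : ∀ x y : carrier, B (σ x) (σ y) = B x y
  B_lie : ∀ x y z : carrier, B ⁅x, y⁆ z + B y ⁅x, z⁆ = 0
  /-- `𝔥 = [𝔪, 𝔪]`; the inclusion `[𝔪, 𝔪] ⊆ 𝔥` is automatic. -/
  fixed_mem_span : ∀ x : carrier, σ x = x →
    x ∈ Submodule.span ℝ {z : carrier | ∃ a b : carrier, σ a = -a ∧ σ b = -b ∧ ⁅a, b⁆ = z}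

namespace SymmetricTriple

attribute [instance] lieRing lieAlgebra finiteDimensional

variable (τ : SymmetricTriple.{u})

/-- `𝔥`, the eigenspace of `σ` for the eigenvalue `1`. -/
def h : Submodule ℝ τ.carrier where
  carrier := {x | τ.σ x = x}
  add_mem' {a b} ha hb := by
    simp only [Set.mem_ofPred_eq] at ha hb ⊢
    rw [map_add, ha, hb]
  zero_mem' := map_zero _
  smul_mem' c x hx := by
    simp only [Set.mem_ofPred_eq] at hx ⊢
    rw [map_smul, hx]

/-- `𝔪`, the eigenspace of `σ` for the eigenvalue `-1`. -/
def m : Submodule ℝ τ.carrier where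
  carrier := {x | τ.σ x = -x}
  add_mem' {a b} ha hb := by
    simp only [Set.mem_ofPred_eq] at ha hb ⊢
    rw [map_add, ha, hb, neg_add]
  zero_mem' := by simp
  smul_mem' c x hx := by
    simp only [Set.mem_ofPred_eq] at hx ⊢
    rw [map_smul, hx, smul_neg]

theorem mem_h {x : τ.carrier} : x ∈ τ.h ↔ τ.σ x = x := Iff.rfl

theorem mem_m {x : τ.carrier} : x ∈ τ.m ↔ τ.σ x = -x := Iff.rfl

theorem lie_mem_h {x y : τ.carrier} (hx : x ∈ τ.m) (hy : y ∈ τ.m) : ⁅x, y⁆ ∈ τ.h := by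
  rw [mem_m] at hx hy
  rw [mem_h, LieHom.map_lie, hx, hy, neg_lie, lie_neg, neg_neg]

theorem lie_mem_m {x y : τ.carrier} (hx : x ∈ τ.h) (hy : y ∈ τ.m) : ⁅x, y⁆ ∈ τ.m := by
  rw [mem_h] at hx
  rw [mem_m] at hy
  rw [mem_m, LieHom.map_lie, hx, hy, lie_neg]

/-- The subspace `[𝔥, 𝔪]`. -/
def hm : Submodule ℝ τ.carrier :=
  Submodule.span ℝ {z : τ.carrier | ∃ a b : τ.carrier, a ∈ τ.h ∧ b ∈ τ.m ∧ ⁅a, b⁆ = z}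

/-- The centre `𝔷 = 𝔷(𝔤)`, as a linear subspace of `𝔤`. -/
def z : Submodule ℝ τ.carrier := (LieAlgebra.center ℝ τ.carrier).toSubmodule

/-- `B` restricted to `𝔪 × 𝔪` has signature `(p, q)`, with `p` negative and `q` positive squares. -/
def HasSignature (p q : ℕ) : Prop :=
  sigNeg (τ.B.restrict τ.m).toQuadraticMap = p ∧
    sigPos (τ.B.restrict τ.m).toQuadraticMap = q

/-- There is no proper subspace `0 ≠ 𝔪' ⊊ 𝔪` that is non-singular with respect to `B` and
invariant under `ad 𝔥`. -/
def Indecomposable : Prop :=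
  ¬ ∃ m' : Submodule ℝ τ.carrier, m' ≠ ⊥ ∧ m' < τ.m ∧
    (∀ x ∈ m', (∀ y ∈ m', τ.B x y = 0) → x = 0) ∧ ∀ a ∈ τ.h, ∀ x ∈ m', ⁅a, x⁆ ∈ m'

/-- `𝔪 = 𝔷 ⊕ W ⊕ E` is a Witt decomposition adapted to `[𝔥, 𝔪] = 𝔷 ⊕ W` and `B`. -/
structure IsAdapted (W E : Submodule ℝ τ.carrier) : Prop where
  z_sup_W : τ.z ⊔ W = τ.hm
  disjoint_z_W : Disjoint τ.z W
  hm_sup_E : τ.hm ⊔ E = τ.m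
  disjoint_hm_E : Disjoint τ.hm E
  isotropic_z : ∀ x ∈ τ.z, ∀ y ∈ τ.z, τ.B x y = 0
  isotropic_E : ∀ x ∈ E, ∀ y ∈ E, τ.B x y = 0
  orthogonal : ∀ w ∈ W, ∀ x ∈ τ.z ⊔ E, τ.B w x = 0

/-- For an adapted decomposition `𝔪 = 𝔷 ⊕ W ⊕ E`, the operators `pr_W ∘ ad x ∘ ad y` on `W`, with
`x, y ∈ E`, have no common kernel. That the `W`-component of an element of `𝔪` vanishes means that
it lies in `𝔷 ⊕ E`. The condition does not depend on the adapted decomposition. -/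
def LeastNilpotent : Prop :=
  ∃ W E : Submodule ℝ τ.carrier, τ.IsAdapted W E ∧
    ∀ w ∈ W, (∀ x ∈ E, ∀ y ∈ E, ⁅x, ⁅y, w⁆⁆ ∈ τ.z ⊔ E) → w = 0

/-- The class `𝒯_{p,q}`, `1 ≤ p ≤ q`, of indecomposable solvable symmetric triples of signature
`(p, q)` with maximal centre which are least nilpotent. -/
structure IsT (p q : ℕ) : Prop where
  one_le : 1 ≤ p
  le : p ≤ q
  signature : τ.HasSignature p q
  indecomposable : τ.Indecomposable
  solvable : LieAlgebra.IsSolvable τ.carrier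
  maximal_center : finrank ℝ τ.z = p
  leastNilpotent : τ.LeastNilpotent

/-- Isomorphisms of symmetric triples. -/
structure Iso (τ₁ : SymmetricTriple.{u}) (τ₂ : SymmetricTriple.{v}) where
  toLieEquiv : τ₁.carrier ≃ₗ⁅ℝ⁆ τ₂.carrier
  map_σ : ∀ x, toLieEquiv (τ₁.σ x) = τ₂.σ (toLieEquiv x)
  map_B : ∀ x y, τ₂.B (toLieEquiv x) (toLieEquiv y) = τ₁.B x y

/-! ### Direct sums -/

section DirectSum

variable {s : ℕ} (t : Fin s → SymmetricTriple.{u})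

/-- The underlying vector space of the direct sum of finitely many symmetric triples. -/
def SumCarrier : Type u := ∀ i, (t i).carrier

instance : AddCommGroup (SumCarrier t) := inferInstanceAs (AddCommGroup (∀ i, (t i).carrier))

instance : Module ℝ (SumCarrier t) := inferInstanceAs (Module ℝ (∀ i, (t i).carrier))

instance : FiniteDimensional ℝ (SumCarrier t) :=
  inferInstanceAs (FiniteDimensional ℝ (∀ i, (t i).carrier))

/-- The componentwise bracket. -/
instance : LieRing (SumCarrier t) where
  bracket x y := fun i => ⁅x i, y i⁆
  add_lie x y z := funext fun i => add_lie (x i) (y i) (z i)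
  lie_add x y z := funext fun i => lie_add (x i) (y i) (z i)
  lie_self x := funext fun i => lie_self (x i)
  leibniz_lie x y z := funext fun i => leibniz_lie (x i) (y i) (z i)

instance : LieAlgebra ℝ (SumCarrier t) where
  lie_smul c x y := funext fun i => lie_smul c (x i) (y i)

/-- The componentwise involution. -/
def sumσ : SumCarrier t →ₗ⁅ℝ⁆ SumCarrier t where
  toFun x := fun i => (t i).σ (x i)
  map_add' x y := funext fun i => map_add (t i).σ (x i) (y i)
  map_smul' c x := funext fun i => map_smul (t i).σ c (x i)
  map_lie' {x y} := funext fun i => LieHom.map_lie (t i).σ (x i) (y i)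

/-- The orthogonal sum of the forms `B_i`. -/
def sumForm : LinearMap.BilinForm ℝ (SumCarrier t) :=
  LinearMap.mk₂ ℝ (fun x y => ∑ i, (t i).B (x i) (y i))
    (fun x x' y => by
      rw [← Finset.sum_add_distrib]
      exact Finset.sum_congr rfl fun i _ => LinearMap.map_add₂ (t i).B (x i) (x' i) (y i))
    (fun c x y => by
      rw [Finset.smul_sum]
      exact Finset.sum_congr rfl fun i _ => LinearMap.map_smul₂ (t i).B c (x i) (y i))
    (fun x y y' => by
      rw [← Finset.sum_add_distrib]
      exact Finset.sum_congr rfl fun i _ => map_add ((t i).B (x i)) (y i) (y' i))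
    (fun c x y => by
      rw [Finset.smul_sum]
      exact Finset.sum_congr rfl fun i _ => map_smul ((t i).B (x i)) c (y i))

theorem sumForm_apply (x y : SumCarrier t) : sumForm t x y = ∑ i, (t i).B (x i) (y i) := rfl

theorem sumForm_symm (x y : SumCarrier t) : sumForm t x y = sumForm t y x := by
  rw [sumForm_apply, sumForm_apply]
  exact Finset.sum_congr rfl fun i _ => (t i).B_symm (x i) (y i)

theorem sumForm_nondeg (x : SumCarrier t) (hx : ∀ y, sumForm t x y = 0) : x = 0 := by
  classical
  funext i
  refine (t i).B_nondeg (x i) fun y => ?_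
  have h : ∑ j, (t j).B (x j) ((Pi.single i y : ∀ j, (t j).carrier) j) = 0 :=
    hx (Pi.single i y : ∀ j, (t j).carrier)
  rw [Finset.sum_eq_single i] at h
  · rw [Pi.single_eq_same] at h
    exact h
  · intro j _ hj
    rw [Pi.single_eq_of_ne hj, map_zero]
  · intro hi
    exact absurd (Finset.mem_univ i) hi

theorem sumForm_σ (x y : SumCarrier t) :
    sumForm t (sumσ t x) (sumσ t y) = sumForm t x y := by
  rw [sumForm_apply, sumForm_apply]
  exact Finset.sum_congr rfl fun i _ => (t i).B_σ (x i) (y i)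

theorem sumForm_lie (x y z : SumCarrier t) :
    sumForm t ⁅x, y⁆ z + sumForm t y ⁅x, z⁆ = 0 := by
  rw [sumForm_apply, sumForm_apply, ← Finset.sum_add_distrib]
  exact Finset.sum_eq_zero fun i _ => (t i).B_lie (x i) (y i) (z i)

/-- The direct sum `τ₁ ⊕ … ⊕ τ_s`. -/
def directSum : SymmetricTriple.{u} where
  carrier := SumCarrier t
  σ := sumσ t
  σ_σ x := funext fun i => (t i).σ_σ (x i)
  B := sumForm t
  B_symm x y := sumForm_symm t x y
  B_nondeg x hx := sumForm_nondeg t x hx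
  B_σ x y := sumForm_σ t x y
  B_lie x y z := sumForm_lie t x y z
  fixed_mem_span x hx := by
    classical
    have hdec : x = ∑ i, (LinearMap.single ℝ (fun j => (t j).carrier) i (x i) :
        ∀ j, (t j).carrier) := by
      have := Finset.univ_sum_single (M := fun j => (t j).carrier) x
      exact this.symm
    rw [hdec]
    refine Submodule.sum_mem _ fun i _ => ?_
    have hi := (t i).fixed_mem_span (x i) (congrFun hx i)
    have := Submodule.mem_map_of_mem (f := LinearMap.single ℝ (fun j => (t j).carrier) i) hi
    rw [Submodule.map_span] at this
    refine Submodule.span_mono ?_ this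
    rintro _ ⟨_, ⟨a, b, ha, hb, rfl⟩, rfl⟩
    refine ⟨(Pi.single i a : ∀ j, (t j).carrier), (Pi.single i b : ∀ j, (t j).carrier), ?_, ?_, ?_⟩
    · funext j
      show (t j).σ ((Pi.single i a : ∀ j, (t j).carrier) j) = -((Pi.single i a :
        ∀ j, (t j).carrier) j)
      by_cases hj : j = i
      · subst hj; simpa using ha
      · simp [Pi.single_eq_of_ne hj]
    · funext j
      show (t j).σ ((Pi.single i b : ∀ j, (t j).carrier) j) = -((Pi.single i b :
        ∀ j, (t j).carrier) j)
      by_cases hj : j = i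
      · subst hj; simpa using hb
      · simp [Pi.single_eq_of_ne hj]
    · funext j
      show ⁅(Pi.single i a : ∀ j, (t j).carrier) j, (Pi.single i b : ∀ j, (t j).carrier) j⁆
        = (Pi.single i ⁅a, b⁆ : ∀ j, (t j).carrier) j
      by_cases hj : j = i
      · subst hj; simp
      · simp [Pi.single_eq_of_ne hj]

end DirectSum

/-! ### Automorphisms -/

/-- `Aut(τ) = Aut(𝔪, [[·,·],·], B)`: the linear automorphisms of `𝔪` which preserve `B` and the
triple bracket `[[x, y], w]`. -/
def Aut : Subgroup (τ.m ≃ₗ[ℝ] τ.m) where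
  carrier := {γ | (∀ x y : τ.m, τ.B (γ x) (γ y) = τ.B x y) ∧
    ∀ x y w x' : τ.m, ⁅⁅(x : τ.carrier), (y : τ.carrier)⁆, (w : τ.carrier)⁆ = x' →
      ⁅⁅(γ x : τ.carrier), (γ y : τ.carrier)⁆, (γ w : τ.carrier)⁆ = γ x'}
  mul_mem' {a b} ha hb := by
    refine ⟨fun x y => ?_, fun x y w x' h => ?_⟩
    · rw [LinearEquiv.mul_apply, LinearEquiv.mul_apply, ha.1, hb.1]
    · exact ha.2 _ _ _ _ (hb.2 _ _ _ _ h)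
  one_mem' := ⟨fun _ _ => rfl, fun _ _ _ _ h => h⟩
  inv_mem' {a} ha := by
    refine ⟨fun x y => ?_, fun x y w x' h => ?_⟩
    · have := ha.1 (a⁻¹ x) (a⁻¹ y)
      rw [← LinearEquiv.mul_apply, ← LinearEquiv.mul_apply, mul_inv_cancel] at this
      exact this.symm
    · have key : ∀ v, a (a⁻¹ v) = v := fun v => by
        rw [← LinearEquiv.mul_apply, mul_inv_cancel]; rfl
      have hm : ⁅⁅((a⁻¹ x : τ.m) : τ.carrier), ((a⁻¹ y : τ.m) : τ.carrier)⁆,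
          ((a⁻¹ w : τ.m) : τ.carrier)⁆ ∈ τ.m :=
        τ.lie_mem_m (τ.lie_mem_h (a⁻¹ x).2 (a⁻¹ y).2) (a⁻¹ w).2
      have := ha.2 (a⁻¹ x) (a⁻¹ y) (a⁻¹ w) ⟨_, hm⟩ rfl
      rw [key, key, key, h] at this
      have h2 : a⁻¹ x' = ⟨_, hm⟩ := by
        have h3 := Subtype.ext this
        rw [h3, ← LinearEquiv.mul_apply, inv_mul_cancel]; rfl
      exact (congrArg Subtype.val h2).symm

/-- `Γ = stab([𝔥, 𝔪]) ∩ O(𝔪, B)`. -/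
def Γ : Subgroup (τ.m ≃ₗ[ℝ] τ.m) where
  carrier := {γ | (∀ x y : τ.m, τ.B (γ x) (γ y) = τ.B x y) ∧
    ∀ x : τ.m, (γ x : τ.carrier) ∈ τ.hm ↔ (x : τ.carrier) ∈ τ.hm}
  mul_mem' {a b} ha hb := by
    refine ⟨fun x y => ?_, fun x => ?_⟩
    · rw [LinearEquiv.mul_apply, LinearEquiv.mul_apply, ha.1, hb.1]
    · rw [LinearEquiv.mul_apply, ha.2, hb.2]
  one_mem' := ⟨fun _ _ => rfl, fun _ => Iff.rfl⟩
  inv_mem' {a} ha := by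
    have key : ∀ v, a (a⁻¹ v) = v := fun v => by
      rw [← LinearEquiv.mul_apply, mul_inv_cancel]; rfl
    refine ⟨fun x y => ?_, fun x => ?_⟩
    · rw [← ha.1, key, key]
    · rw [← ha.2, key]

/-- `[𝔥, 𝔪]^⊥ ∩ 𝔪`. -/
def hmPerp : Submodule ℝ τ.carrier := τ.m ⊓ τ.B.orthogonal τ.hm

/-- The subgroup `Γ_decomp` of those `γ ∈ Γ` which act identically on `E = F ∩ F^⊥`, on `F / E` and
on `F^⊥ / E`, where `F = [𝔥, 𝔪]`. -/
def ΓDecomp : Subgroup (τ.m ≃ₗ[ℝ] τ.m) where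
  carrier := {γ | γ ∈ τ.Γ ∧
    (∀ x : τ.m, (x : τ.carrier) ∈ τ.hm ⊓ τ.hmPerp → γ x = x) ∧
    (∀ x : τ.m, (x : τ.carrier) ∈ τ.hm → ((γ x - x : τ.m) : τ.carrier) ∈ τ.hm ⊓ τ.hmPerp) ∧
    (∀ x : τ.m, (x : τ.carrier) ∈ τ.hmPerp → ((γ x - x : τ.m) : τ.carrier) ∈ τ.hm ⊓ τ.hmPerp)}
  mul_mem' {a b} ha hb := by
    refine ⟨mul_mem ha.1 hb.1, fun x hx => ?_, fun x hx => ?_, fun x hx => ?_⟩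
    · rw [LinearEquiv.mul_apply, hb.2.1 x hx, ha.2.1 x hx]
    · have h1 := hb.2.2.1 x hx
      have h2 := ha.2.1 _ h1
      have h3 := ha.2.2.1 x hx
      have h4 : (a * b) x - x = (b x - x) + (a x - x) := by
        rw [LinearEquiv.mul_apply]
        have : a (b x) = a (b x - x) + a x := by rw [map_sub, sub_add_cancel]
        rw [this, h2]; abel
      rw [h4]
      exact Submodule.add_mem _ h1 h3
    · have h1 := hb.2.2.2 x hx
      have h2 := ha.2.1 _ h1
      have h3 := ha.2.2.2 x hx
      have h4 : (a * b) x - x = (b x - x) + (a x - x) := by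
        rw [LinearEquiv.mul_apply]
        have : a (b x) = a (b x - x) + a x := by rw [map_sub, sub_add_cancel]
        rw [this, h2]; abel
      rw [h4]
      exact Submodule.add_mem _ h1 h3
  one_mem' := by
    refine ⟨one_mem _, fun x _ => rfl, fun x _ => ?_, fun x _ => ?_⟩ <;>
    · have : (1 : τ.m ≃ₗ[ℝ] τ.m) x - x = 0 := sub_self x
      rw [this]
      exact Submodule.zero_mem _
  inv_mem' {a} ha := by
    have key : ∀ v, a⁻¹ (a v) = v := fun v => by
      rw [← LinearEquiv.mul_apply, inv_mul_cancel]; rfl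
    have h1 : ∀ x : τ.m, (x : τ.carrier) ∈ τ.hm ⊓ τ.hmPerp → a⁻¹ x = x := fun x hx => by
      conv_lhs => rw [← ha.2.1 x hx]
      exact key x
    have h2 : ∀ x : τ.m, ((a x - x : τ.m) : τ.carrier) ∈ τ.hm ⊓ τ.hmPerp →
        ((a⁻¹ x - x : τ.m) : τ.carrier) ∈ τ.hm ⊓ τ.hmPerp := fun x hx => by
      have h3 := h1 _ hx
      rw [map_sub, key] at h3
      have h4 : a⁻¹ x - x = -(a x - x) := by rw [← h3]; abel
      rw [h4]
      exact Submodule.neg_mem _ hx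
    exact ⟨inv_mem ha.1, h1, fun x hx => h2 x (ha.2.2.1 x hx), fun x hx => h2 x (ha.2.2.2 x hx)⟩

/-- The subgroup `Γ_basis^D` of those `γ ∈ Γ` which preserve the adapted decomposition
`D = (E, W, E')`, i.e. `𝔪 = E ⊕ W ⊕ E'`. -/
def ΓBasis (E W E' : Submodule ℝ τ.carrier) : Subgroup (τ.m ≃ₗ[ℝ] τ.m) where
  carrier := {γ | γ ∈ τ.Γ ∧
    (∀ x : τ.m, (γ x : τ.carrier) ∈ E ↔ (x : τ.carrier) ∈ E) ∧
    (∀ x : τ.m, (γ x : τ.carrier) ∈ W ↔ (x : τ.carrier) ∈ W) ∧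
    (∀ x : τ.m, (γ x : τ.carrier) ∈ E' ↔ (x : τ.carrier) ∈ E')}
  mul_mem' {a b} ha hb := by
    refine ⟨mul_mem ha.1 hb.1, fun x => ?_, fun x => ?_, fun x => ?_⟩
    · rw [LinearEquiv.mul_apply, ha.2.1, hb.2.1]
    · rw [LinearEquiv.mul_apply, ha.2.2.1, hb.2.2.1]
    · rw [LinearEquiv.mul_apply, ha.2.2.2, hb.2.2.2]
  one_mem' := ⟨one_mem _, fun _ => Iff.rfl, fun _ => Iff.rfl, fun _ => Iff.rfl⟩
  inv_mem' {a} ha := by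
    have key : ∀ v, a (a⁻¹ v) = v := fun v => by
      rw [← LinearEquiv.mul_apply, mul_inv_cancel]; rfl
    refine ⟨inv_mem ha.1, fun x => ?_, fun x => ?_, fun x => ?_⟩
    · rw [← ha.2.1, key]
    · rw [← ha.2.2.1, key]
    · rw [← ha.2.2.2, key]

/-- `ad(a)|_𝔪` for `a ∈ 𝔥`. -/
def adm (a : τ.h) : Module.End ℝ τ.m where
  toFun x := ⟨⁅(a : τ.carrier), (x : τ.carrier)⁆, τ.lie_mem_m a.2 x.2⟩
  map_add' _ _ := Subtype.ext (lie_add _ _ _)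
  map_smul' _ _ := Subtype.ext (lie_smul _ _ _)

end SymmetricTriple

/-- The exponential `∑ A^k / k!` of a nilpotent endomorphism (a finite sum). -/
def nilExp {M : Type*} [AddCommGroup M] [Module ℝ M] (A : Module.End ℝ M) : Module.End ℝ M :=
  ∑ᶠ k : ℕ, ((k.factorial : ℝ)⁻¹) • A ^ k

theorem eq_zero_of_eq_neg {M : Type*} [AddCommGroup M] [Module ℝ M] {x : M} (h : x = -x) :
    x = 0 := by
  have h2 : (2 : ℝ) • x = 0 := by
    rw [two_smul]
    exact add_eq_zero_iff_eq_neg.2 h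
  exact (smul_eq_zero.1 h2).resolve_left two_ne_zero

/-! ### Algebraic curvature tensors and the normal forms -/

section Curvature

variable (V : Type v) [AddCommGroup V] [Module ℝ V]

/-- `Λ²(V^*)`, the second exterior power of the dual space. -/
abbrev Lambda2 : Type v := ⋀[ℝ]^2 (Dual ℝ V)

variable {V}

theorem update_zero {M : Type*} (a b c : M) : Function.update ![a, b] 0 c = ![c, b] := by
  ext i; fin_cases i <;> rfl

theorem update_one {M : Type*} (a b c : M) : Function.update ![a, b] 1 c = ![a, c] := by
  ext i; fin_cases i <;> rfl

/-- The wedge product `f ∧ g ∈ Λ²(V^*)`. -/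
def wedge : Dual ℝ V →ₗ[ℝ] Dual ℝ V →ₗ[ℝ] Lambda2 V :=
  LinearMap.mk₂ ℝ (fun f g => exteriorPower.ιMulti ℝ 2 ![f, g])
    (fun f f' g => by
      have h := (exteriorPower.ιMulti ℝ 2 (M := Dual ℝ V)).map_update_add ![f, g] 0 f f'
      simp only [update_zero] at h
      exact h)
    (fun c f g => by
      have h := (exteriorPower.ιMulti ℝ 2 (M := Dual ℝ V)).map_update_smul ![f, g] 0 c f
      simp only [update_zero] at h
      exact h)
    (fun f g g' => by
      have h := (exteriorPower.ιMulti ℝ 2 (M := Dual ℝ V)).map_update_add ![f, g] 1 g g'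
      simp only [update_one] at h
      exact h)
    (fun c f g => by
      have h := (exteriorPower.ιMulti ℝ 2 (M := Dual ℝ V)).map_update_smul ![f, g] 1 c g
      simp only [update_one] at h
      exact h)

theorem wedge_self (f : Dual ℝ V) : wedge f f = 0 :=
  (exteriorPower.ιMulti ℝ 2 (M := Dual ℝ V)).map_eq_zero_of_eq ![f, f] (i := 0) (j := 1) rfl
    (by decide)

theorem wedge_swap (f g : Dual ℝ V) : wedge f g = -wedge g f := by
  have h := wedge_self (f + g)
  simp only [map_add, LinearMap.add_apply, wedge_self, zero_add, add_zero] at h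
  exact eq_neg_of_add_eq_zero_right h

/-- Algebraic curvature tensors on `V^*`: a symmetric bilinear form on `Λ²(V^*)` that satisfies the
first Bianchi identity. -/
structure IsCurvatureTensor (R : LinearMap.BilinForm ℝ (Lambda2 V)) : Prop where
  symm : ∀ ω η, R ω η = R η ω
  bianchi : ∀ f₁ f₂ f₃ f₄ : Dual ℝ V,
    R (wedge f₁ f₂) (wedge f₃ f₄) + R (wedge f₂ f₃) (wedge f₁ f₄)
      + R (wedge f₃ f₁) (wedge f₂ f₄) = 0

/-- The pull-back of `R` by the map which `P^* : V^* → V^*`, `f ↦ f ∘ P`, induces on `Λ²(V^*)`. -/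
def pullbackCurv (P : V ≃ₗ[ℝ] V) (R : LinearMap.BilinForm ℝ (Lambda2 V)) :
    LinearMap.BilinForm ℝ (Lambda2 V) :=
  R.compl₁₂ (exteriorPower.map 2 (P : V →ₗ[ℝ] V).dualMap)
    (exteriorPower.map 2 (P : V →ₗ[ℝ] V).dualMap)

end Curvature

section CurvatureQuotient

variable {V : Type v} [AddCommGroup V] [Module ℝ V]

/-- The projection `π : Λ²(V^*) → Y = Λ²(V^*) / ker R`. -/
def curvProj (R : LinearMap.BilinForm ℝ (Lambda2 V)) :
    Lambda2 V →ₗ[ℝ] (Lambda2 V ⧸ LinearMap.ker R) := (LinearMap.ker R).mkQ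

/-- `R` descended in the first argument: `(π ω, η) ↦ R(ω, η)`. -/
def curvLeft (R : LinearMap.BilinForm ℝ (Lambda2 V)) :
    (Lambda2 V ⧸ LinearMap.ker R) →ₗ[ℝ] Lambda2 V →ₗ[ℝ] ℝ :=
  (LinearMap.ker R).liftQ R le_rfl

theorem curvLeft_proj (R : LinearMap.BilinForm ℝ (Lambda2 V)) (ω : Lambda2 V) :
    curvLeft R (curvProj R ω) = R ω :=
  (LinearMap.ker R).liftQ_apply R ω

/-- The form `B_Y = π_* R` on `Y`: `B_Y(π ω, π η) = R(ω, η)`. -/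
def curvForm (R : LinearMap.BilinForm ℝ (Lambda2 V)) (hR : IsCurvatureTensor R) :
    LinearMap.BilinForm ℝ (Lambda2 V ⧸ LinearMap.ker R) :=
  (LinearMap.ker R).liftQ (curvLeft R).flip (by
    intro ω hω
    rw [LinearMap.mem_ker] at hω ⊢
    refine LinearMap.ext fun y => ?_
    obtain ⟨η, rfl⟩ := Submodule.mkQ_surjective _ y
    show curvLeft R (curvProj R η) ω = 0
    rw [curvLeft_proj, hR.symm, hω, LinearMap.zero_apply])

theorem curvForm_proj (R : LinearMap.BilinForm ℝ (Lambda2 V)) (hR : IsCurvatureTensor R)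
    (ω η : Lambda2 V) : curvForm R hR (curvProj R ω) (curvProj R η) = R ω η := by
  show curvLeft R (curvProj R η) ω = R ω η
  rw [curvLeft_proj, hR.symm]

variable [FiniteDimensional ℝ V]

/-- The map `b : Y × V^* → V` with `f₄(b(π(f₁ ∧ f₂), f₃)) = R(f₁ ∧ f₂, f₃ ∧ f₄)`. -/
def curvB (R : LinearMap.BilinForm ℝ (Lambda2 V)) :
    (Lambda2 V ⧸ LinearMap.ker R) →ₗ[ℝ] Dual ℝ V →ₗ[ℝ] V :=
  LinearMap.mk₂ ℝ (fun y f => (evalEquiv ℝ V).symm (curvLeft R y ∘ₗ wedge f))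
    (fun y y' f => by rw [map_add, LinearMap.add_comp, map_add])
    (fun c y f => by rw [map_smul, LinearMap.smul_comp, map_smul])
    (fun y f f' => by rw [map_add, LinearMap.comp_add, map_add])
    (fun c y f => by rw [map_smul, LinearMap.comp_smul, map_smul])

theorem apply_curvB (R : LinearMap.BilinForm ℝ (Lambda2 V)) (y : Lambda2 V ⧸ LinearMap.ker R)
    (f g : Dual ℝ V) : g (curvB R y f) = curvLeft R y (wedge f g) := by
  have h := LinearEquiv.apply_symm_apply (evalEquiv ℝ V) (curvLeft R y ∘ₗ wedge f)
  exact LinearMap.congr_fun h g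

end CurvatureQuotient

/-- The data of a normal form `τ_{p,q}(R_b, ε, Λ)` with centre `V` (so `p = dim V`) and
`n = q - p`: an algebraic curvature tensor on `V^*`, signs and non-zero vectors of `V`, subject to
`b(Y, V^*) + span{Λ_α} = V`. -/
structure NormalFormData (V : Type v) [AddCommGroup V] [Module ℝ V] [FiniteDimensional ℝ V]
    (n : ℕ) where
  R : LinearMap.BilinForm ℝ (Lambda2 V)
  isCurvatureTensor : IsCurvatureTensor R
  ε : Fin n → ℝ
  ε_sign : ∀ α, ε α = 1 ∨ ε α = -1
  Λ : Fin n → V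
  Λ_ne_zero : ∀ α, Λ α ≠ 0
  span_eq_top : Submodule.span ℝ {x : V | ∃ y f, curvB R y f = x} ⊔
    Submodule.span ℝ (Set.range Λ) = ⊤

namespace NormalFormData

variable {V : Type v} [AddCommGroup V] [Module ℝ V] [FiniteDimensional ℝ V] {n : ℕ}
  (D : NormalFormData V n)

/-- `Y = Λ²(V^*) / ker R_b`. -/
abbrev Y : Type v := Lambda2 V ⧸ LinearMap.ker D.R

/-- The map `b : Y × V^* → V`. -/
abbrev b : D.Y →ₗ[ℝ] Dual ℝ V →ₗ[ℝ] V := curvB D.R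

/-- The underlying vector space `𝔤 = Y ⊕ W^* ⊕ 𝔷 ⊕ W ⊕ 𝔷^*`, in this order, with `𝔷 = V`, and with
`W` and `W^*` identified with `ℝ^n` by their fixed bases `W_α` and `W^*_α`. -/
def Carrier : Type v :=
  D.Y × (Fin n → ℝ) × V × (Fin n → ℝ) × Dual ℝ V

instance : AddCommGroup D.Carrier :=
  inferInstanceAs (AddCommGroup (D.Y × (Fin n → ℝ) × V × (Fin n → ℝ) × Dual ℝ V))

instance : Module ℝ D.Carrier :=
  inferInstanceAs (Module ℝ (D.Y × (Fin n → ℝ) × V × (Fin n → ℝ) × Dual ℝ V))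

instance : FiniteDimensional ℝ D.Carrier :=
  inferInstanceAs (FiniteDimensional ℝ (D.Y × (Fin n → ℝ) × V × (Fin n → ℝ) × Dual ℝ V))

/-- The component of an element of `𝔤` in `Y`. -/
def cY : D.Carrier →ₗ[ℝ] D.Y := LinearMap.fst ℝ _ _

/-- The component of an element of `𝔤` in `W^*`. -/
def cWs : D.Carrier →ₗ[ℝ] (Fin n → ℝ) := LinearMap.fst ℝ _ _ ∘ₗ LinearMap.snd ℝ D.Y _

/-- The component of an element of `𝔤` in `𝔷`. -/
def cz : D.Carrier →ₗ[ℝ] V :=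
  LinearMap.fst ℝ _ _ ∘ₗ LinearMap.snd ℝ (Fin n → ℝ) _ ∘ₗ LinearMap.snd ℝ D.Y _

/-- The component of an element of `𝔤` in `W`. -/
def cW : D.Carrier →ₗ[ℝ] (Fin n → ℝ) :=
  LinearMap.fst ℝ _ _ ∘ₗ LinearMap.snd ℝ V _ ∘ₗ LinearMap.snd ℝ (Fin n → ℝ) _ ∘ₗ
    LinearMap.snd ℝ D.Y _

/-- The component of an element of `𝔤` in `𝔷^*`. -/
def czs : D.Carrier →ₗ[ℝ] Dual ℝ V :=
  LinearMap.snd ℝ (Fin n → ℝ) _ ∘ₗ LinearMap.snd ℝ V _ ∘ₗ LinearMap.snd ℝ (Fin n → ℝ) _ ∘ₗ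
    LinearMap.snd ℝ D.Y _

/-- The element of `𝔤` with the given components in `Y`, `W^*`, `𝔷`, `W` and `𝔷^*`. -/
def elt (y : D.Y) (u : Fin n → ℝ) (x : V) (w : Fin n → ℝ) (f : Dual ℝ V) : D.Carrier :=
  (y, u, x, w, f)

@[simp] theorem cY_elt (y u x w f) : D.cY (D.elt y u x w f) = y := rfl
@[simp] theorem cWs_elt (y u x w f) : D.cWs (D.elt y u x w f) = u := rfl
@[simp] theorem cz_elt (y u x w f) : D.cz (D.elt y u x w f) = x := rfl
@[simp] theorem cW_elt (y u x w f) : D.cW (D.elt y u x w f) = w := rfl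
@[simp] theorem czs_elt (y u x w f) : D.czs (D.elt y u x w f) = f := rfl

theorem ext_carrier {x x' : D.Carrier} (h1 : D.cY x = D.cY x') (h2 : D.cWs x = D.cWs x')
    (h3 : D.cz x = D.cz x') (h4 : D.cW x = D.cW x') (h5 : D.czs x = D.czs x') : x = x' :=
  Prod.ext h1 (Prod.ext h2 (Prod.ext h3 (Prod.ext h4 h5)))

/-- The bracket. On generators its only possibly non-zero values are
`[f, g] = π(f ∧ g)`, `[f, W_α] = f(Λ_α) W^*_α`, `[y, f] = b(y, f)`, `[W^*_α, f] = ε_α f(Λ_α) W_α`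
and `[W^*_α, W_β] = -ε_α δ_{αβ} Λ_α`, for `f, g ∈ 𝔷^*` and `y ∈ Y`. -/
def bracket (x x' : D.Carrier) : D.Carrier :=
  D.elt (curvProj D.R (wedge (D.czs x) (D.czs x')))
    (fun α => D.czs x (D.Λ α) * D.cW x' α - D.czs x' (D.Λ α) * D.cW x α)
    (D.b (D.cY x) (D.czs x') - D.b (D.cY x') (D.czs x)
      - ∑ α, (D.ε α * (D.cWs x α * D.cW x' α - D.cWs x' α * D.cW x α)) • D.Λ α)
    (fun α => D.ε α * (D.cWs x α * D.czs x' (D.Λ α) - D.cWs x' α * D.czs x (D.Λ α)))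
    0

theorem b_bianchi (f₁ f₂ f₃ : Dual ℝ V) :
    D.b (curvProj D.R (wedge f₁ f₂)) f₃ + D.b (curvProj D.R (wedge f₂ f₃)) f₁
      + D.b (curvProj D.R (wedge f₃ f₁)) f₂ = 0 := by
  rw [← Module.forall_dual_apply_eq_zero_iff ℝ]
  intro g
  rw [map_add, map_add, apply_curvB, apply_curvB, apply_curvB, curvLeft_proj, curvLeft_proj,
    curvLeft_proj]
  exact D.isCurvatureTensor.bianchi f₁ f₂ f₃ g

instance : LieRing D.Carrier where
  bracket := D.bracket
  add_lie x y z := by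
    apply D.ext_carrier
    · simp [bracket]
    · ext α; simp [bracket]; ring
    · simp only [bracket, cz_elt, map_add, LinearMap.add_apply, Pi.add_apply]
      have : ∀ α, (D.ε α * ((D.cWs x α + D.cWs y α) * D.cW z α
          - D.cWs z α * (D.cW x α + D.cW y α))) • D.Λ α
          = (D.ε α * (D.cWs x α * D.cW z α - D.cWs z α * D.cW x α)) • D.Λ α
            + (D.ε α * (D.cWs y α * D.cW z α - D.cWs z α * D.cW y α)) • D.Λ α := fun α => by
        rw [← add_smul]; congr 1; ring
      simp only [this, Finset.sum_add_distrib]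
      abel
    · ext α; simp [bracket]; ring
    · simp [bracket]
  lie_add x y z := by
    apply D.ext_carrier
    · simp [bracket]
    · ext α; simp [bracket]; ring
    · simp only [bracket, cz_elt, map_add, LinearMap.add_apply, Pi.add_apply]
      have : ∀ α, (D.ε α * (D.cWs x α * (D.cW y α + D.cW z α)
          - (D.cWs y α + D.cWs z α) * D.cW x α)) • D.Λ α
          = (D.ε α * (D.cWs x α * D.cW y α - D.cWs y α * D.cW x α)) • D.Λ α
            + (D.ε α * (D.cWs x α * D.cW z α - D.cWs z α * D.cW x α)) • D.Λ α := fun α => by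
        rw [← add_smul]; congr 1; ring
      simp only [this, Finset.sum_add_distrib]
      abel
    · ext α; simp [bracket]; ring
    · simp [bracket]
  lie_self x := by
    apply D.ext_carrier
    · simp [bracket, wedge_self]
    · ext α; simp [bracket]
    · simp [bracket]
    · ext α; simp [bracket]
    · simp [bracket]
  leibniz_lie x y z := by
    apply D.ext_carrier
    · simp [bracket]
    · ext α; simp [bracket]; ring
    · have hb := D.b_bianchi (D.czs x) (D.czs y) (D.czs z)
      have h1 : ∀ f, D.b (curvProj D.R (wedge (D.czs z) (D.czs x))) f
          = - D.b (curvProj D.R (wedge (D.czs x) (D.czs z))) f := fun f => by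
        rw [wedge_swap, map_neg, map_neg, LinearMap.neg_apply]
      rw [h1] at hb
      simp only [bracket, cz_elt, map_add, cY_elt, cWs_elt, czs_elt, cW_elt,
        map_zero, LinearMap.zero_apply, zero_sub, sub_zero]
      rw [← sub_eq_zero]
      trans -(D.b (curvProj D.R (wedge (D.czs x) (D.czs y))) (D.czs z)
        + D.b (curvProj D.R (wedge (D.czs y) (D.czs z))) (D.czs x)
        + - D.b (curvProj D.R (wedge (D.czs x) (D.czs z))) (D.czs y))
      · have key : ∀ A B C S₁ S₂ S₃ : V, S₁ = S₂ + S₃ →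
            -B - S₁ - (A - S₂ + (-C - S₃)) = -(A + B + -C) := by
          intro A B C S₁ S₂ S₃ h
          subst h
          abel
        apply key
        rw [← Finset.sum_add_distrib]
        refine Finset.sum_congr rfl fun α _ => ?_
        rw [← add_smul]
        congr 1
        ring
      · rw [hb, neg_zero]
    · ext α; simp [bracket]; ring
    · simp [bracket]

instance : LieAlgebra ℝ D.Carrier where
  lie_smul c x y := by
    apply D.ext_carrier
    · change D.cY (D.bracket x (c • y)) = c • D.cY (D.bracket x y)
      simp [bracket]
    · change D.cWs (D.bracket x (c • y)) = c • D.cWs (D.bracket x y)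
      ext α; simp [bracket]; ring
    · change D.cz (D.bracket x (c • y)) = c • D.cz (D.bracket x y)
      simp only [bracket, cz_elt, map_smul, LinearMap.smul_apply, Pi.smul_apply, smul_sub,
        Finset.smul_sum, smul_smul, smul_eq_mul]
      congr 1
      refine Finset.sum_congr rfl fun α _ => ?_
      congr 1
      ring
    · change D.cW (D.bracket x (c • y)) = c • D.cW (D.bracket x y)
      ext α; simp [bracket]; ring
    · change D.czs (D.bracket x (c • y)) = c • D.czs (D.bracket x y)
      simp [bracket]

theorem lie_def (x x' : D.Carrier) : ⁅x, x'⁆ = D.bracket x x' := rfl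

/-- The linear map underlying the involution `σ`. -/
def invLin : D.Carrier →ₗ[ℝ] D.Carrier where
  toFun x := D.elt (D.cY x) (D.cWs x) (-D.cz x) (-D.cW x) (-D.czs x)
  map_add' x y := by
    apply D.ext_carrier <;> simp only [map_add, cY_elt, cWs_elt, cz_elt, cW_elt, czs_elt, neg_add]
  map_smul' c x := by
    apply D.ext_carrier <;>
      simp only [map_smul, cY_elt, cWs_elt, cz_elt, cW_elt, czs_elt, smul_neg, RingHom.id_apply]

@[simp] theorem cY_invLin (x) : D.cY (D.invLin x) = D.cY x := rfl
@[simp] theorem cWs_invLin (x) : D.cWs (D.invLin x) = D.cWs x := rfl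
@[simp] theorem cz_invLin (x) : D.cz (D.invLin x) = -D.cz x := rfl
@[simp] theorem cW_invLin (x) : D.cW (D.invLin x) = -D.cW x := rfl
@[simp] theorem czs_invLin (x) : D.czs (D.invLin x) = -D.czs x := rfl

theorem invLin_lie (x y : D.Carrier) :
    D.invLin (D.bracket x y) = D.bracket (D.invLin x) (D.invLin y) := by
  apply D.ext_carrier
  · simp [bracket]
  · ext α; simp [bracket]
  · simp only [bracket, cz_elt, cz_invLin, cY_invLin, cWs_invLin, cW_invLin, czs_invLin, map_neg,
      Pi.neg_apply]
    have : ∀ α, (D.ε α * (D.cWs x α * -D.cW y α - D.cWs y α * -D.cW x α)) • D.Λ α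
        = -((D.ε α * (D.cWs x α * D.cW y α - D.cWs y α * D.cW x α)) • D.Λ α) := fun α => by
      rw [← neg_smul]; congr 1; ring
    simp only [this, Finset.sum_neg_distrib]
    abel
  · ext α
    simp only [bracket, cW_elt, cW_invLin, cWs_invLin, czs_invLin, Pi.neg_apply,
      LinearMap.neg_apply]
    ring
  · simp [bracket]

/-- The involution `σ`, which is `1` on `𝔥 = Y ⊕ W^*` and `-1` on `𝔪 = 𝔷 ⊕ W ⊕ 𝔷^*`. -/
def inv : D.Carrier →ₗ⁅ℝ⁆ D.Carrier where
  toLinearMap := D.invLin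
  map_lie' {x y} := D.invLin_lie x y

theorem inv_apply (x : D.Carrier) : D.inv x = D.invLin x := rfl

/-- The bilinear form `B = B_Y ⊕ B_{W^*} ⊕ B_𝔷 ⊕ B_W` on `𝔤`, where `B_{W^*}(W^*_α, W^*_α) = ε_α`,
`B_𝔷(f, x) = f(x)` for `f ∈ 𝔷^*`, `x ∈ 𝔷`, and the `W_α` are orthonormal. -/
def form : LinearMap.BilinForm ℝ D.Carrier :=
  LinearMap.mk₂ ℝ
    (fun x x' => curvForm D.R D.isCurvatureTensor (D.cY x) (D.cY x')
      + ∑ α, D.ε α * (D.cWs x α * D.cWs x' α)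
      + (D.czs x (D.cz x') + D.czs x' (D.cz x))
      + ∑ α, D.cW x α * D.cW x' α)
    (fun x x' y => by
      simp only [map_add, LinearMap.add_apply, Pi.add_apply, add_mul, mul_add,
        Finset.sum_add_distrib]
      ring)
    (fun c x y => by
      simp only [map_smul, LinearMap.smul_apply, Pi.smul_apply, smul_eq_mul, mul_add,
        Finset.mul_sum]
      have h1 : ∀ α, D.ε α * (c * D.cWs x α * D.cWs y α) = c * (D.ε α * (D.cWs x α * D.cWs y α)) := fun α => by ring
      have h2 : ∀ α, c * D.cW x α * D.cW y α = c * (D.cW x α * D.cW y α) := fun α => by ring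
      simp only [h1, h2])
    (fun x y y' => by
      simp only [map_add, LinearMap.add_apply, Pi.add_apply, mul_add,
        Finset.sum_add_distrib]
      ring)
    (fun c x y => by
      simp only [map_smul, LinearMap.smul_apply, Pi.smul_apply, smul_eq_mul, mul_add,
        Finset.mul_sum]
      have h1 : ∀ α, D.ε α * (D.cWs x α * (c * D.cWs y α)) = c * (D.ε α * (D.cWs x α * D.cWs y α)) := fun α => by ring
      have h2 : ∀ α, D.cW x α * (c * D.cW y α) = c * (D.cW x α * D.cW y α) := fun α => by ring
      simp only [h1, h2])

theorem form_apply (x x' : D.Carrier) : D.form x x' =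
    curvForm D.R D.isCurvatureTensor (D.cY x) (D.cY x')
      + ∑ α, D.ε α * (D.cWs x α * D.cWs x' α)
      + (D.czs x (D.cz x') + D.czs x' (D.cz x))
      + ∑ α, D.cW x α * D.cW x' α := rfl

theorem curvForm_symm (y y' : D.Y) : curvForm D.R D.isCurvatureTensor y y'
    = curvForm D.R D.isCurvatureTensor y' y := by
  obtain ⟨ω, rfl⟩ := Submodule.mkQ_surjective _ y
  obtain ⟨η, rfl⟩ := Submodule.mkQ_surjective _ y'
  exact ((curvForm_proj D.R D.isCurvatureTensor ω η).trans
    (D.isCurvatureTensor.symm ω η)).trans (curvForm_proj D.R D.isCurvatureTensor η ω).symm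

theorem curvForm_nondeg (y : D.Y)
    (h : ∀ y', curvForm D.R D.isCurvatureTensor y y' = 0) : y = 0 := by
  obtain ⟨ω, rfl⟩ := Submodule.mkQ_surjective _ y
  rw [Submodule.mkQ_apply, Submodule.Quotient.mk_eq_zero, LinearMap.mem_ker]
  refine LinearMap.ext fun η => ?_
  exact (curvForm_proj D.R D.isCurvatureTensor ω η).symm.trans (h (curvProj D.R η))

theorem curvForm_wedge (y : D.Y) (f g : Dual ℝ V) :
    curvForm D.R D.isCurvatureTensor y (curvProj D.R (wedge f g)) = g (D.b y f) := by
  obtain ⟨ω, rfl⟩ := Submodule.mkQ_surjective _ y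
  rw [apply_curvB]
  exact (curvForm_proj D.R D.isCurvatureTensor ω _).trans
    (LinearMap.congr_fun (curvLeft_proj D.R ω) _).symm

theorem form_symm (x y : D.Carrier) : D.form x y = D.form y x := by
  rw [form_apply, form_apply, D.curvForm_symm, add_comm (D.czs x (D.cz y))]
  congr 1
  · congr 2
    exact Finset.sum_congr rfl fun α _ => by ring
  · exact Finset.sum_congr rfl fun α _ => by ring

theorem form_nondeg (x : D.Carrier) (hx : ∀ y, D.form x y = 0) : x = 0 := by
  classical
  apply D.ext_carrier
  · refine (D.curvForm_nondeg _ fun y' => ?_).trans (map_zero _).symm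
    simpa [form_apply] using hx (D.elt y' 0 0 0 0)
  · ext α
    have h : D.ε α * D.cWs x α = 0 := by
      simpa [form_apply, Pi.single_apply] using hx (D.elt 0 (Pi.single α 1) 0 0 0)
    have hε : D.ε α ≠ 0 := by
      rcases D.ε_sign α with h | h <;> rw [h] <;> norm_num
    simpa [hε] using h
  · refine Eq.trans ?_ (map_zero _).symm
    rw [← Module.forall_dual_apply_eq_zero_iff ℝ]
    intro f
    simpa [form_apply] using hx (D.elt 0 0 0 0 f)
  · ext α
    simpa [form_apply, Pi.single_apply] using hx (D.elt 0 0 0 (Pi.single α 1) 0)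
  · ext v
    simpa [form_apply] using hx (D.elt 0 0 v 0 0)

theorem form_inv (x y : D.Carrier) : D.form (D.inv x) (D.inv y) = D.form x y := by
  rw [form_apply, form_apply, inv_apply, inv_apply]
  simp

theorem b_skew (y : D.Y) (f g : Dual ℝ V) : g (D.b y f) = -f (D.b y g) := by
  rw [apply_curvB, apply_curvB, wedge_swap, map_neg]

theorem form_lie (x y z : D.Carrier) : D.form ⁅x, y⁆ z + D.form y ⁅x, z⁆ = 0 := by
  rw [form_apply, form_apply, D.lie_def, D.lie_def]
  simp only [bracket, cY_elt, cWs_elt, cz_elt, cW_elt, czs_elt, LinearMap.zero_apply, map_sub,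
    map_sum, map_smul, smul_eq_mul, zero_add, add_zero]
  rw [D.curvForm_symm _ (D.cY z), curvForm_wedge, curvForm_wedge,
    D.b_skew (D.cY x) (D.czs y) (D.czs z)]
  have key : ∑ α, D.ε α * ((D.czs x (D.Λ α) * D.cW y α - D.czs y (D.Λ α) * D.cW x α) * D.cWs z α)
      - ∑ α, D.ε α * (D.cWs x α * D.cW y α - D.cWs y α * D.cW x α) * D.czs z (D.Λ α)
      + ∑ α, D.ε α * (D.cWs x α * D.czs y (D.Λ α) - D.cWs y α * D.czs x (D.Λ α)) * D.cW z α
      + ∑ α, D.ε α * (D.cWs y α * (D.czs x (D.Λ α) * D.cW z α - D.czs z (D.Λ α) * D.cW x α))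
      - ∑ α, D.ε α * (D.cWs x α * D.cW z α - D.cWs z α * D.cW x α) * D.czs y (D.Λ α)
      + ∑ α, D.cW y α * (D.ε α * (D.cWs x α * D.czs z (D.Λ α) - D.cWs z α * D.czs x (D.Λ α)))
      = 0 := by
    simp only [← Finset.sum_add_distrib, ← Finset.sum_sub_distrib]
    exact Finset.sum_eq_zero fun α _ => by ring
  linarith [key]

theorem elt_Y_mem_span (y : D.Y) : D.elt y 0 0 0 0 ∈ Submodule.span ℝ
    {z : D.Carrier | ∃ a b : D.Carrier, D.inv a = -a ∧ D.inv b = -b ∧ ⁅a, b⁆ = z} := by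
  obtain ⟨ω, rfl⟩ := Submodule.mkQ_surjective _ y
  let L : Lambda2 V →ₗ[ℝ] D.Carrier := LinearMap.inl ℝ D.Y _ ∘ₗ curvProj D.R
  show ω ∈ (Submodule.span ℝ
    {z : D.Carrier | ∃ a b : D.Carrier, D.inv a = -a ∧ D.inv b = -b ∧ ⁅a, b⁆ = z}).comap L
  have hω : ω ∈ Submodule.span ℝ (Set.range (exteriorPower.ιMulti ℝ 2 (M := Dual ℝ V))) := by
    rw [exteriorPower.ιMulti_span]; trivial
  refine Submodule.span_le.2 ?_ hω
  rintro _ ⟨v, rfl⟩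
  have hv : exteriorPower.ιMulti ℝ 2 v = wedge (v 0) (v 1) := by
    show _ = exteriorPower.ιMulti ℝ 2 ![v 0, v 1]
    congr 1
    ext i; fin_cases i <;> rfl
  rw [hv]
  refine Submodule.subset_span ⟨D.elt 0 0 0 0 (v 0), D.elt 0 0 0 0 (v 1), ?_, ?_, ?_⟩
  · rw [inv_apply]; apply D.ext_carrier <;> simp
  · rw [inv_apply]; apply D.ext_carrier <;> simp
  · rw [D.lie_def]
    show _ = D.elt (curvProj D.R (wedge (v 0) (v 1))) 0 0 0 0
    apply D.ext_carrier
    · simp [bracket]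
    · ext α; simp [bracket]
    · simp [bracket]
    · ext α; simp [bracket]
    · simp [bracket]

theorem elt_Ws_mem_span (u : Fin n → ℝ) : D.elt 0 u 0 0 0 ∈ Submodule.span ℝ
    {z : D.Carrier | ∃ a b : D.Carrier, D.inv a = -a ∧ D.inv b = -b ∧ ⁅a, b⁆ = z} := by
  classical
  let L : (Fin n → ℝ) →ₗ[ℝ] D.Carrier := LinearMap.inr ℝ D.Y _ ∘ₗ LinearMap.inl ℝ _ _
  show u ∈ (Submodule.span ℝ
    {z : D.Carrier | ∃ a b : D.Carrier, D.inv a = -a ∧ D.inv b = -b ∧ ⁅a, b⁆ = z}).comap L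
  rw [pi_eq_sum_univ u]
  refine Submodule.sum_mem _ fun α _ => ?_
  obtain ⟨f, hf⟩ : ∃ f : Dual ℝ V, f (D.Λ α) ≠ 0 := by
    by_contra h
    push Not at h
    exact D.Λ_ne_zero α ((Module.forall_dual_apply_eq_zero_iff ℝ _).1 h)
  refine Submodule.subset_span ⟨D.elt 0 0 0 0 f,
    D.elt 0 0 0 (Pi.single α (u α * (f (D.Λ α))⁻¹)) 0, ?_, ?_, ?_⟩
  · rw [inv_apply]; apply D.ext_carrier <;> simp
  · rw [inv_apply]; apply D.ext_carrier <;> simp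
  · rw [D.lie_def]
    show _ = D.elt 0 (u α • fun j => if α = j then 1 else 0) 0 0 0
    apply D.ext_carrier
    · simp [bracket]
    · ext β
      by_cases h : α = β
      · subst h
        simp [bracket]
        field_simp
      · simp [bracket, h]
    · simp [bracket]
    · ext α; simp [bracket]
    · simp [bracket]

/-- The symmetric triple `τ_{p,q}(R_b, ε, Λ)`, with `p = dim V` and `q = p + n`. -/
def triple : SymmetricTriple.{v} where
  carrier := D.Carrier
  σ := D.inv
  σ_σ x := by rw [inv_apply, inv_apply]; apply D.ext_carrier <;> simp
  B := D.form
  B_symm := D.form_symm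
  B_nondeg := D.form_nondeg
  B_σ := D.form_inv
  B_lie := D.form_lie
  fixed_mem_span x hx := by
    rw [inv_apply] at hx
    have h3 : D.cz x = 0 := eq_zero_of_eq_neg (congrArg D.cz hx).symm
    have h4 : D.cW x = 0 := eq_zero_of_eq_neg (congrArg D.cW hx).symm
    have h5 : D.czs x = 0 := eq_zero_of_eq_neg (congrArg D.czs hx).symm
    have : x = D.elt (D.cY x) 0 0 0 0 + D.elt 0 (D.cWs x) 0 0 0 := by
      apply D.ext_carrier <;> simp [h3, h4, h5]
    rw [this]
    exact Submodule.add_mem _ (D.elt_Y_mem_span _) (D.elt_Ws_mem_span _)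

/-- The inclusion `𝔷 ⊕ W ⊕ 𝔷^* → 𝔤`. -/
def inclM : (V × (Fin n → ℝ) × Dual ℝ V) →ₗ[ℝ] D.Carrier :=
  LinearMap.inr ℝ D.Y _ ∘ₗ LinearMap.inr ℝ (Fin n → ℝ) _

/-- `𝔷 ⊕ W ⊕ 𝔷^* = 𝔪`. -/
def mEquiv : (V × (Fin n → ℝ) × Dual ℝ V) ≃ₗ[ℝ] D.triple.m where
  toFun x := ⟨D.inclM x, by
    show D.invLin (D.inclM x) = -D.inclM x
    apply D.ext_carrier
    · exact neg_zero.symm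
    · exact neg_zero.symm
    · rfl
    · rfl
    · rfl⟩
  map_add' x y := Subtype.ext (map_add D.inclM x y)
  map_smul' c x := Subtype.ext (map_smul D.inclM c x)
  invFun x := (D.cz x.1, D.cW x.1, D.czs x.1)
  left_inv _ := rfl
  right_inv x := by
    have hx : D.invLin x.1 = -x.1 := x.2
    have h1 : D.cY x.1 = 0 := eq_zero_of_eq_neg (congrArg D.cY hx)
    have h2 : D.cWs x.1 = 0 := eq_zero_of_eq_neg (congrArg D.cWs hx)
    exact Subtype.ext (D.ext_carrier h1.symm h2.symm rfl rfl rfl)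

/-- The summand `𝔷` of `𝔪`, as a subspace of `𝔤`. -/
def zSub : Submodule ℝ D.triple.carrier :=
  LinearMap.range (D.inclM ∘ₗ LinearMap.inl ℝ V _)

/-- The summand `W` of `𝔪`, as a subspace of `𝔤`. -/
def wSub : Submodule ℝ D.triple.carrier :=
  LinearMap.range (D.inclM ∘ₗ LinearMap.inr ℝ V _ ∘ₗ LinearMap.inl ℝ (Fin n → ℝ) _)

/-- The summand `𝔷^*` of `𝔪`, as a subspace of `𝔤`. -/
def zsSub : Submodule ℝ D.triple.carrier :=
  LinearMap.range (D.inclM ∘ₗ LinearMap.inr ℝ V _ ∘ₗ LinearMap.inr ℝ (Fin n → ℝ) _)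

/-- The element `y + ∑ u_α W^*_α` of `𝔥 = Y ⊕ W^*`. -/
def hElt (y : D.Y) (u : Fin n → ℝ) : D.triple.h :=
  ⟨D.elt y u 0 0 0, by
    show D.invLin (D.elt y u 0 0 0) = D.elt y u 0 0 0
    apply D.ext_carrier <;> simp⟩

end NormalFormData

section Maps

variable {V : Type v} [AddCommGroup V] [Module ℝ V] {n : ℕ}

/-- The transpose `L^t : 𝔷^* → W` of `L : W → 𝔷`, `L^t f = ∑ f(L W_α) W_α`. -/
def homTranspose (L : (Fin n → ℝ) →ₗ[ℝ] V) : Dual ℝ V →ₗ[ℝ] (Fin n → ℝ) :=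
  LinearMap.pi fun α => Dual.eval ℝ V (L (Pi.single α 1))

theorem homTranspose_neg (L : (Fin n → ℝ) →ₗ[ℝ] V) (f : Dual ℝ V) :
    homTranspose (-L) f = -homTranspose L f := by
  ext α
  simp [homTranspose]

/-- `S ∈ Skew(𝔷^*, 𝔷, B)`. -/
def IsSkewMap (S : Dual ℝ V →ₗ[ℝ] V) : Prop := ∀ f g : Dual ℝ V, f (S g) + g (S f) = 0

/-- `ρ_L ∘ ρ_S` on `𝔷 ⊕ W ⊕ 𝔷^*`, where `ρ_S` is the identity on `𝔷 ⊕ W` and `ρ_S f = f + S f`, and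
where `ρ_L` is the identity on `𝔷`, `ρ_L w = w + L w` and `ρ_L f = f - L^t f - ½ L L^t f`. -/
def rhoFun (L : (Fin n → ℝ) →ₗ[ℝ] V) (S : Dual ℝ V →ₗ[ℝ] V) :
    (V × (Fin n → ℝ) × Dual ℝ V) →ₗ[ℝ] (V × (Fin n → ℝ) × Dual ℝ V) where
  toFun x := (x.1 + L x.2.1 + S x.2.2 - (1 / 2 : ℝ) • L (homTranspose L x.2.2),
    x.2.1 - homTranspose L x.2.2, x.2.2)
  map_add' x y := by
    refine Prod.ext ?_ (Prod.ext ?_ rfl)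
    · simp only [Prod.fst_add, Prod.snd_add, map_add, smul_add]; abel
    · simp only [Prod.fst_add, Prod.snd_add, map_add]; abel
  map_smul' c x := by
    refine Prod.ext ?_ (Prod.ext ?_ rfl)
    · simp only [Prod.smul_fst, Prod.smul_snd, map_smul, RingHom.id_apply, smul_add, smul_sub,
        smul_comm c (1 / 2 : ℝ)]
    · simp only [Prod.smul_fst, Prod.smul_snd, map_smul, RingHom.id_apply, smul_sub]

theorem rhoFun_neg_rhoFun (L : (Fin n → ℝ) →ₗ[ℝ] V) (S : Dual ℝ V →ₗ[ℝ] V)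
    (x : V × (Fin n → ℝ) × Dual ℝ V) : rhoFun (-L) (-S) (rhoFun L S x) = x := by
  obtain ⟨z, w, f⟩ := x
  refine Prod.ext ?_ (Prod.ext ?_ rfl)
  · simp only [rhoFun, LinearMap.coe_mk, AddHom.coe_mk, LinearMap.neg_apply, homTranspose_neg,
      map_sub, map_neg, neg_neg]
    module
  · simp only [rhoFun, LinearMap.coe_mk, AddHom.coe_mk, homTranspose_neg]
    abel

/-- `ρ_L ∘ ρ_S` as a linear automorphism. -/
def rho (L : (Fin n → ℝ) →ₗ[ℝ] V) (S : Dual ℝ V →ₗ[ℝ] V) :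
    (V × (Fin n → ℝ) × Dual ℝ V) ≃ₗ[ℝ] (V × (Fin n → ℝ) × Dual ℝ V) :=
  { rhoFun L S with
    invFun := rhoFun (-L) (-S)
    left_inv := rhoFun_neg_rhoFun L S
    right_inv := fun x => by
      have h := rhoFun_neg_rhoFun (-L) (-S) x
      rw [neg_neg, neg_neg] at h
      exact h }

/-- `Q ∈ O(W, B|_{W × W})`, for `W = ℝ^n` with its standard scalar product. -/
def IsOrthogonalMap (Q : (Fin n → ℝ) ≃ₗ[ℝ] (Fin n → ℝ)) : Prop :=
  ∀ w w' : Fin n → ℝ, ∑ α, Q w α * Q w' α = ∑ α, w α * w' α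

/-- The map `Q_Π` of `W` with `Q_Π(W_α) = W_{Π(α)}`. -/
def permMap (π : Equiv.Perm (Fin n)) : (Fin n → ℝ) ≃ₗ[ℝ] (Fin n → ℝ) :=
  LinearEquiv.funCongrLeft ℝ ℝ π.symm

theorem permMap_single (π : Equiv.Perm (Fin n)) (α : Fin n) :
    permMap π (Pi.single α 1) = Pi.single (π α) 1 := by
  ext β
  simp [permMap, LinearEquiv.funCongrLeft_apply, LinearMap.funLeft_apply, Pi.single_apply,
    Equiv.symm_apply_eq]

end Maps

namespace NormalFormData

variable {V : Type v} [AddCommGroup V] [Module ℝ V] [FiniteDimensional ℝ V] {n : ℕ}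
  (D : NormalFormData V n)

/-- `Γ_basis^D` for the decomposition `D = (𝔷, W, 𝔷^*)`. -/
def ΓBasis : Subgroup (D.triple.m ≃ₗ[ℝ] D.triple.m) :=
  D.triple.ΓBasis D.zSub D.wSub D.zsSub

/-- The isometry `ρ_L ∘ ρ_S` of `𝔪` that corresponds to `L ∈ Hom(W, 𝔷)`, `S ∈ Skew(𝔷^*, 𝔷, B)`. -/
def decompMap (L : (Fin n → ℝ) →ₗ[ℝ] V) (S : Dual ℝ V →ₗ[ℝ] V) :
    D.triple.m ≃ₗ[ℝ] D.triple.m :=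
  D.mEquiv.symm ≪≫ₗ rho L S ≪≫ₗ D.mEquiv

/-- The map `P ⊕ Q ⊕ (P^*)⁻¹` of `𝔪 = 𝔷 ⊕ W ⊕ 𝔷^*`. -/
def basisMap (P : V ≃ₗ[ℝ] V) (Q : (Fin n → ℝ) ≃ₗ[ℝ] (Fin n → ℝ)) :
    D.triple.m ≃ₗ[ℝ] D.triple.m :=
  D.mEquiv.symm ≪≫ₗ (P.prodCongr (Q.prodCongr P.dualMap.symm)) ≪≫ₗ D.mEquiv

/-- `L ∈ Hom(W, 𝔷)` is of the form `L(W_α) = c_α Λ_α`. -/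
def IsΛHom (L : (Fin n → ℝ) →ₗ[ℝ] V) : Prop :=
  ∃ c : Fin n → ℝ, ∀ α, L (Pi.single α 1) = c α • D.Λ α

/-- The simultaneous eigenspace of the operators `pr_W ∘ ad(f)²|_W`, `f ∈ 𝔷^*`, for the
eigenvalues `χ(f)`. -/
def simEigenspace (χ : Dual ℝ V → ℝ) : Set (Fin n → ℝ) :=
  {w | ∀ f : Dual ℝ V,
    D.cW ⁅D.elt 0 0 0 0 f, ⁅D.elt 0 0 0 0 f, D.elt 0 0 0 w 0⁆⁆ = χ f • w}

/-- `Q` is an orthogonal map of `W` that preserves every simultaneous eigenspace `W_1, …, W_s`,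
i.e. `Q ∈ O(W_1) × … × O(W_s)`. -/
def IsEigenOrthogonal (Q : (Fin n → ℝ) ≃ₗ[ℝ] (Fin n → ℝ)) : Prop :=
  IsOrthogonalMap Q ∧ ∀ χ, ∀ w ∈ D.simEigenspace χ, Q w ∈ D.simEigenspace χ

/-- `exp(ad(y)|_𝔪)` for `y ∈ Y`. -/
def expY (y : D.Y) : Module.End ℝ D.triple.m := nilExp (D.triple.adm (D.hElt y 0))

/-- `exp(ad(∑ c_α W^*_α)|_𝔪)`. -/
def expWs (c : Fin n → ℝ) : Module.End ℝ D.triple.m := nilExp (D.triple.adm (D.hElt 0 c))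

/-- `γ` maps every simultaneous eigenspace `W_i ⊆ W ⊆ 𝔪` into itself. -/
def PreservesEigenspaces (γ : D.triple.m ≃ₗ[ℝ] D.triple.m) : Prop :=
  ∀ χ, ∀ w ∈ D.simEigenspace χ, ∃ w' ∈ D.simEigenspace χ,
    γ (D.mEquiv (0, w, 0)) = D.mEquiv (0, w', 0)

end NormalFormData

/-- The conditions `P^* · R_b = R̃_b`, `ε_α = ε̃_{Π(α)}` and `P(Λ_α) = ±Λ̃_{Π(α)}`. -/
structure IsoCond {V : Type v} [AddCommGroup V] [Module ℝ V] [FiniteDimensional ℝ V] {n : ℕ}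
    (D D' : NormalFormData V n) (P : V ≃ₗ[ℝ] V) (π : Equiv.Perm (Fin n)) : Prop where
  curvature : pullbackCurv P D.R = D'.R
  sign : ∀ α, D.ε α = D'.ε (π α)
  vector : ∀ α, P (D.Λ α) = D'.Λ (π α) ∨ P (D.Λ α) = -D'.Λ (π α)

end

/-!
A symmetric triple is determined by the metric space `𝔪` together with the quadrilinear form
`B([x, y], [u, v])` on `𝔪`: since `𝔤` is generated by `𝔪` and `B` is non-degenerate, an isometry
of the spaces `𝔪` that respects these forms extends to an isomorphism
(`SymmetricTriple.exists_iso_of_parametrizations`). For a normal form, `𝔪 = V ⊕ ℝ^n ⊕ V^*` with `V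
= 𝔷`, and the form is explicit (`NormalFormData.quad`). So the classification and the description
of the automorphisms are statements about isometries of `V ⊕ ℝ^n ⊕ V^*` and this form.

Part (i). In a triple of class `𝒯_{p,q}` the holonomy algebra acts nilpotently, by Lie's theorem
for the solvable Lie algebra `𝔤`. As `dim 𝔷 = p`, the form `B` is positive definite on `[𝔥, 𝔪]`
modulo `𝔷`, and `[𝔥, [𝔥, 𝔪]] ⊆ 𝔷`; together with the least-nilpotency condition this is
`SymmetricTriple.IsTame`. On `W ≅ [𝔥, 𝔪] / 𝔷` the operators `ad x ∘ ad y`, `x, y ∈ 𝔪`, are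
self-adjoint and commute, so there is an orthonormal basis of common eigenvectors `w_α`. One has
`B([x, w_α], [y, w_β]) = ε_α δ_{αβ} λ_α(x) λ_α(y)` with signs `ε_α` and linear forms `λ_α`, which
give the vectors `Λ_α`; the values of the quadrilinear form on `𝔷^*` are a curvature tensor. A
correction of the eigenvectors by central elements removes the mixed terms
(`SymmetricTriple.IsTame.exists_adapted_eigenvectors`).

Part (ii). Tameness does not involve indecomposability or a choice of decomposition. It holds for
the normal forms, it passes to direct summands, and a non-zero tame solvable indecomposable triple
is of class `𝒯_{p',q'}`. Decompositions exist because a non-degenerate `ad 𝔥`-invariant subspace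
of `𝔪` commutes with its orthogonal complement. A decomposition of a normal form induces one of
`𝔷^* = A ⊕ A'` with `π(A ∧ A') = 0`, whence the bound on `dim Y`.

Parts (iii) and (iv). An isometry that preserves the quadrilinear form preserves `V` and `V ⊕
ℝ^n`, so it is a product of `ρ_L ∘ ρ_S` and `P ⊕ Q ⊕ (P^*)⁻¹` (`exists_eq_rho_diagMap`). Comparing
the forms yields that `L W_α` is a multiple of `Λ_α`, that `P` carries one curvature tensor to the
other, and that a non-zero matrix entry `Q_{βα}` forces the quadratic forms `ε_α f(Λ_α)²` and `ε_β
f(P⁻¹ Λ_β)²` of `f` to agree. A non-zero term of the Leibniz expansion of `det Q` then provides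
the permutation. The holonomy is computed from `ad(a)³ = 0` on `𝔪` for `a ∈ 𝔥`.
-/

noncomputable section

/-! ### Symmetric triples in general -/

namespace SymmetricTriple

variable (τ : SymmetricTriple.{u})

theorem B_lie_left (x y z : τ.carrier) : τ.B ⁅x, y⁆ z = -τ.B y ⁅x, z⁆ :=
  eq_neg_of_add_eq_zero_left (τ.B_lie x y z)

theorem B_lie_assoc (x y z : τ.carrier) : τ.B ⁅x, y⁆ z = τ.B x ⁅y, z⁆ := by
  rw [← lie_skew, map_neg, LinearMap.neg_apply, B_lie_left, neg_neg]

theorem mem_z {x : τ.carrier} : x ∈ τ.z ↔ ∀ y : τ.carrier, ⁅x, y⁆ = 0 := by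
  show x ∈ LieAlgebra.center ℝ τ.carrier ↔ _
  rw [LieModule.mem_maxTrivSubmodule]
  refine forall_congr' fun y => ?_
  rw [← lie_skew, neg_eq_zero]

theorem lie_z {x y : τ.carrier} (hx : x ∈ τ.z) : ⁅x, y⁆ = 0 := τ.mem_z.1 hx y

theorem lie_z' {x y : τ.carrier} (hx : x ∈ τ.z) : ⁅y, x⁆ = 0 := by
  rw [← lie_skew, τ.lie_z hx, neg_zero]

theorem exists_h_add_m (x : τ.carrier) : ∃ a ∈ τ.h, ∃ y ∈ τ.m, x = a + y := by
  refine ⟨(1 / 2 : ℝ) • (x + τ.σ x), ?_, (1 / 2 : ℝ) • (x - τ.σ x), ?_, by module⟩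
  · rw [mem_h, map_smul, map_add, σ_σ, add_comm]
  · rw [mem_m, map_smul, map_sub, σ_σ, ← smul_neg, neg_sub]

theorem B_h_m {a x : τ.carrier} (ha : a ∈ τ.h) (hx : x ∈ τ.m) : τ.B a x = 0 := by
  have h := τ.B_σ a x
  rw [τ.mem_h.1 ha, τ.mem_m.1 hx, map_neg] at h
  linarith

theorem eq_zero_of_m {x : τ.carrier} (hx : x ∈ τ.m) (h : ∀ y ∈ τ.m, τ.B x y = 0) : x = 0 := by
  refine τ.B_nondeg x fun y => ?_
  obtain ⟨a, ha, y, hy, rfl⟩ := τ.exists_h_add_m y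
  rw [map_add, h y hy, τ.B_symm, τ.B_h_m ha hx, add_zero]

theorem eq_zero_of_h {x : τ.carrier} (hx : x ∈ τ.h) (h : ∀ y ∈ τ.h, τ.B x y = 0) : x = 0 := by
  refine τ.B_nondeg x fun y => ?_
  obtain ⟨a, ha, y, hy, rfl⟩ := τ.exists_h_add_m y
  rw [map_add, h a ha, τ.B_h_m hx hy, add_zero]

/-- Linear properties of elements of `𝔥` need only be checked on brackets of elements of `𝔪`. -/
theorem h_induction {N : Submodule ℝ τ.carrier}
    (H : ∀ x ∈ τ.m, ∀ y ∈ τ.m, ⁅x, y⁆ ∈ N) : τ.h ≤ N := by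
  intro a ha
  refine Submodule.span_le.2 ?_ (τ.fixed_mem_span a ha)
  rintro _ ⟨x, y, hx, hy, rfl⟩
  exact H x hx y hy

theorem eq_zero_of_h' {x : τ.carrier} (hx : x ∈ τ.h)
    (h : ∀ y ∈ τ.m, ∀ y' ∈ τ.m, τ.B x ⁅y, y'⁆ = 0) : x = 0 := by
  refine τ.eq_zero_of_h hx fun y hy => ?_
  exact τ.h_induction (N := LinearMap.ker (τ.B x)) h hy

/-- The action of `𝔥` on `𝔪` is faithful. -/
theorem eq_zero_of_lie_m {a : τ.carrier} (ha : a ∈ τ.h) (h : ∀ x ∈ τ.m, ⁅a, x⁆ = 0) : a = 0 := by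
  refine τ.eq_zero_of_h' ha fun y hy y' _ => ?_
  rw [← τ.B_lie_assoc, h y hy, map_zero, LinearMap.zero_apply]

theorem lie_mem_hm {a x : τ.carrier} (ha : a ∈ τ.h) (hx : x ∈ τ.m) : ⁅a, x⁆ ∈ τ.hm :=
  Submodule.subset_span ⟨a, x, ha, hx, rfl⟩

theorem lie_mem_hm' {a x : τ.carrier} (ha : a ∈ τ.h) (hx : x ∈ τ.m) : ⁅x, a⁆ ∈ τ.hm := by
  rw [← lie_skew]
  exact τ.hm.neg_mem (τ.lie_mem_hm ha hx)

theorem hm_le_iff {N : Submodule ℝ τ.carrier} :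
    τ.hm ≤ N ↔ ∀ a ∈ τ.h, ∀ x ∈ τ.m, ⁅a, x⁆ ∈ N := by
  refine ⟨fun H a ha x hx => H (τ.lie_mem_hm ha hx), fun H => Submodule.span_le.2 ?_⟩
  rintro _ ⟨a, x, ha, hx, rfl⟩
  exact H a ha x hx

theorem hm_le_m : τ.hm ≤ τ.m := τ.hm_le_iff.2 fun _ ha _ hx => τ.lie_mem_m ha hx

theorem mem_z_of_m {x : τ.carrier} (h : ∀ y ∈ τ.m, ⁅x, y⁆ = 0) : x ∈ τ.z := by
  have hh : ∀ a ∈ τ.h, ⁅x, a⁆ = 0 := by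
    intro a ha
    refine τ.h_induction (N := LinearMap.ker (LieAlgebra.ad ℝ τ.carrier x)) ?_ ha
    intro y hy y' hy'
    rw [LinearMap.mem_ker, LieAlgebra.ad_apply, leibniz_lie, h y hy, h y' hy', zero_lie, lie_zero,
      add_zero]
  rw [mem_z]
  intro y
  obtain ⟨a, ha, y, hy, rfl⟩ := τ.exists_h_add_m y
  rw [lie_add, hh a ha, h y hy, add_zero]

theorem mem_z_of_lie_h {x : τ.carrier} (hx : x ∈ τ.m) (h : ∀ a ∈ τ.h, ⁅a, x⁆ = 0) : x ∈ τ.z := by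
  refine τ.mem_z_of_m fun y hy => τ.eq_zero_of_h (τ.lie_mem_h hx hy) fun a ha => ?_
  rw [τ.B_symm, ← τ.B_lie_assoc, h a ha, map_zero, LinearMap.zero_apply]

theorem z_le_m : τ.z ≤ τ.m := by
  intro x hx
  obtain ⟨a, ha, y, hy, rfl⟩ := τ.exists_h_add_m x
  have ha0 : a = 0 := by
    refine τ.eq_zero_of_lie_m ha fun w hw => ?_
    have h1 := τ.lie_z (y := w) hx
    rw [add_lie] at h1
    have h2 : τ.σ ⁅a, w⁆ = -⁅a, w⁆ := τ.lie_mem_m ha hw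
    have h3 : τ.σ ⁅y, w⁆ = ⁅y, w⁆ := τ.lie_mem_h hy hw
    rw [← eq_neg_iff_add_eq_zero] at h1
    rw [h1, map_neg, h3, neg_neg] at h2
    rw [h1, eq_zero_of_eq_neg h2.symm, neg_zero]
  rw [ha0, zero_add]
  exact hy

/-- The centre is the orthogonal complement of `[𝔥, 𝔪]` in `𝔪`. -/
theorem mem_z_iff {x : τ.carrier} : x ∈ τ.z ↔ x ∈ τ.m ∧ ∀ w ∈ τ.hm, τ.B x w = 0 := by
  constructor
  · refine fun hx => ⟨τ.z_le_m hx, fun w hw => ?_⟩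
    refine (τ.hm_le_iff (N := LinearMap.ker (τ.B x))).2 (fun a ha y hy => ?_) hw
    rw [LinearMap.mem_ker, ← τ.B_lie_assoc, τ.lie_z hx, map_zero, LinearMap.zero_apply]
  · rintro ⟨hx, h⟩
    refine τ.mem_z_of_lie_h hx fun a ha => τ.eq_zero_of_m (τ.lie_mem_m ha hx) fun y hy => ?_
    rw [τ.B_lie_left, h _ (τ.lie_mem_hm ha hy), neg_zero]

theorem B_z_hm {x w : τ.carrier} (hx : x ∈ τ.z) (hw : w ∈ τ.hm) : τ.B x w = 0 :=
  (τ.mem_z_iff.1 hx).2 w hw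

theorem B_hm_z {x w : τ.carrier} (hx : x ∈ τ.z) (hw : w ∈ τ.hm) : τ.B w x = 0 := by
  rw [τ.B_symm, τ.B_z_hm hx hw]

theorem B_isRefl : τ.B.IsRefl := fun x y h => by rw [τ.B_symm, h]

theorem B_nondegenerate : τ.B.Nondegenerate :=
  ⟨fun x h => τ.B_nondeg x h, fun x h => τ.B_nondeg x fun y => (τ.B_symm x y).trans (h y)⟩

theorem h_inf_m : τ.h ⊓ τ.m = ⊥ := by
  rw [eq_bot_iff]
  rintro x ⟨h1, h2⟩
  exact eq_zero_of_eq_neg ((τ.mem_h.1 h1).symm.trans (τ.mem_m.1 h2))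

theorem h_sup_m : τ.h ⊔ τ.m = ⊤ := by
  rw [eq_top_iff]
  rintro x -
  obtain ⟨a, ha, y, hy, rfl⟩ := τ.exists_h_add_m x
  exact Submodule.add_mem_sup ha hy

theorem orthogonal_hm : τ.B.orthogonal τ.hm = τ.h ⊔ τ.z := by
  apply le_antisymm
  · intro x hx
    obtain ⟨a, ha, y, hy, rfl⟩ := τ.exists_h_add_m x
    refine Submodule.add_mem_sup ha (τ.mem_z_iff.2 ⟨hy, fun w hw => ?_⟩)
    have h : τ.B w (a + y) = 0 := hx w hw
    rw [map_add, τ.B_symm w a, τ.B_h_m ha (τ.hm_le_m hw),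
      zero_add] at h
    rw [τ.B_symm, h]
  · refine sup_le (fun a ha w hw => ?_) fun x hx w hw => ?_
    · show τ.B w a = 0
      rw [τ.B_symm, τ.B_h_m ha (τ.hm_le_m hw)]
    · exact τ.B_hm_z hx hw

/-- `[𝔥, 𝔪]` is the orthogonal complement of the centre in `𝔪`. -/
theorem mem_hm_of_B_z {x : τ.carrier} (hx : x ∈ τ.m) (h : ∀ v ∈ τ.z, τ.B x v = 0) :
    x ∈ τ.hm := by
  rw [← LinearMap.BilinForm.orthogonal_orthogonal τ.B_nondegenerate τ.B_isRefl τ.hm,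
    τ.orthogonal_hm]
  intro y hy
  obtain ⟨a, ha, v, hv, rfl⟩ := Submodule.mem_sup.1 hy
  show τ.B (a + v) x = 0
  rw [map_add, LinearMap.add_apply, τ.B_h_m ha hx, τ.B_symm, h v hv,
    add_zero]

theorem hmPerp_eq_z : τ.hmPerp = τ.z := by
  ext x
  rw [mem_z_iff]
  refine and_congr Iff.rfl (forall_congr' fun w => forall_congr' fun _ => ?_)
  show τ.B w x = 0 ↔ _
  rw [τ.B_symm]

theorem finrank_h_add_finrank_m :
    finrank ℝ τ.h + finrank ℝ τ.m = finrank ℝ τ.carrier := by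
  have h := Submodule.finrank_sup_add_finrank_inf_eq τ.h τ.m
  rw [h_sup_m, h_inf_m, finrank_bot, finrank_top, add_zero] at h
  exact h.symm

theorem finrank_hm_add_finrank_z : finrank ℝ τ.hm + finrank ℝ τ.z = finrank ℝ τ.m := by
  have h1 := LinearMap.BilinForm.finrank_orthogonal τ.B_nondegenerate τ.hm
  have h2 := Submodule.finrank_sup_add_finrank_inf_eq τ.h τ.z
  have h3 : τ.h ⊓ τ.z = ⊥ := eq_bot_iff.2 ((inf_le_inf_left _ τ.z_le_m).trans τ.h_inf_m.le)
  have h4 := τ.finrank_h_add_finrank_m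
  have h5 : finrank ℝ τ.hm ≤ finrank ℝ τ.carrier := Submodule.finrank_le _
  rw [orthogonal_hm] at h1
  rw [h3, finrank_bot] at h2
  omega

end SymmetricTriple

/-! ### Extending isometries of `𝔪` -/

namespace SymmetricTriple

open TensorProduct in
theorem surjective_of_tensor {τ : SymmetricTriple.{u}} {X : Type*} [AddCommGroup X] [Module ℝ X]
    (F : X →ₗ[ℝ] τ.carrier) (T : X × (X ⊗[ℝ] X) →ₗ[ℝ] τ.carrier) (hF : LinearMap.range F = τ.m)
    (h1 : ∀ x, T (x, 0) = F x) (h2 : ∀ x y, T (0, x ⊗ₜ y) = ⁅F x, F y⁆) :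
    Function.Surjective T := by
  rw [← LinearMap.range_eq_top, eq_top_iff, ← τ.h_sup_m]
  refine sup_le (τ.h_induction ?_) ?_
  · intro x hx y hy
    rw [← hF] at hx hy
    obtain ⟨x, rfl⟩ := hx
    obtain ⟨y, rfl⟩ := hy
    exact ⟨_, h2 x y⟩
  · rw [← hF]
    rintro _ ⟨x, rfl⟩
    exact ⟨_, h1 x⟩

open TensorProduct in
/-- A linear isometry between the `(-1)`-eigenspaces `𝔪` of two symmetric triples which respects the
quadrilinear form `B([x, y], [u, v])` extends to an isomorphism of the triples. The isometry is
given by two parametrizations `F₁`, `F₂` of the spaces `𝔪` by the same vector space. As `𝔤` is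
generated by `𝔪`, both `𝔤₁` and `𝔤₂` are quotients of `X × (X ⊗ X)`, and by non-degeneracy the
kernels are the radicals of the same form. -/
theorem exists_iso_of_parametrizations {τ₁ : SymmetricTriple.{u}} {τ₂ : SymmetricTriple.{v}}
    {X : Type*} [AddCommGroup X] [Module ℝ X] (F₁ : X →ₗ[ℝ] τ₁.carrier) (F₂ : X →ₗ[ℝ] τ₂.carrier)
    (hF₁ : LinearMap.range F₁ = τ₁.m) (hF₂ : LinearMap.range F₂ = τ₂.m)
    (hB : ∀ x y, τ₂.B (F₂ x) (F₂ y) = τ₁.B (F₁ x) (F₁ y))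
    (hR : ∀ x y x' y', τ₂.B ⁅F₂ x, F₂ y⁆ ⁅F₂ x', F₂ y'⁆ = τ₁.B ⁅F₁ x, F₁ y⁆ ⁅F₁ x', F₁ y'⁆) :
    ∃ Φ : τ₁.Iso τ₂, ∀ x, Φ.toLieEquiv (F₁ x) = F₂ x := by
  have hm₁ : ∀ x, F₁ x ∈ τ₁.m := fun x => hF₁ ▸ LinearMap.mem_range_self F₁ x
  have hm₂ : ∀ x, F₂ x ∈ τ₂.m := fun x => hF₂ ▸ LinearMap.mem_range_self F₂ x
  have hh₁ : ∀ x y, ⁅F₁ x, F₁ y⁆ ∈ τ₁.h := fun x y => τ₁.lie_mem_h (hm₁ x) (hm₁ y)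
  have hh₂ : ∀ x y, ⁅F₂ x, F₂ y⁆ ∈ τ₂.h := fun x y => τ₂.lie_mem_h (hm₂ x) (hm₂ y)
  let T₁ : X × (X ⊗[ℝ] X) →ₗ[ℝ] τ₁.carrier := F₁.coprod (TensorProduct.lift
    ((LieModule.toEnd ℝ τ₁.carrier τ₁.carrier : τ₁.carrier →ₗ[ℝ] End ℝ τ₁.carrier).compl₁₂ F₁ F₁))
  let T₂ : X × (X ⊗[ℝ] X) →ₗ[ℝ] τ₂.carrier := F₂.coprod (TensorProduct.lift
    ((LieModule.toEnd ℝ τ₂.carrier τ₂.carrier : τ₂.carrier →ₗ[ℝ] End ℝ τ₂.carrier).compl₁₂ F₂ F₂))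
  have hT₁ : ∀ x, T₁ (x, 0) = F₁ x := fun x => by simp [T₁]
  have hT₂ : ∀ x, T₂ (x, 0) = F₂ x := fun x => by simp [T₂]
  have hT₁' : ∀ x y, T₁ (0, x ⊗ₜ y) = ⁅F₁ x, F₁ y⁆ := fun x y => by simp [T₁]
  have hT₂' : ∀ x y, T₂ (0, x ⊗ₜ y) = ⁅F₂ x, F₂ y⁆ := fun x y => by simp [T₂]
  have surj₁ := surjective_of_tensor F₁ T₁ hF₁ hT₁ hT₁'
  have surj₂ := surjective_of_tensor F₂ T₂ hF₂ hT₂ hT₂'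
  have hBT : τ₂.B.compl₁₂ T₂ T₂ = τ₁.B.compl₁₂ T₁ T₁ := by
    ext x y
    · simpa [hT₁, hT₂] using hB x y
    · rename_i z
      simp [hT₁, hT₂, hT₁', hT₂', τ₁.B_symm (F₁ _), τ₂.B_symm (F₂ _), τ₁.B_h_m (hh₁ _ _) (hm₁ _),
        τ₂.B_h_m (hh₂ _ _) (hm₂ _)]
    · rename_i z
      simp [hT₁, hT₂, hT₁', hT₂', τ₁.B_h_m (hh₁ _ _) (hm₁ _), τ₂.B_h_m (hh₂ _ _) (hm₂ _)]
    · simp [hT₁', hT₂', hR]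
  have hBT' : ∀ p q, τ₂.B (T₂ p) (T₂ q) = τ₁.B (T₁ p) (T₁ q) := fun p q =>
    LinearMap.congr_fun (LinearMap.congr_fun hBT p) q
  obtain ⟨G, hG⟩ := T₁.exists_rightInverse_of_surjective (LinearMap.range_eq_top.2 surj₁)
  have hG' : ∀ x, T₁ (G x) = x := fun x => LinearMap.congr_fun hG x
  let Φ : τ₁.carrier →ₗ[ℝ] τ₂.carrier := T₂ ∘ₗ G
  have hΦ : ∀ p, Φ (T₁ p) = T₂ p := by
    intro p
    rw [← sub_eq_zero]
    refine τ₂.B_nondeg _ fun y => ?_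
    obtain ⟨q, rfl⟩ := surj₂ y
    show τ₂.B (T₂ (G (T₁ p)) - T₂ p) (T₂ q) = 0
    rw [← map_sub, hBT', map_sub, hG', sub_self, map_zero, LinearMap.zero_apply]
  have hΦF : ∀ x, Φ (F₁ x) = F₂ x := fun x => by rw [← hT₁, hΦ, hT₂]
  have hΦL : ∀ x y, Φ ⁅F₁ x, F₁ y⁆ = ⁅F₂ x, F₂ y⁆ := fun x y => by rw [← hT₁', hΦ, hT₂']
  have hΦB : ∀ x y, τ₂.B (Φ x) (Φ y) = τ₁.B x y := by
    intro x y
    obtain ⟨p, rfl⟩ := surj₁ x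
    obtain ⟨q, rfl⟩ := surj₁ y
    rw [hΦ, hΦ, hBT']
  have hΦσ : Φ ∘ₗ (τ₁.σ : τ₁.carrier →ₗ[ℝ] τ₁.carrier) =
      (τ₂.σ : τ₂.carrier →ₗ[ℝ] τ₂.carrier) ∘ₗ Φ := by
    refine (LinearMap.cancel_right surj₁).1 ?_
    ext x
    · have h1 : τ₁.σ (F₁ x) = -F₁ x := hm₁ x
      have h2 : τ₂.σ (F₂ x) = -F₂ x := hm₂ x
      simp [hT₁, hΦF, h1, h2]
    · rename_i y
      have h1 : ⁅τ₁.σ (F₁ x), τ₁.σ (F₁ y)⁆ = ⁅F₁ x, F₁ y⁆ := by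
        rw [← LieHom.map_lie]; exact hh₁ x y
      have h2 : ⁅τ₂.σ (F₂ x), τ₂.σ (F₂ y)⁆ = ⁅F₂ x, F₂ y⁆ := by
        rw [← LieHom.map_lie]; exact hh₂ x y
      simp [hT₁', hΦL, h1, h2]
  have mem_m₁ : ∀ {y}, y ∈ τ₁.m → ∃ x, F₁ x = y := fun {y} hy => by rwa [← hF₁] at hy
  -- brackets of `𝔥` and `𝔪`, detected by pairing with `𝔪`
  have hΦhm : ∀ x y z, Φ ⁅⁅F₁ x, F₁ y⁆, F₁ z⁆ = ⁅⁅F₂ x, F₂ y⁆, F₂ z⁆ := by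
    intro x y z
    obtain ⟨w, hw⟩ := mem_m₁ (τ₁.lie_mem_m (hh₁ x y) (hm₁ z))
    rw [← sub_eq_zero]
    refine τ₂.eq_zero_of_m ?_ fun v hv => ?_
    · rw [← hw, hΦF]
      exact τ₂.m.sub_mem (hm₂ w) (τ₂.lie_mem_m (hh₂ x y) (hm₂ z))
    · rw [← hF₂] at hv
      obtain ⟨v, rfl⟩ := hv
      rw [map_sub, LinearMap.sub_apply, τ₂.B_lie_assoc _ (F₂ z), hR, ← τ₁.B_lie_assoc, ← hΦF v, hΦB,
        sub_self]
  have hΦhm' : ∀ a ∈ τ₁.h, ∀ z ∈ τ₁.m, Φ ⁅a, z⁆ = ⁅Φ a, Φ z⁆ := by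
    intro a ha z hz
    obtain ⟨z, rfl⟩ := mem_m₁ hz
    have h := τ₁.h_induction (N := LinearMap.eqLocus
      (Φ ∘ₗ ((LieModule.toEnd ℝ τ₁.carrier τ₁.carrier : τ₁.carrier →ₗ[ℝ] End ℝ τ₁.carrier).flip
        (F₁ z)))
      (((LieModule.toEnd ℝ τ₂.carrier τ₂.carrier : τ₂.carrier →ₗ[ℝ] End ℝ τ₂.carrier).flip
        (Φ (F₁ z))) ∘ₗ Φ)) ?_ ha
    · exact h
    · intro x hx y hy
      obtain ⟨x, rfl⟩ := mem_m₁ hx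
      obtain ⟨y, rfl⟩ := mem_m₁ hy
      show Φ ⁅⁅F₁ x, F₁ y⁆, F₁ z⁆ = ⁅Φ ⁅F₁ x, F₁ y⁆, Φ (F₁ z)⁆
      rw [hΦhm, hΦL, hΦF]
  have hΦmm : ∀ x ∈ τ₁.m, ∀ y ∈ τ₁.m, Φ ⁅x, y⁆ = ⁅Φ x, Φ y⁆ := by
    intro x hx y hy
    obtain ⟨x, rfl⟩ := mem_m₁ hx
    obtain ⟨y, rfl⟩ := mem_m₁ hy
    rw [hΦL, hΦF, hΦF]
  have hΦhh : ∀ a ∈ τ₁.h, ∀ b ∈ τ₁.h, Φ ⁅a, b⁆ = ⁅Φ a, Φ b⁆ := by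
    intro a ha b hb
    have h := τ₁.h_induction (N := LinearMap.eqLocus
      (Φ ∘ₗ (LieModule.toEnd ℝ τ₁.carrier τ₁.carrier a))
      ((LieModule.toEnd ℝ τ₂.carrier τ₂.carrier (Φ a)) ∘ₗ Φ)) ?_ hb
    · exact h
    · intro x hx y hy
      show Φ ⁅a, ⁅x, y⁆⁆ = ⁅Φ a, Φ ⁅x, y⁆⁆
      rw [leibniz_lie, map_add, hΦmm _ (τ₁.lie_mem_m ha hx) _ hy, hΦmm _ hx _ (τ₁.lie_mem_m ha hy),
        hΦmm _ hx _ hy, hΦhm' _ ha _ hx, hΦhm' _ ha _ hy, ← leibniz_lie]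
  have hΦlie : ∀ x y, Φ ⁅x, y⁆ = ⁅Φ x, Φ y⁆ := by
    intro x y
    obtain ⟨a, ha, x, hx, rfl⟩ := τ₁.exists_h_add_m x
    obtain ⟨b, hb, y, hy, rfl⟩ := τ₁.exists_h_add_m y
    have h1 : Φ ⁅x, b⁆ = ⁅Φ x, Φ b⁆ := by
      rw [← lie_skew, map_neg, hΦhm' _ hb _ hx, lie_skew]
    simp only [add_lie, lie_add, map_add, hΦhh a ha b hb, hΦmm x hx y hy, hΦhm' a ha y hy, h1]
  have inj : Function.Injective Φ := by
    rw [← LinearMap.ker_eq_bot, LinearMap.ker_eq_bot']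
    intro x hx
    refine τ₁.B_nondeg x fun y => ?_
    rw [← hΦB, hx, map_zero, LinearMap.zero_apply]
  have surjΦ : Function.Surjective Φ := by
    intro y
    obtain ⟨q, rfl⟩ := surj₂ y
    exact ⟨_, hΦ q⟩
  let e : τ₁.carrier ≃ₗ[ℝ] τ₂.carrier := LinearEquiv.ofBijective Φ ⟨inj, surjΦ⟩
  exact ⟨⟨{ e with map_lie' := hΦlie _ _ }, fun x => LinearMap.congr_fun hΦσ x, hΦB⟩, hΦF⟩

end SymmetricTriple

/-! ### Witt frames -/

namespace SymmetricTriple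

/-- A linear parametrization of `𝔪` by `V ⊕ ℝ^n ⊕ V^*` that carries the canonical pairing of `V` and
`V^*` plus the Euclidean form of `ℝ^n` to `B`, that maps `V` into the centre and `V ⊕ ℝ^n` into
`[𝔥, 𝔪]`. It is the same as an adapted decomposition with positive definite `W` together with an
orthonormal basis of `W` and an identification of the centre with `V`. -/
structure Frame (τ : SymmetricTriple.{u}) (V : Type v) [AddCommGroup V] [Module ℝ V] (n : ℕ) where
  toLin : (V × (Fin n → ℝ) × Dual ℝ V) →ₗ[ℝ] τ.carrier
  range_eq : LinearMap.range toLin = τ.m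
  form : ∀ x x', τ.B (toLin x) (toLin x') =
    x.2.2 x'.1 + x'.2.2 x.1 + ∑ α, x.2.1 α * x'.2.1 α
  mem_z : ∀ v, toLin (v, 0, 0) ∈ τ.z
  mem_hm : ∀ v w, toLin (v, w, 0) ∈ τ.hm

namespace Frame

variable {τ : SymmetricTriple.{u}} {V : Type v} [AddCommGroup V] [Module ℝ V] {n : ℕ}
  (F : Frame τ V n)

theorem mem_m (x) : F.toLin x ∈ τ.m := F.range_eq ▸ LinearMap.mem_range_self F.toLin x

theorem exists_eq {x : τ.carrier} (hx : x ∈ τ.m) : ∃ y, F.toLin y = x := by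
  rwa [← F.range_eq] at hx

theorem mem_hm_iff {x} : F.toLin x ∈ τ.hm ↔ x.2.2 = 0 := by
  constructor
  · intro hx
    ext v
    simpa [F.form] using τ.B_hm_z (F.mem_z v) hx
  · obtain ⟨v, w, f⟩ := x
    rintro rfl
    exact F.mem_hm v w

theorem mem_z_iff {x} : F.toLin x ∈ τ.z ↔ x.2 = 0 := by
  classical
  constructor
  · intro hx
    have h1 : ∀ (v : V) (w : Fin n → ℝ), x.2.2 v + ∑ α, x.2.1 α * w α = 0 := fun v w => by
      simpa [F.form] using τ.B_z_hm hx (F.mem_hm v w)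
    refine Prod.ext ?_ ?_
    · ext α
      simpa [Pi.single_apply] using h1 0 (Pi.single α 1)
    · ext v
      simpa using h1 v 0
  · obtain ⟨v, w, f⟩ := x
    rintro ⟨⟩
    exact F.mem_z v

theorem injective : Function.Injective F.toLin := by
  rw [← LinearMap.ker_eq_bot, LinearMap.ker_eq_bot']
  rintro ⟨v, w, f⟩ hx
  have h2 : (w, f) = 0 := F.mem_z_iff.1 (hx ▸ τ.z.zero_mem)
  obtain ⟨rfl, rfl⟩ := Prod.mk.inj h2
  have hv : v = 0 := by
    rw [← Module.forall_dual_apply_eq_zero_iff ℝ]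
    intro g
    have := F.form (v, 0, 0) (0, 0, g)
    rw [hx] at this
    simpa using this.symm
  rw [hv]; rfl

theorem finrank_m [FiniteDimensional ℝ V] (F : Frame τ V n) :
    finrank ℝ τ.m = 2 * finrank ℝ V + n := by
  rw [← F.range_eq, LinearMap.finrank_range_of_inj F.injective, finrank_prod, finrank_prod,
    Subspace.dual_finrank_eq, finrank_fin_fun]
  ring

/-- The signature of `B` on `𝔪` can be read off from a frame: the vectors `f ± e(f) + w`, where `e
: V^* → V` is given by the Euclidean form of a basis of `V`, span definite subspaces of dimensions
that add up to `dim 𝔪`. -/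
theorem hasSignature [FiniteDimensional ℝ V] (F : Frame τ V n) :
    τ.HasSignature (finrank ℝ V) (finrank ℝ V + n) := by
  set Q := (τ.B.restrict τ.m).toQuadraticMap with hQ
  have hQa : ∀ x : τ.m, Q x = τ.B x x := fun x => rfl
  let b := finBasis ℝ V
  let e : Dual ℝ V →ₗ[ℝ] V := ∑ i, (Dual.eval ℝ V (b i)).smulRight (b i)
  have he : ∀ f : Dual ℝ V, f (e f) = ∑ i, f (b i) ^ 2 := fun f => by
    simp [e, LinearMap.sum_apply, pow_two]
  have he0 : ∀ f : Dual ℝ V, 0 ≤ f (e f) := fun f => by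
    rw [he]; positivity
  have he1 : ∀ f : Dual ℝ V, f (e f) = 0 → f = 0 := fun f hf => by
    rw [he, Finset.sum_eq_zero_iff_of_nonneg (fun _ _ => by positivity)] at hf
    refine b.ext fun i => ?_
    simpa using hf i (Finset.mem_univ i)
  let F' : (V × (Fin n → ℝ) × Dual ℝ V) →ₗ[ℝ] τ.m := F.toLin.codRestrict τ.m F.mem_m
  have hF' : Function.Injective F' := fun x y h => F.injective (congrArg Subtype.val h)
  let N : Dual ℝ V →ₗ[ℝ] τ.m := F' ∘ₗ (-e).prod (LinearMap.inr ℝ _ _)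
  let P : ((Fin n → ℝ) × Dual ℝ V) →ₗ[ℝ] τ.m :=
    F' ∘ₗ (e ∘ₗ LinearMap.snd ℝ _ _).prod LinearMap.id
  have hN : Function.Injective N := by
    refine hF'.comp fun f g h => ?_
    exact (Prod.mk.inj (Prod.mk.inj h).2).2
  have hP : Function.Injective P := by
    refine hF'.comp fun f g h => ?_
    exact (Prod.mk.inj h).2
  have hQN : ∀ f, Q (N f) = -(2 * f (e f)) := fun f => by
    rw [hQa]
    show τ.B (F.toLin (-e f, 0, f)) (F.toLin (-e f, 0, f)) = _
    rw [F.form]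
    simp
    ring
  have hQP : ∀ w f, Q (P (w, f)) = 2 * f (e f) + ∑ α, w α ^ 2 := fun w f => by
    rw [hQa]
    show τ.B (F.toLin (e f, w, f)) (F.toLin (e f, w, f)) = _
    rw [F.form]
    simp [pow_two]
    ring
  have h1 : finrank ℝ V ≤ sigNeg Q := by
    have : ((-Q).restrict (LinearMap.range N)).PosDef := by
      rintro ⟨_, f, rfl⟩ hf
      have hf0 : f ≠ 0 := fun h => hf (by ext1; simp [h])
      show 0 < -Q (N f)
      rw [hQN, neg_neg]
      exact mul_pos two_pos ((he0 f).lt_of_ne fun h => hf0 (he1 f h.symm))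
    have := le_sigNeg_of_negDef Q this
    rwa [LinearMap.finrank_range_of_inj hN, Subspace.dual_finrank_eq] at this
  have h2 : finrank ℝ V + n ≤ sigPos Q := by
    have : (Q.restrict (LinearMap.range P)).PosDef := by
      rintro ⟨_, ⟨w, f⟩, rfl⟩ hf
      show 0 < Q (P (w, f))
      have hs : 0 ≤ ∑ α, w α ^ 2 := by positivity
      rw [hQP]
      refine lt_of_le_of_ne (by linarith [he0 f]) fun h => hf ?_
      have hf0 : f = 0 := he1 f (by linarith [he0 f])
      have hw0 : ∑ α, w α ^ 2 = 0 := by linarith [he0 f]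
      rw [Finset.sum_eq_zero_iff_of_nonneg (fun _ _ => by positivity)] at hw0
      have hw : w = 0 := by
        ext α
        simpa using hw0 α (Finset.mem_univ α)
      ext1
      rw [hf0, hw]
      exact map_zero P
    have := le_sigPos_of_posDef Q this
    rw [LinearMap.finrank_range_of_inj hP, finrank_prod, Subspace.dual_finrank_eq,
      finrank_fin_fun] at this
    omega
  have h3 := QuadraticForm.sigPos_add_sigNeg_add_radical (Q := Q)
  have h4 := F.finrank_m
  refine ⟨?_, ?_⟩
  · show sigNeg Q = _
    omega
  · show sigPos Q = _
    omega

end Frame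

/-- `B` on `𝔪` is non-degenerate, so the numbers of negative and positive squares add up to the
dimension of `𝔪`. -/
theorem HasSignature.finrank_m {τ : SymmetricTriple.{u}} {p q : ℕ} (h : τ.HasSignature p q) :
    finrank ℝ τ.m = p + q := by
  have h3 := QuadraticForm.sigPos_add_sigNeg_add_radical
    (Q := (τ.B.restrict τ.m).toQuadraticMap)
  have h0 : (τ.B.restrict τ.m).toQuadraticMap.radical = ⊥ := by
    rw [eq_bot_iff]
    rintro ⟨x, hx⟩ hrad
    rw [QuadraticMap.mem_radical_iff'] at hrad
    rw [Submodule.mem_bot]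
    ext1
    refine τ.eq_zero_of_m hx fun y hy => ?_
    have h1 := hrad.2 ⟨y, hy⟩
    have h2 := hrad.1
    have e1 : ∀ a : τ.m, (τ.B.restrict τ.m).toQuadraticMap a = τ.B a a := fun _ => rfl
    rw [e1] at h1 h2
    rw [e1] at h1
    simp only [Submodule.coe_add, map_add, LinearMap.add_apply] at h1 h2
    rw [τ.B_symm y x] at h1
    linarith
  rw [h0, finrank_bot, h.1, h.2] at h3
  omega

variable {τ : SymmetricTriple.{u}}

/-- Every orthonormal family `w` of vectors of `[𝔥, 𝔪]` that spans a complement of the centre is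
part of a frame: a lift of the dual space of the centre is corrected first by multiples of the
`w_α` and then by central elements. -/
theorem exists_frame {V : Type v} [AddCommGroup V] [Module ℝ V] [FiniteDimensional ℝ V]
    (hV : finrank ℝ V = finrank ℝ τ.z) (hz : τ.z ≤ τ.hm) {n : ℕ} (w : Fin n → τ.carrier)
    (hw : ∀ α, w α ∈ τ.hm) (hww : ∀ α β, τ.B (w α) (w β) = if α = β then 1 else 0)
    (hspan : τ.hm ≤ τ.z ⊔ Submodule.span ℝ (Set.range w)) :
    ∃ F : Frame τ V n, ∀ α, F.toLin (0, Pi.single α 1, 0) = w α := by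
  classical
  let j : V →ₗ[ℝ] τ.carrier := τ.z.subtype ∘ₗ (LinearEquiv.ofFinrankEq V τ.z hV).toLinearMap
  have hjz : ∀ v, j v ∈ τ.z := fun v => (LinearEquiv.ofFinrankEq V τ.z hV v).2
  have hj : Function.Injective j :=
    Subtype.val_injective.comp (LinearEquiv.ofFinrankEq V τ.z hV).injective
  have hjs : ∀ x ∈ τ.z, ∃ v, j v = x := fun x hx => by
    obtain ⟨v, hv⟩ := (LinearEquiv.ofFinrankEq V τ.z hV).surjective ⟨x, hx⟩
    exact ⟨v, congrArg Subtype.val hv⟩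
  have hwm : ∀ α, w α ∈ τ.m := fun α => τ.hm_le_m (hw α)
  have hBj : ∀ v, ∀ x ∈ τ.hm, τ.B x (j v) = 0 := fun v x hx => τ.B_hm_z (hjz v) hx
  have hr : Function.Surjective (j.dualMap ∘ₗ (τ.B : τ.carrier →ₗ[ℝ] Dual ℝ τ.carrier)) := by
    refine (LinearMap.dualMap_surjective_of_injective hj).comp ?_
    refine ((LinearMap.injective_iff_surjective_of_finrank_eq_finrank
      (Subspace.dual_finrank_eq).symm).1 ?_)
    rw [← LinearMap.ker_eq_bot, LinearMap.ker_eq_bot']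
    exact fun x hx => τ.B_nondeg x fun y => LinearMap.congr_fun hx y
  obtain ⟨s, hs⟩ := LinearMap.exists_rightInverse_of_surjective _ (LinearMap.range_eq_top.2 hr)
  have hs' : ∀ f v, τ.B (s f) (j v) = f v := fun f v =>
    LinearMap.congr_fun (LinearMap.congr_fun hs f) v
  let e₀ : Dual ℝ V →ₗ[ℝ] τ.carrier :=
    (1 / 2 : ℝ) • (LinearMap.id - (τ.σ : τ.carrier →ₗ[ℝ] τ.carrier)) ∘ₗ s
  have he₀m : ∀ f, e₀ f ∈ τ.m := fun f => by
    show τ.σ ((1 / 2 : ℝ) • (s f - τ.σ (s f))) = -((1 / 2 : ℝ) • (s f - τ.σ (s f)))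
    rw [map_smul, map_sub, σ_σ, ← smul_neg, neg_sub]
  have he₀ : ∀ f v, τ.B (e₀ f) (j v) = f v := fun f v => by
    have h1 : τ.B (τ.σ (s f)) (j v) = -f v := by
      have h2 : τ.σ (j v) = -j v := τ.z_le_m (hjz v)
      rw [← τ.B_σ, σ_σ, h2, map_neg, hs']
    show τ.B ((1 / 2 : ℝ) • (s f - τ.σ (s f))) (j v) = _
    rw [map_smul, map_sub, LinearMap.smul_apply, LinearMap.sub_apply, hs', h1, smul_eq_mul]
    ring
  let e₁ : Dual ℝ V →ₗ[ℝ] τ.carrier :=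
    e₀ - ∑ α, ((τ.B.flip (w α)) ∘ₗ e₀).smulRight (w α)
  have he₁' : ∀ f, e₁ f = e₀ f - ∑ α, τ.B (e₀ f) (w α) • w α := fun f => by
    simp [e₁, LinearMap.sum_apply]
  have he₁m : ∀ f, e₁ f ∈ τ.m := fun f => by
    rw [he₁']
    exact τ.m.sub_mem (he₀m f) (τ.m.sum_mem fun α _ => τ.m.smul_mem _ (hwm α))
  have he₁ : ∀ f v, τ.B (e₁ f) (j v) = f v := fun f v => by
    rw [he₁', map_sub, LinearMap.sub_apply, he₀, map_sum, LinearMap.sum_apply,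
      Finset.sum_eq_zero, sub_zero]
    intro α _
    rw [map_smul, LinearMap.smul_apply, hBj v _ (hw α), smul_zero]
  have he₁w : ∀ f α, τ.B (e₁ f) (w α) = 0 := fun f α => by
    rw [he₁', map_sub, LinearMap.sub_apply, map_sum, LinearMap.sum_apply]
    simp [hww]
  let ζ : Dual ℝ V →ₗ[ℝ] V :=
    (evalEquiv ℝ V).symm.toLinearMap ∘ₗ (τ.B.compl₁₂ e₁ e₁ : Dual ℝ V →ₗ[ℝ] Dual ℝ (Dual ℝ V))
  have hζ : ∀ f g : Dual ℝ V, g (ζ f) = τ.B (e₁ f) (e₁ g) := fun f g =>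
    LinearMap.congr_fun (LinearEquiv.apply_symm_apply (evalEquiv ℝ V) _) g
  let e : Dual ℝ V →ₗ[ℝ] τ.carrier := e₁ - (1 / 2 : ℝ) • j ∘ₗ ζ
  have he' : ∀ f, e f = e₁ f - (1 / 2 : ℝ) • j (ζ f) := fun f => rfl
  have hjj : ∀ v v', τ.B (j v) (j v') = 0 := fun v v' => hBj v' _ (hz (hjz v))
  have hjw : ∀ v α, τ.B (j v) (w α) = 0 := fun v α => τ.B_z_hm (hjz v) (hw α)
  have he : ∀ f v, τ.B (e f) (j v) = f v := fun f v => by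
    rw [he', map_sub, LinearMap.sub_apply, he₁, map_smul, LinearMap.smul_apply, hjj, smul_zero,
      sub_zero]
  have hew : ∀ f α, τ.B (e f) (w α) = 0 := fun f α => by
    rw [he', map_sub, LinearMap.sub_apply, he₁w, map_smul, LinearMap.smul_apply, hjw, smul_zero,
      sub_zero]
  have hee : ∀ f g, τ.B (e f) (e g) = 0 := fun f g => by
    rw [he' g, map_sub, map_smul, he, hζ, he', map_sub, LinearMap.sub_apply, map_smul,
      LinearMap.smul_apply, τ.B_symm (j _), he₁, hζ, τ.B_symm (e₁ g), smul_eq_mul]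
    ring
  have hem : ∀ f, e f ∈ τ.m := fun f =>
    τ.m.sub_mem (he₁m f) (τ.m.smul_mem _ (τ.z_le_m (hjz _)))
  let W : (Fin n → ℝ) →ₗ[ℝ] τ.carrier := Fintype.linearCombination ℝ w
  have hW : ∀ x, W x = ∑ α, x α • w α := fun x => rfl
  have hWhm : ∀ x, W x ∈ τ.hm := fun x => by
    rw [hW]
    exact τ.hm.sum_mem fun α _ => τ.hm.smul_mem _ (hw α)
  have hBW : ∀ y x, (τ.B y) (W x) = ∑ α, x α * τ.B y (w α) := fun y x => by
    simp [hW]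
  have hWW : ∀ x y, τ.B (W x) (W y) = ∑ α, x α * y α := fun x y => by
    rw [hBW]
    refine Finset.sum_congr rfl fun α _ => ?_
    rw [τ.B_symm, hBW]
    simp [hww, mul_comm]
  have heW : ∀ f x, τ.B (e f) (W x) = 0 := fun f x => by
    rw [hBW]
    exact Finset.sum_eq_zero fun α _ => by rw [hew, mul_zero]
  have hjW : ∀ v x, τ.B (j v) (W x) = 0 := fun v x => τ.B_z_hm (hjz v) (hWhm x)
  refine ⟨⟨j.coprod (W.coprod e), ?_, ?_, ?_, ?_⟩, ?_⟩
  · apply le_antisymm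
    · rintro _ ⟨⟨v, x, f⟩, rfl⟩
      exact τ.m.add_mem (τ.z_le_m (hjz v)) (τ.m.add_mem (τ.hm_le_m (hWhm x)) (hem f))
    · intro x hx
      have h1 : x - e (τ.B x ∘ₗ j) ∈ τ.hm := by
        refine τ.mem_hm_of_B_z (τ.m.sub_mem hx (hem _)) fun v hv => ?_
        obtain ⟨v, rfl⟩ := hjs v hv
        rw [map_sub, LinearMap.sub_apply, he]
        exact sub_self _
      obtain ⟨v, hv, y, hy, hvy⟩ := Submodule.mem_sup.1 (hspan h1)
      obtain ⟨v, rfl⟩ := hjs v hv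
      rw [← Fintype.range_linearCombination (R := ℝ)] at hy
      obtain ⟨y, rfl⟩ := hy
      refine ⟨(v, y, τ.B x ∘ₗ j), ?_⟩
      show j v + (W y + e (τ.B x ∘ₗ j)) = x
      rw [← add_assoc]
      exact eq_sub_iff_add_eq.1 hvy
  · rintro ⟨v, x, f⟩ ⟨v', x', f'⟩
    show τ.B (j v + (W x + e f)) (j v' + (W x' + e f')) = _
    simp only [map_add, LinearMap.add_apply, hjj, hjW, heW, he, hee, hWW, τ.B_symm (j _) (e _),
      τ.B_symm (W _) (e _), τ.B_symm (W _) (j _)]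
    ring
  · intro v
    simpa using hjz v
  · intro v x
    simpa using τ.hm.add_mem (hz (hjz v)) (hWhm x)
  · intro α
    simp [hW, Pi.single_apply]

end SymmetricTriple

/-! ### Tame symmetric triples -/

namespace SymmetricTriple

/-- The conditions on a symmetric triple which, unlike membership in `𝒯_{p,q}`, need no
indecomposability and no choice of an adapted decomposition: the holonomy algebra maps `[𝔥, 𝔪]` into
the centre, the centre lies in `[𝔥, 𝔪]`, the form `B` is positive definite on `[𝔥, 𝔪]` modulo the
centre, and the operators `ad x ∘ ad y` with `x, y ∈ 𝔪` have no common kernel on `[𝔥, 𝔪]` modulo the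
centre. They pass to direct summands. -/
structure IsTame (τ : SymmetricTriple.{u}) : Prop where
  lie_hm : ∀ a ∈ τ.h, ∀ w ∈ τ.hm, ⁅a, w⁆ ∈ τ.z
  z_le_hm : τ.z ≤ τ.hm
  nonneg : ∀ w ∈ τ.hm, 0 ≤ τ.B w w
  mem_z : ∀ w ∈ τ.hm, τ.B w w = 0 → w ∈ τ.z
  leastNilpotent : ∀ w ∈ τ.hm, (∀ x ∈ τ.m, ∀ y ∈ τ.m, ⁅x, ⁅y, w⁆⁆ ∈ τ.z) → w ∈ τ.z

variable {τ : SymmetricTriple.{u}}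

theorem lie_hm_hm (h : ∀ a ∈ τ.h, ∀ w ∈ τ.hm, ⁅a, w⁆ ∈ τ.z) {w w' : τ.carrier}
    (hw : w ∈ τ.hm) (hw' : w' ∈ τ.hm) : ⁅w, w'⁆ = 0 := by
  refine τ.eq_zero_of_h (τ.lie_mem_h (τ.hm_le_m hw) (τ.hm_le_m hw')) fun a ha => ?_
  rw [τ.B_symm, ← τ.B_lie_assoc, τ.B_z_hm (h a ha w hw) hw']

theorem IsTame.lie_hm_hm (h : τ.IsTame) {w w' : τ.carrier}
    (hw : w ∈ τ.hm) (hw' : w' ∈ τ.hm) : ⁅w, w'⁆ = 0 :=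
  SymmetricTriple.lie_hm_hm h.lie_hm hw hw'

/-- A complement of the centre in `[𝔥, 𝔪]`, a Euclidean space. -/
theorem IsTame.exists_complement (h : τ.IsTame) :
    ∃ W : Submodule ℝ τ.carrier, W ≤ τ.hm ∧ τ.z ⊔ W = τ.hm ∧ Disjoint τ.z W ∧
      (∀ w ∈ W, 0 ≤ τ.B w w) ∧ ∀ w ∈ W, τ.B w w = 0 → w = 0 := by
  obtain ⟨W', hW'⟩ := Submodule.exists_isCompl (τ.z.comap τ.hm.subtype)
  have hle : W'.map τ.hm.subtype ≤ τ.hm := by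
    rintro _ ⟨w, -, rfl⟩
    exact w.2
  have hdisj : Disjoint τ.z (W'.map τ.hm.subtype) := by
    rw [Submodule.disjoint_def]
    rintro _ hx ⟨w, hw, rfl⟩
    have := Submodule.disjoint_def.1 hW'.disjoint w hx hw
    rw [this, map_zero]
  refine ⟨W'.map τ.hm.subtype, hle, ?_, hdisj, fun w hw => h.nonneg w (hle hw),
    fun w hw h0 => Submodule.disjoint_def.1 hdisj w (h.mem_z w (hle hw) h0) hw⟩
  apply le_antisymm (sup_le h.z_le_hm hle)
  intro x hx
  obtain ⟨y, hy, w, hw, hyw⟩ := Submodule.mem_sup.1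
    (hW'.sup_eq_top.ge (Submodule.mem_top (x := (⟨x, hx⟩ : τ.hm))))
  rw [show x = (y : τ.carrier) + w from congrArg Subtype.val hyw.symm]
  exact Submodule.add_mem_sup hy (Submodule.mem_map_of_mem hw)

/-- Simultaneous diagonalization: on a Euclidean vector space, given by a positive definite
symmetric bilinear form, a commuting family of self-adjoint operators has an orthonormal basis of
common eigenvectors. -/
theorem exists_orthonormal_eigenbasis {E ι : Type*} [AddCommGroup E] [Module ℝ E]
    [FiniteDimensional ℝ E] (B : LinearMap.BilinForm ℝ E) (hs : ∀ x y, B x y = B y x)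
    (hnn : ∀ x, 0 ≤ B x x) (hd : ∀ x, B x x = 0 → x = 0) (T : ι → E →ₗ[ℝ] E)
    (hT : ∀ i x y, B (T i x) y = B x (T i y)) (hC : ∀ i j, Commute (T i) (T j)) {n : ℕ}
    (hn : finrank ℝ E = n) :
    ∃ b : Basis (Fin n) ℝ E, (∀ α β, B (b α) (b β) = if α = β then 1 else 0) ∧
      ∀ i α, ∃ c : ℝ, T i (b α) = c • b α := by
  classical
  let core : InnerProductSpace.Core ℝ E :=
    { inner := fun x y => B x y
      conj_inner_symm := fun x y => hs y x
      re_inner_nonneg := hnn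
      add_left := fun x y z => by simp
      smul_left := fun x y r => by simp
      definite := hd }
  let _ : NormedAddCommGroup E := core.toNormedAddCommGroup
  let _ : InnerProductSpace ℝ E := InnerProductSpace.ofCore core.toCore
  have hT' : ∀ i, (T i).IsSymmetric := fun i x y => hT i x y
  have hint := LinearMap.IsSymmetric.directSum_isInternal_of_pairwise_commute hT'
    (fun i j _ => hC i j)
  have hfam := LinearMap.IsSymmetric.orthogonalFamily_iInf_eigenspaces hT'
  let v : ∀ χ : ι → ℝ, OrthonormalBasis _ ℝ (⨅ j, End.eigenspace (T j) (χ j) : Submodule ℝ E) :=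
    fun χ => stdOrthonormalBasis ℝ _
  have hon := hint.collectedBasis_orthonormal (v_family := fun χ => (v χ).toBasis) hfam
    (fun χ => by simp)
  set b₀ := hint.collectedBasis fun χ => (v χ).toBasis with hb₀
  have := FiniteDimensional.fintypeBasisIndex b₀
  let e := Fintype.equivFinOfCardEq ((finrank_eq_card_basis b₀).symm.trans hn)
  refine ⟨b₀.reindex e, fun α β => ?_, fun i α => ⟨(e.symm α).1 i, ?_⟩⟩
  · rw [Basis.reindex_apply, Basis.reindex_apply]
    have := orthonormal_iff_ite.1 hon (e.symm α) (e.symm β)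
    simp only [e.symm.injective.eq_iff] at this
    exact this
  · rw [Basis.reindex_apply]
    have h1 := hint.collectedBasis_mem (fun χ => (v χ).toBasis) (e.symm α)
    rw [Submodule.mem_iInf] at h1
    exact End.mem_eigenspace_iff.1 (h1 i)

/-- A tame symmetric triple has a frame. -/
theorem IsTame.nonempty_frame (h : τ.IsTame) {V : Type v} [AddCommGroup V] [Module ℝ V]
    [FiniteDimensional ℝ V] (hV : finrank ℝ V = finrank ℝ τ.z) {n : ℕ}
    (hn : finrank ℝ τ.hm = finrank ℝ τ.z + n) : Nonempty (Frame τ V n) := by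
  obtain ⟨W, hle, hsup, hdisj, hnn, hd⟩ := h.exists_complement
  have hfr := Submodule.finrank_sup_add_finrank_inf_eq τ.z W
  rw [hsup, hdisj.eq_bot, finrank_bot] at hfr
  obtain ⟨b, hb, -⟩ := exists_orthonormal_eigenbasis (ι := Empty) (τ.B.restrict W)
    (fun x y => τ.B_symm x y) (fun x => hnn x x.2) (fun x hx => Subtype.ext (hd x x.2 hx))
    Empty.elim (fun i => i.elim) (fun i => i.elim) (n := n) (by omega)
  obtain ⟨F, -⟩ := exists_frame hV h.z_le_hm (fun α => (b α : τ.carrier)) (fun α => hle (b α).2)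
    hb (by
      rw [← hsup]
      refine sup_le_sup_left (fun x hx => ?_) _
      have := b.mem_span ⟨x, hx⟩
      have := Submodule.mem_map_of_mem (f := W.subtype) this
      rw [Submodule.map_span, ← Set.range_comp] at this
      exact this)
  exact ⟨F⟩

namespace Frame

variable {V : Type v} [AddCommGroup V] [Module ℝ V] {n : ℕ}

theorem isAdapted (F : Frame τ V n) :
    τ.IsAdapted (LinearMap.range (F.toLin ∘ₗ LinearMap.inr ℝ V _ ∘ₗ LinearMap.inl ℝ (Fin n → ℝ) _))
      (LinearMap.range (F.toLin ∘ₗ LinearMap.inr ℝ V _ ∘ₗ LinearMap.inr ℝ (Fin n → ℝ) _)) := by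
  have hz : ∀ x ∈ τ.z, ∃ v, F.toLin (v, 0, 0) = x := by
    intro x hx
    obtain ⟨y, rfl⟩ := F.exists_eq (τ.z_le_m hx)
    exact ⟨y.1, congrArg F.toLin (Prod.ext rfl (F.mem_z_iff.1 hx).symm)⟩
  have hadd : ∀ v w f, F.toLin (v, w, f) = F.toLin (v, 0, 0) + (F.toLin (0, w, 0) +
      F.toLin (0, 0, f)) := by
    intro v w f
    rw [← map_add, ← map_add]
    simp
  have hzhm : τ.z ≤ τ.hm := fun x hx => by
    obtain ⟨v, rfl⟩ := hz x hx
    exact F.mem_hm v 0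
  refine ⟨le_antisymm (sup_le hzhm ?_) ?_, ?_, le_antisymm (sup_le τ.hm_le_m ?_) ?_, ?_, ?_, ?_, ?_⟩
  · rintro _ ⟨w, rfl⟩
    exact F.mem_hm 0 w
  · intro x hx
    obtain ⟨⟨v, w, f⟩, rfl⟩ := F.exists_eq (τ.hm_le_m hx)
    have hf : f = 0 := F.mem_hm_iff.1 hx
    rw [hadd, hf, Prod.mk_zero_zero, Prod.mk_zero_zero, map_zero, add_zero]
    exact Submodule.add_mem_sup (F.mem_z v) ⟨w, rfl⟩
  · rw [Submodule.disjoint_def]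
    rintro _ hx ⟨w, rfl⟩
    have : (w, (0 : Dual ℝ V)) = 0 := F.mem_z_iff.1 hx
    obtain ⟨rfl, -⟩ := Prod.mk.inj this
    exact map_zero _
  · rintro _ ⟨f, rfl⟩
    exact F.mem_m _
  · intro x hx
    obtain ⟨⟨v, w, f⟩, rfl⟩ := F.exists_eq hx
    rw [hadd, ← add_assoc]
    exact Submodule.add_mem_sup (τ.hm.add_mem (F.mem_hm _ _) (F.mem_hm _ _)) ⟨f, rfl⟩
  · rw [Submodule.disjoint_def]
    rintro _ hx ⟨f, rfl⟩
    have : f = 0 := F.mem_hm_iff.1 hx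
    subst this
    exact map_zero _
  · exact fun x hx y hy => τ.B_z_hm hx (hzhm hy)
  · rintro _ ⟨f, rfl⟩ _ ⟨g, rfl⟩
    simp [F.form]
  · rintro _ ⟨w, rfl⟩ x hx
    obtain ⟨y, hy, _, ⟨f, rfl⟩, rfl⟩ := Submodule.mem_sup.1 hx
    obtain ⟨v, rfl⟩ := hz y hy
    rw [map_add]
    simp [F.form]

end Frame

/-- The condition of being least nilpotent does not depend on the adapted decomposition. -/
theorem IsAdapted.leastNilpotent_iff {W E : Submodule ℝ τ.carrier} (hA : τ.IsAdapted W E)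
    (h : ∀ a ∈ τ.h, ∀ w ∈ τ.hm, ⁅a, w⁆ ∈ τ.z) :
    (∀ w ∈ W, (∀ x ∈ E, ∀ y ∈ E, ⁅x, ⁅y, w⁆⁆ ∈ τ.z ⊔ E) → w = 0) ↔
    ∀ w ∈ τ.hm, (∀ x ∈ τ.m, ∀ y ∈ τ.m, ⁅x, ⁅y, w⁆⁆ ∈ τ.z) → w ∈ τ.z := by
  have hWhm : W ≤ τ.hm := hA.z_sup_W ▸ le_sup_right
  have hEm : E ≤ τ.m := hA.hm_sup_E ▸ le_sup_right
  have hzhm : τ.z ≤ τ.hm := hA.z_sup_W ▸ le_sup_left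
  have key : ∀ w ∈ τ.hm, ∀ x ∈ τ.m, ∀ y ∈ τ.m, ⁅x, ⁅y, w⁆⁆ ∈ τ.hm := fun w hw x hx y hy =>
    τ.lie_mem_hm' (τ.lie_mem_h hy (τ.hm_le_m hw)) hx
  constructor
  · intro H w hw h0
    rw [← hA.z_sup_W] at hw
    obtain ⟨v, hv, w, hw', rfl⟩ := Submodule.mem_sup.1 hw
    have : w = 0 := by
      refine H w hw' fun x hx y hy => Submodule.mem_sup_left ?_
      have := h0 x (hEm hx) y (hEm hy)
      rwa [lie_add, τ.lie_z' hv, zero_add] at this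
    rw [this, add_zero]
    exact hv
  · intro H w hw h0
    refine Submodule.disjoint_def.1 hA.disjoint_z_W w (H w (hWhm hw) fun x hx y hy => ?_) hw
    rw [← hA.hm_sup_E] at hx hy
    obtain ⟨x', hx', x, hxE, rfl⟩ := Submodule.mem_sup.1 hx
    obtain ⟨y', hy', y, hyE, rfl⟩ := Submodule.mem_sup.1 hy
    rw [add_lie, add_lie, lie_hm_hm h hy' (hWhm hw), zero_add]
    refine τ.z.add_mem ?_ ?_
    · rw [← lie_skew]
      exact τ.z.neg_mem (h _ (τ.lie_mem_h (hEm hyE) (τ.hm_le_m (hWhm hw))) _ hx')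
    · have h1 := key w (hWhm hw) x (hEm hxE) y (hEm hyE)
      obtain ⟨v, hv, e, he, hve⟩ := Submodule.mem_sup.1 (h0 x hxE y hyE)
      rw [← hve] at h1 ⊢
      have he0 : e = 0 := by
        refine Submodule.disjoint_def.1 hA.disjoint_hm_E e ?_ he
        simpa using τ.hm.sub_mem h1 (hzhm hv)
      rwa [he0, add_zero]

/-- If `𝔪 ≠ 0` and `[𝔥, [𝔥, 𝔪]]` is central, then the centre is not zero: otherwise
`𝔪 = [𝔥, 𝔪] = [𝔥, [𝔥, 𝔪]] = 0`. -/
theorem IsTame.finrank_z_pos (h : τ.IsTame) (hnt : Nontrivial τ.carrier) : 1 ≤ finrank ℝ τ.z := by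
  rw [Nat.one_le_iff_ne_zero, ne_eq, Submodule.finrank_eq_zero]
  intro hz
  have h1 : ∀ x ∈ τ.m, x = 0 := by
    intro x hx
    have h2 : ∀ y ∈ τ.m, y ∈ τ.hm := fun y hy => τ.mem_hm_of_B_z hy fun v hv => by
      rw [hz, Submodule.mem_bot] at hv
      rw [hv, map_zero]
    rw [← Submodule.mem_bot ℝ, ← hz]
    exact τ.mem_z_of_m fun y hy => h.lie_hm_hm (h2 x hx) (h2 y hy)
  obtain ⟨x, hx⟩ := exists_ne (0 : τ.carrier)
  obtain ⟨a, ha, y, hy, rfl⟩ := τ.exists_h_add_m x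
  refine hx ?_
  rw [h1 y hy, τ.eq_zero_of_lie_m ha fun w hw => h1 _ (τ.lie_mem_m ha hw), add_zero]

theorem IsTame.isT (h : τ.IsTame) (hs : LieAlgebra.IsSolvable τ.carrier) (hi : τ.Indecomposable)
    (hnt : Nontrivial τ.carrier) : ∃ p q, τ.IsT p q := by
  obtain ⟨n, hn⟩ := Nat.exists_eq_add_of_le (Submodule.finrank_mono h.z_le_hm)
  obtain ⟨F⟩ := h.nonempty_frame (V := τ.z) rfl hn
  exact ⟨finrank ℝ τ.z, finrank ℝ τ.z + n, h.finrank_z_pos hnt, Nat.le_add_right _ _,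
    F.hasSignature, hi, hs, rfl, _, _, F.isAdapted,
    (F.isAdapted.leastNilpotent_iff h.lie_hm).2 h.leastNilpotent⟩

end SymmetricTriple

/-! ### Solvable triples with maximal centre -/

section Solvable

open LieModule

/-- A consequence of Lie's theorem: on a module over a solvable Lie algebra, sums of brackets act
nilpotently. -/
theorem isNilpotent_toEnd_of_isAlgClosed {k L : Type*} [Field k] [IsAlgClosed k] [CharZero k]
    [LieRing L] [LieAlgebra k L] [LieAlgebra.IsSolvable L] {a : L}
    (ha : a ∈ Submodule.span k {z : L | ∃ x y : L, ⁅x, y⁆ = z}) (N : ℕ) :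
    ∀ (M : Type u) [AddCommGroup M] [Module k M] [LieRingModule L M] [LieModule k L M]
      [FiniteDimensional k M], finrank k M ≤ N → IsNilpotent (toEnd k L M a) := by
  induction N with
  | zero =>
    intro M _ _ _ _ _ hM
    have : Subsingleton M := finrank_zero_iff.1 (Nat.le_zero.1 hM)
    exact ⟨1, Subsingleton.elim _ _⟩
  | succ N ih =>
    intro M _ _ _ _ _ hM
    cases subsingleton_or_nontrivial M with
    | inl h => exact ⟨1, Subsingleton.elim _ _⟩
    | inr h =>
      obtain ⟨χ, hχ⟩ := exists_nontrivial_weightSpace_of_isSolvable k L M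
      have hχa : χ a = 0 := by
        obtain ⟨⟨v, hv⟩, hv0⟩ := exists_ne (0 : weightSpace M χ)
        rw [mem_weightSpace] at hv
        have hv0' : v ≠ 0 := fun h => hv0 (Subtype.ext h)
        have : Submodule.span k {z : L | ∃ x y : L, ⁅x, y⁆ = z} ≤ LinearMap.ker χ := by
          rw [Submodule.span_le]
          rintro _ ⟨x, y, rfl⟩
          have h1 := hv ⁅x, y⁆
          rw [lie_lie, hv, hv, lie_smul, lie_smul, hv, hv, smul_smul, smul_smul, mul_comm,
            sub_self] at h1
          exact (smul_eq_zero.1 h1.symm).resolve_right hv0'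
        exact this ha
      have hlt : finrank k (M ⧸ (weightSpace M χ).toSubmodule) ≤ N := by
        have h1 := Submodule.finrank_quotient_add_finrank (weightSpace M χ).toSubmodule
        have h2 : 0 < finrank k (weightSpace M χ).toSubmodule := by
          have : Nontrivial (weightSpace M χ).toSubmodule := hχ
          exact finrank_pos
        omega
      obtain ⟨K, hK⟩ := ih (M ⧸ weightSpace M χ) hlt
      refine ⟨K + 1, LinearMap.ext fun m => ?_⟩
      have hq : ∀ j (m : M), ((toEnd k L (M ⧸ weightSpace M χ) a) ^ j)
          (LieSubmodule.Quotient.mk m) = LieSubmodule.Quotient.mk (((toEnd k L M a) ^ j) m) := by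
        intro j
        induction j with
        | zero => intro m; rfl
        | succ j ihj =>
          intro m
          rw [pow_succ, pow_succ, Module.End.mul_apply, Module.End.mul_apply, ← ihj]
          rfl
      have h1 : ((toEnd k L M a) ^ K) m ∈ weightSpace M χ := by
        have := hq K m
        rw [hK] at this
        exact (LieSubmodule.Quotient.mk_eq_zero').1 this.symm
      rw [mem_weightSpace] at h1
      rw [pow_succ', Module.End.mul_apply, toEnd_apply_apply, h1, hχa, zero_smul]
      rfl

open TensorProduct in
theorem isNilpotent_toEnd_of_isSolvable {L : Type*} [LieRing L] [LieAlgebra ℝ L]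
    [LieAlgebra.IsSolvable L] {a : L} (ha : a ∈ Submodule.span ℝ {z : L | ∃ x y : L, ⁅x, y⁆ = z})
    (M : Type*) [AddCommGroup M] [Module ℝ M] [LieRingModule L M] [LieModule ℝ L M]
    [FiniteDimensional ℝ M] : IsNilpotent (toEnd ℝ L M a) := by
  have h1 : (1 : ℂ) ⊗ₜ[ℝ] a ∈
      Submodule.span ℂ {z : ℂ ⊗[ℝ] L | ∃ x y : ℂ ⊗[ℝ] L, ⁅x, y⁆ = z} := by
    induction ha using Submodule.span_induction with
    | mem x hx =>
      obtain ⟨x, y, rfl⟩ := hx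
      refine Submodule.subset_span ⟨1 ⊗ₜ x, 1 ⊗ₜ y, ?_⟩
      rw [LieAlgebra.ExtendScalars.bracket_tmul, one_mul]
    | zero => rw [tmul_zero]; exact Submodule.zero_mem _
    | add x y _ _ hx hy => rw [tmul_add]; exact Submodule.add_mem _ hx hy
    | smul c x _ hx =>
      rw [tmul_smul, ← algebraMap_smul ℂ c]
      exact Submodule.smul_mem _ _ hx
  obtain ⟨K, hK⟩ := isNilpotent_toEnd_of_isAlgClosed h1 _ (ℂ ⊗[ℝ] M) le_rfl
  refine ⟨K, LinearMap.ext fun m => ?_⟩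
  have h2 : ∀ j m, ((toEnd ℂ (ℂ ⊗[ℝ] L) (ℂ ⊗[ℝ] M) (1 ⊗ₜ a)) ^ j) (1 ⊗ₜ m) =
      (1 : ℂ) ⊗ₜ[ℝ] (((toEnd ℝ L M a) ^ j) m) := by
    intro j
    induction j with
    | zero => intro m; rfl
    | succ j ihj =>
      intro m
      rw [pow_succ, pow_succ, Module.End.mul_apply, Module.End.mul_apply, toEnd_apply_apply,
        LieAlgebra.ExtendScalars.bracket_tmul, one_mul, ihj]
      rfl
  have h3 := h2 K m
  rw [hK] at h3
  have hinj : Function.Injective (TensorProduct.mk ℝ ℂ M 1) :=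
    Module.FaithfullyFlat.tensorProduct_mk_injective (A := ℝ) (B := ℂ) M
  refine hinj ?_
  rw [TensorProduct.mk_apply, ← h3, LinearMap.zero_apply, LinearMap.zero_apply, map_zero]

end Solvable

namespace SymmetricTriple

variable {τ : SymmetricTriple.{u}}

theorem h_le_span_lie : τ.h ≤ Submodule.span ℝ {z : τ.carrier | ∃ x y : τ.carrier, ⁅x, y⁆ = z} :=
  τ.h_induction fun x _ y _ => Submodule.subset_span ⟨x, y, rfl⟩

/-- In a solvable triple with `B` definite on `[𝔥, 𝔪]` modulo the centre, the elements of `𝔥` act on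
this quotient by operators that are both skew-symmetric and nilpotent, hence by zero. -/
theorem lie_hm_mem_z (hs : LieAlgebra.IsSolvable τ.carrier)
    (hd : ∀ w ∈ τ.hm, τ.B w w = 0 → w ∈ τ.z) {a w : τ.carrier} (ha : a ∈ τ.h) (hw : w ∈ τ.hm) :
    ⁅a, w⁆ ∈ τ.z := by
  obtain ⟨K, hK⟩ := isNilpotent_toEnd_of_isSolvable (h_le_span_lie ha) τ.carrier
  set A := LieModule.toEnd ℝ τ.carrier τ.carrier a with hA
  have hAa : ∀ x, A x = ⁅a, x⁆ := fun x => rfl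
  have hmem : ∀ k, (A ^ k) w ∈ τ.hm := by
    intro k
    induction k with
    | zero => exact hw
    | succ k ih =>
      rw [pow_succ', Module.End.mul_apply]
      exact τ.lie_mem_hm ha (τ.hm_le_m ih)
  have key : ∀ k, (A ^ (k + 1)) w ∈ τ.z → (A ^ 1) w ∈ τ.z := by
    intro k
    induction k with
    | zero => exact id
    | succ k ih =>
      intro h
      refine ih (hd _ (hmem _) ?_)
      have h1 : (A ^ (k + 1)) w = ⁅a, (A ^ k) w⁆ := by
        rw [pow_succ', Module.End.mul_apply, hAa]
      have h2 : (A ^ (k + 2)) w = ⁅a, (A ^ (k + 1)) w⁆ := by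
        rw [pow_succ', Module.End.mul_apply, hAa]
      nth_rewrite 1 [h1]
      rw [τ.B_lie_left, ← h2, τ.B_hm_z h (hmem k), neg_zero]
  refine key K ?_
  rw [pow_succ', hK, mul_zero]
  exact τ.z.zero_mem

/-- Triples in `𝒯_{p,q}` are tame. The form is definite on `[𝔥, 𝔪]` modulo the centre because a
maximal positive definite subspace of `𝔪` meets `[𝔥, 𝔪]` in a complement of the centre, by
dimensions. -/
theorem IsT.isTame {p q : ℕ} (h : τ.IsT p q) : τ.IsTame := by
  obtain ⟨W, E, hA, hLN⟩ := h.leastNilpotent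
  have hzhm : τ.z ≤ τ.hm := hA.z_sup_W ▸ le_sup_left
  have hpos : ∀ x ∈ τ.hm, ∃ v ∈ τ.z, ∃ y, x = v + y ∧ y ∈ τ.hm ∧ 0 ≤ τ.B y y ∧
      (τ.B y y = 0 → y = 0) := by
    obtain ⟨P, hP, hPd⟩ := exists_finrank_eq_sigPos_and_posDef (τ.B.restrict τ.m).toQuadraticMap
    rw [h.signature.2] at hP
    set P' := P.map τ.m.subtype with hP'
    have hfP : finrank ℝ P' = q := by
      rw [hP', Submodule.finrank_map_subtype_eq, hP]
    have hPm : P' ≤ τ.m := by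
      rintro _ ⟨x, -, rfl⟩
      exact x.2
    have hPpos : ∀ x ∈ P', x ≠ 0 → 0 < τ.B x x := by
      rintro _ ⟨x, hx, rfl⟩ hx0
      exact hPd ⟨x, hx⟩ fun h0 => hx0 (by rw [show x = 0 from congrArg Subtype.val h0, map_zero])
    have h1 := Submodule.finrank_sup_add_finrank_inf_eq P' τ.hm
    have h2 : finrank ℝ (P' ⊔ τ.hm : Submodule ℝ τ.carrier) ≤ finrank ℝ τ.m :=
      Submodule.finrank_mono (sup_le hPm τ.hm_le_m)
    have h3 := Submodule.finrank_sup_add_finrank_inf_eq τ.z (P' ⊓ τ.hm)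
    have h4 : τ.z ⊓ (P' ⊓ τ.hm) = ⊥ := by
      rw [eq_bot_iff]
      rintro x ⟨hx1, hx2, hx3⟩
      by_contra hx0
      exact (hPpos x hx2 hx0).ne' (hA.isotropic_z x hx1 x hx1)
    have h5 := h.signature.finrank_m
    have h6 := τ.finrank_hm_add_finrank_z
    have h7 := h.maximal_center
    rw [h4, finrank_bot] at h3
    have h8 : τ.z ⊔ (P' ⊓ τ.hm) = τ.hm :=
      Submodule.eq_of_le_of_finrank_le (sup_le hzhm inf_le_right) (by omega)
    intro x hx
    rw [← h8] at hx
    obtain ⟨v, hv, y, hy, rfl⟩ := Submodule.mem_sup.1 hx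
    refine ⟨v, hv, y, rfl, hy.2, ?_, ?_⟩
    · by_cases hy0 : y = 0
      · rw [hy0, map_zero]
      · exact (hPpos y hy.1 hy0).le
    · intro h0
      by_contra hy0
      exact (hPpos y hy.1 hy0).ne' h0
  have hB : ∀ v ∈ τ.z, ∀ y ∈ τ.hm, τ.B (v + y) (v + y) = τ.B y y := fun v hv y hy => by
    rw [map_add, map_add, LinearMap.add_apply, LinearMap.add_apply, τ.B_z_hm hv hy,
      τ.B_hm_z hv hy, τ.B_hm_z hv (hzhm hv), zero_add, zero_add, zero_add]
  have hd : ∀ w ∈ τ.hm, τ.B w w = 0 → w ∈ τ.z := by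
    intro w hw h0
    obtain ⟨v, hv, y, rfl, hy, -, hy0⟩ := hpos w hw
    rw [hB v hv y hy] at h0
    rwa [hy0 h0, add_zero]
  have hlie : ∀ a ∈ τ.h, ∀ w ∈ τ.hm, ⁅a, w⁆ ∈ τ.z := fun a ha w hw =>
    lie_hm_mem_z h.solvable hd ha hw
  refine ⟨hlie, hzhm, fun w hw => ?_, hd, (hA.leastNilpotent_iff hlie).1 hLN⟩
  obtain ⟨v, hv, y, rfl, hy, hnn, -⟩ := hpos w hw
  rwa [hB v hv y hy]

end SymmetricTriple

/-! ### The normal forms are tame -/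

namespace NormalFormData

variable {V : Type v} [AddCommGroup V] [Module ℝ V] [FiniteDimensional ℝ V] {n : ℕ}
  (D : NormalFormData V n)

/-- The inclusion of `𝔷 ⊕ W ⊕ 𝔷^*` into the Lie algebra of the triple. -/
def incl : (V × (Fin n → ℝ) × Dual ℝ V) →ₗ[ℝ] D.triple.carrier := D.inclM

/-- The element `y + u` of `Y ⊕ W^*` in the Lie algebra of the triple. -/
def hIncl : (D.Y × (Fin n → ℝ)) →ₗ[ℝ] D.triple.carrier where
  toFun x := D.elt x.1 x.2 0 0 0
  map_add' x y := by
    show D.elt _ _ _ _ _ = D.elt _ _ _ _ _ + D.elt _ _ _ _ _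
    apply D.ext_carrier <;> simp
  map_smul' c x := by
    show D.elt _ _ _ _ _ = c • D.elt _ _ _ _ _
    apply D.ext_carrier <;> simp

/-- The `W^*`-component of the bracket of two elements of `𝔷 ⊕ W ⊕ 𝔷^*`. -/
def mu (x x' : V × (Fin n → ℝ) × Dual ℝ V) : Fin n → ℝ :=
  fun α => x.2.2 (D.Λ α) * x'.2.1 α - x'.2.2 (D.Λ α) * x.2.1 α

/-- The quadrilinear form `B([x, x'], [u, u'])` on `𝔷 ⊕ W ⊕ 𝔷^*`. -/
def quad (x x' u u' : V × (Fin n → ℝ) × Dual ℝ V) : ℝ :=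
  D.R (wedge x.2.2 x'.2.2) (wedge u.2.2 u'.2.2) + ∑ α, D.ε α * (D.mu x x' α * D.mu u u' α)

theorem mEquiv_coe (x) : (D.mEquiv x : D.triple.carrier) = D.incl x := rfl

theorem incl_mem_m (x) : D.incl x ∈ D.triple.m := (D.mEquiv x).2

theorem hIncl_mem_h (x) : D.hIncl x ∈ D.triple.h := (D.hElt x.1 x.2).2

theorem exists_incl {x : D.triple.carrier} (hx : x ∈ D.triple.m) : ∃ y, D.incl y = x :=
  ⟨D.mEquiv.symm ⟨x, hx⟩, congrArg Subtype.val (D.mEquiv.apply_symm_apply ⟨x, hx⟩)⟩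

theorem exists_hIncl {x : D.triple.carrier} (hx : x ∈ D.triple.h) : ∃ y, D.hIncl y = x := by
  have hx' : D.invLin x = x := hx
  have h3 : D.cz x = 0 := eq_zero_of_eq_neg (congrArg D.cz hx').symm
  have h4 : D.cW x = 0 := eq_zero_of_eq_neg (congrArg D.cW hx').symm
  have h5 : D.czs x = 0 := eq_zero_of_eq_neg (congrArg D.czs hx').symm
  refine ⟨(D.cY x, D.cWs x), ?_⟩
  exact D.ext_carrier rfl rfl h3.symm h4.symm h5.symm

theorem incl_lie_incl (x x') :
    ⁅D.incl x, D.incl x'⁆ = D.hIncl (curvProj D.R (wedge x.2.2 x'.2.2), D.mu x x') := by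
  show D.bracket (D.elt 0 0 x.1 x.2.1 x.2.2) (D.elt 0 0 x'.1 x'.2.1 x'.2.2) = D.elt _ _ 0 0 0
  apply D.ext_carrier
  · simp [bracket]
  · ext α; simp [bracket, mu]
  · simp [bracket]
  · ext α; simp [bracket]
  · simp [bracket]

theorem hIncl_lie_incl (a x) : ⁅D.hIncl a, D.incl x⁆ =
    D.incl (D.b a.1 x.2.2 - ∑ α, (D.ε α * (a.2 α * x.2.1 α)) • D.Λ α,
      fun α => D.ε α * (a.2 α * x.2.2 (D.Λ α)), 0) := by
  show D.bracket (D.elt a.1 a.2 0 0 0) (D.elt 0 0 x.1 x.2.1 x.2.2) = D.elt 0 0 _ _ _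
  apply D.ext_carrier
  · simp [bracket]
  · ext α; simp [bracket]
  · simp [bracket]
  · ext α; simp [bracket]
  · simp [bracket]

theorem B_incl (x x') : D.triple.B (D.incl x) (D.incl x') =
    x.2.2 x'.1 + x'.2.2 x.1 + ∑ α, x.2.1 α * x'.2.1 α := by
  show D.form (D.elt 0 0 x.1 x.2.1 x.2.2) (D.elt 0 0 x'.1 x'.2.1 x'.2.2) = _
  simp [form_apply]

theorem B_hIncl (a a') : D.triple.B (D.hIncl a) (D.hIncl a') =
    curvForm D.R D.isCurvatureTensor a.1 a'.1 + ∑ α, D.ε α * (a.2 α * a'.2 α) := by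
  show D.form (D.elt a.1 a.2 0 0 0) (D.elt a'.1 a'.2 0 0 0) = _
  simp [form_apply]

theorem B_lie_incl (x x' u u') :
    D.triple.B ⁅D.incl x, D.incl x'⁆ ⁅D.incl u, D.incl u'⁆ = D.quad x x' u u' := by
  rw [incl_lie_incl, incl_lie_incl, B_hIncl, curvForm_proj]
  rfl

theorem range_incl : LinearMap.range D.incl = D.triple.m := by
  apply le_antisymm
  · rintro _ ⟨x, rfl⟩
    exact D.incl_mem_m x
  · intro x hx
    exact D.exists_incl hx

theorem exists_dual_Λ (α : Fin n) : ∃ f : Dual ℝ V, f (D.Λ α) = 1 := by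
  have h := (Module.forall_dual_apply_eq_zero_iff ℝ (D.Λ α)).not.2 (D.Λ_ne_zero α)
  push Not at h
  obtain ⟨f, hf⟩ := h
  exact ⟨(f (D.Λ α))⁻¹ • f, inv_mul_cancel₀ hf⟩

theorem ε_mul_self (α : Fin n) : D.ε α * D.ε α = 1 := by
  rcases D.ε_sign α with h | h <;> rw [h] <;> norm_num

theorem incl_mem_hm (v w) : D.incl (v, w, 0) ∈ D.triple.hm := by
  classical
  have h1 : ∀ a x, ⁅D.hIncl a, D.incl x⁆ ∈ D.triple.hm := fun a x =>
    D.triple.lie_mem_hm (D.hIncl_mem_h a) (D.incl_mem_m x)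
  have hb : ∀ y f, D.incl (D.b y f, 0, 0) ∈ D.triple.hm := fun y f => by
    have := h1 (y, 0) (0, 0, f)
    rw [hIncl_lie_incl] at this
    simpa [← Pi.zero_def] using this
  have hΛ : ∀ α, D.incl (D.Λ α, 0, 0) ∈ D.triple.hm := fun α => by
    have := h1 (0, Pi.single α (-D.ε α)) (0, Pi.single α 1, 0)
    rw [hIncl_lie_incl] at this
    simpa [Pi.single_apply, ε_mul_self, ← Pi.zero_def] using this
  have hW : ∀ α, D.incl (0, Pi.single α 1, 0) ∈ D.triple.hm := fun α => by
    obtain ⟨f, hf⟩ := D.exists_dual_Λ α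
    have := h1 (0, Pi.single α (D.ε α)) (0, 0, f)
    rw [hIncl_lie_incl] at this
    have h2 : (fun β => D.ε β * ((Pi.single α (D.ε α) : Fin n → ℝ) β * f (D.Λ β))) =
        Pi.single α 1 := by
      ext β
      by_cases hβ : β = α
      · subst hβ; simp [hf, ε_mul_self]
      · simp [hβ]
    simpa [h2] using this
  have hv : ∀ v : V, D.incl (v, 0, 0) ∈ D.triple.hm := by
    intro v
    have hle : Submodule.span ℝ {x : V | ∃ y f, curvB D.R y f = x} ⊔
        Submodule.span ℝ (Set.range D.Λ) ≤
        D.triple.hm.comap (D.incl ∘ₗ LinearMap.inl ℝ V _) := by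
      refine sup_le (Submodule.span_le.2 ?_) (Submodule.span_le.2 ?_)
      · rintro _ ⟨y, f, rfl⟩
        exact hb y f
      · rintro _ ⟨α, rfl⟩
        exact hΛ α
    rw [D.span_eq_top] at hle
    exact hle Submodule.mem_top
  have hw : ∀ w : Fin n → ℝ, D.incl (0, w, 0) ∈ D.triple.hm := by
    intro w
    have h2 : D.incl (0, w, 0) = ∑ α, w α • D.incl (0, Pi.single α 1, 0) := by
      simp only [← map_smul, ← map_sum]
      congr 1
      refine Prod.ext ?_ (Prod.ext ?_ ?_)
      · simp [Prod.fst_sum]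
      · ext β; simp [Prod.snd_sum, Prod.fst_sum, Pi.single_apply]
      · simp [Prod.snd_sum]
    rw [h2]
    exact Submodule.sum_mem _ fun α _ => Submodule.smul_mem _ _ (hW α)
  have h3 : D.incl (v, w, 0) = D.incl (v, 0, 0) + D.incl (0, w, 0) := by
    rw [← map_add]; simp
  rw [h3]
  exact Submodule.add_mem _ (hv v) (hw w)

/-- The canonical frame of a normal form. -/
def frame : D.triple.Frame V n where
  toLin := D.incl
  range_eq := D.range_incl
  form := D.B_incl
  mem_z v := by
    refine D.triple.mem_z_of_m fun y hy => ?_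
    obtain ⟨y, rfl⟩ := D.exists_incl hy
    rw [incl_lie_incl]
    have h : D.mu (v, 0, 0) y = 0 := by
      ext α; simp [mu]
    rw [h, map_zero, LinearMap.zero_apply, map_zero]
    exact map_zero D.hIncl
  mem_hm := D.incl_mem_hm

theorem incl_injective : Function.Injective D.incl := D.frame.injective

theorem incl_mem_hm_iff {x} : D.incl x ∈ D.triple.hm ↔ x.2.2 = 0 := D.frame.mem_hm_iff

theorem incl_mem_z_iff {x} : D.incl x ∈ D.triple.z ↔ x.2 = 0 := D.frame.mem_z_iff

theorem exists_incl_of_mem_hm {x : D.triple.carrier} (hx : x ∈ D.triple.hm) :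
    ∃ v w, D.incl (v, w, 0) = x := by
  obtain ⟨⟨v, w, f⟩, rfl⟩ := D.exists_incl (D.triple.hm_le_m hx)
  obtain rfl : f = 0 := D.incl_mem_hm_iff.1 hx
  exact ⟨v, w, rfl⟩

theorem isTame : D.triple.IsTame where
  lie_hm a ha x hx := by
    obtain ⟨a, rfl⟩ := D.exists_hIncl ha
    obtain ⟨v, w, rfl⟩ := D.exists_incl_of_mem_hm hx
    rw [hIncl_lie_incl, incl_mem_z_iff]
    simp [← Pi.zero_def]
  z_le_hm x hx := by
    obtain ⟨y, rfl⟩ := D.exists_incl (D.triple.z_le_m hx)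
    rw [incl_mem_hm_iff, D.incl_mem_z_iff.1 hx]
    rfl
  nonneg x hx := by
    obtain ⟨v, w, rfl⟩ := D.exists_incl_of_mem_hm hx
    rw [B_incl]
    simpa using Finset.sum_nonneg fun α _ => mul_self_nonneg (w α)
  mem_z x hx h := by
    obtain ⟨v, w, rfl⟩ := D.exists_incl_of_mem_hm hx
    rw [B_incl] at h
    have h1 : ∑ α, w α * w α = 0 := by simpa using h
    rw [Finset.sum_eq_zero_iff_of_nonneg fun α _ => mul_self_nonneg (w α)] at h1
    rw [incl_mem_z_iff]
    refine Prod.ext (funext fun α => ?_) rfl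
    exact mul_self_eq_zero.1 (h1 α (Finset.mem_univ α))
  leastNilpotent x hx h := by
    obtain ⟨v, w, rfl⟩ := D.exists_incl_of_mem_hm hx
    rw [incl_mem_z_iff]
    refine Prod.ext (funext fun α => ?_) rfl
    obtain ⟨f, hf⟩ := D.exists_dual_Λ α
    have h1 := h _ (D.incl_mem_m (0, 0, f)) _ (D.incl_mem_m (0, 0, f))
    rw [incl_lie_incl, ← lie_skew, hIncl_lie_incl, ← map_neg, incl_mem_z_iff] at h1
    have h2 := congrFun (congrArg Prod.fst h1) α
    have h3 : D.ε α ≠ 0 := fun h0 => by simpa [h0] using D.ε_mul_self α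
    simpa [mu, hf, h3] using h2

/-- The derived series of a normal form ends after three steps: `[𝔤, 𝔤]` lies in the sum
`Y ⊕ W^* ⊕ 𝔷 ⊕ W`, whose derived algebra is central. -/
theorem isSolvable : LieAlgebra.IsSolvable D.triple.carrier := by
  have hbr : ∀ x y : D.triple.carrier, ⁅x, y⁆ = D.bracket x y := fun x y => rfl
  let I : LieIdeal ℝ D.triple.carrier :=
    { LinearMap.ker D.czs with
      lie_mem := fun {x y} _ => by
        show D.czs (D.bracket x y) = 0
        simp [bracket] }
  have h1 : LieAlgebra.derivedSeries ℝ D.triple.carrier 1 ≤ I := by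
    rw [LieAlgebra.derivedSeries_def, LieAlgebra.derivedSeriesOfIdeal_succ,
      LieAlgebra.derivedSeriesOfIdeal_zero, LieSubmodule.lie_le_iff]
    intro x _ y _
    show D.czs (D.bracket x y) = 0
    simp [bracket]
  have h2 : LieAlgebra.derivedSeries ℝ D.triple.carrier 2 ≤
      LieAlgebra.center ℝ D.triple.carrier := by
    rw [LieAlgebra.derivedSeries_def, LieAlgebra.derivedSeriesOfIdeal_succ, LieSubmodule.lie_le_iff]
    intro x hx y hy
    have hx' : D.czs x = 0 := h1 hx
    have hy' : D.czs y = 0 := h1 hy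
    show ⁅x, y⁆ ∈ D.triple.z
    have : ⁅x, y⁆ = D.incl (D.cz (D.bracket x y), 0, 0) := by
      show D.bracket x y = D.elt 0 0 _ 0 0
      apply D.ext_carrier
      · simp [bracket, hx', hy']
      · ext α; simp [bracket, hx', hy']
      · rfl
      · ext α; simp [bracket, hx', hy']
      · simp [bracket]
    rw [this]
    exact D.frame.mem_z _
  refine LieAlgebra.IsSolvable.mk (R := ℝ) (k := 3) ?_
  rw [eq_bot_iff, LieAlgebra.derivedSeries_def, LieAlgebra.derivedSeriesOfIdeal_succ,
    LieSubmodule.lie_le_iff]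
  intro x hx y _
  have hx' : x ∈ D.triple.z := h2 hx
  rw [D.triple.lie_z hx']
  exact Submodule.zero_mem _

end NormalFormData

/-! ### Simultaneous diagonalization of the operators `ad x ∘ ad y` -/

namespace SymmetricTriple

variable {τ : SymmetricTriple.{u}}

/-- `𝔥` commutes with `[𝔪, [𝔥, 𝔪]]`. -/
theorem IsTame.lie_lie_hm (h : τ.IsTame) {a x w : τ.carrier} (ha : a ∈ τ.h) (hx : x ∈ τ.m)
    (hw : w ∈ τ.hm) : ⁅a, ⁅x, w⁆⁆ = 0 := by
  rw [leibniz_lie, h.lie_hm_hm (τ.lie_mem_hm ha hx) hw, τ.lie_z' (h.lie_hm a ha w hw), add_zero]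

/-- Commuting elements may be exchanged in `B([k, a], [l, c])`. -/
theorem B_lie_swap {k l : τ.carrier} (hkl : ⁅k, l⁆ = 0) (a c : τ.carrier) :
    τ.B ⁅k, a⁆ ⁅l, c⁆ = τ.B ⁅l, a⁆ ⁅k, c⁆ := by
  rw [B_lie_left, leibniz_lie, hkl, zero_lie, zero_add, ← B_lie_left]

theorem IsTame.lie_lie_mem_hm {x y w : τ.carrier} (hx : x ∈ τ.m) (hy : y ∈ τ.m)
    (hw : w ∈ τ.hm) : ⁅x, ⁅y, w⁆⁆ ∈ τ.hm :=
  τ.lie_mem_hm' (τ.lie_mem_h hy (τ.hm_le_m hw)) hx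

/-- The form `B([x, w], [y, w'])` with `w, w' ∈ [𝔥, 𝔪]` is symmetric in `x` and `y`. -/
theorem IsTame.B_lie_lie_symm (h : τ.IsTame) {x y w w' : τ.carrier} (hx : x ∈ τ.m) (hy : y ∈ τ.m)
    (hw : w ∈ τ.hm) (hw' : w' ∈ τ.hm) : τ.B ⁅x, w⁆ ⁅y, w'⁆ = τ.B ⁅y, w⁆ ⁅x, w'⁆ := by
  have h1 := τ.B_z_hm (h.lie_hm _ (τ.lie_mem_h hx hy) w hw) hw'
  rw [lie_lie, map_sub, LinearMap.sub_apply, τ.B_lie_left x ⁅y, w⁆, τ.B_lie_left y ⁅x, w⁆] at h1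
  linarith

/-- The form `B([a, [b, w]], [c, [d, w']])` is totally symmetric in `a, b, c, d`; the symmetry in
the first two arguments. -/
theorem IsTame.B_four_swap_left (h : τ.IsTame) {a b w y : τ.carrier} (ha : a ∈ τ.m) (hb : b ∈ τ.m)
    (hw : w ∈ τ.hm) (hy : y ∈ τ.hm) : τ.B ⁅a, ⁅b, w⁆⁆ y = τ.B ⁅b, ⁅a, w⁆⁆ y := by
  rw [leibniz_lie, map_add, LinearMap.add_apply, τ.B_z_hm (h.lie_hm _ (τ.lie_mem_h ha hb) w hw) hy,
    zero_add]

/-- The form `B([a, [b, w]], [c, [d, w']])` is totally symmetric in `a, b, c, d`; the exchange of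
`b` and `d`. -/
theorem IsTame.B_four_swap (h : τ.IsTame) {a b c d w w' : τ.carrier} (hb : b ∈ τ.m)
    (hd : d ∈ τ.m) (hw : w ∈ τ.hm) (hw' : w' ∈ τ.hm) :
    τ.B ⁅a, ⁅b, w⁆⁆ ⁅c, ⁅d, w'⁆⁆ = τ.B ⁅a, ⁅d, w'⁆⁆ ⁅c, ⁅b, w⁆⁆ := by
  have h1 := B_lie_swap (h.lie_lie_hm (τ.lie_mem_h hb (τ.hm_le_m hw)) hd hw') a c
  have e : ∀ a k : τ.carrier, ⁅a, k⁆ = -⁅k, a⁆ := fun a k => (lie_skew a k).symm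
  rw [e a ⁅b, w⁆, e c ⁅d, w'⁆, e a ⁅d, w'⁆, e c ⁅b, w⁆]
  simpa only [map_neg, LinearMap.neg_apply, neg_neg] using h1

/-- The total symmetry of `B([a, [b, w]], [c, [d, w']])` makes the operators `ad a ∘ ad b` and
`ad c ∘ ad d` commute modulo the centre. -/
theorem IsTame.B_four_comm (h : τ.IsTame) {a b c d w w' : τ.carrier} (ha : a ∈ τ.m) (hb : b ∈ τ.m)
    (hc : c ∈ τ.m) (hd : d ∈ τ.m) (hw : w ∈ τ.hm) (hw' : w' ∈ τ.hm) :
    τ.B ⁅a, ⁅b, w⁆⁆ ⁅c, ⁅d, w'⁆⁆ = τ.B ⁅c, ⁅d, w⁆⁆ ⁅a, ⁅b, w'⁆⁆ := by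
  have s12 : ∀ {a b c d : τ.carrier}, a ∈ τ.m → b ∈ τ.m → c ∈ τ.m → d ∈ τ.m →
      τ.B ⁅a, ⁅b, w⁆⁆ ⁅c, ⁅d, w'⁆⁆ = τ.B ⁅b, ⁅a, w⁆⁆ ⁅c, ⁅d, w'⁆⁆ := fun ha hb hc hd =>
    h.B_four_swap_left ha hb hw (lie_lie_mem_hm hc hd hw')
  have s34 : ∀ {a b c d : τ.carrier}, a ∈ τ.m → b ∈ τ.m → c ∈ τ.m → d ∈ τ.m →
      τ.B ⁅a, ⁅b, w⁆⁆ ⁅c, ⁅d, w'⁆⁆ = τ.B ⁅a, ⁅b, w⁆⁆ ⁅d, ⁅c, w'⁆⁆ := fun ha hb hc hd => by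
    rw [τ.B_symm, h.B_four_swap_left hc hd hw' (lie_lie_mem_hm ha hb hw), τ.B_symm]
  have s13 : ∀ {a b c d : τ.carrier}, a ∈ τ.m → b ∈ τ.m → c ∈ τ.m → d ∈ τ.m →
      τ.B ⁅a, ⁅b, w⁆⁆ ⁅c, ⁅d, w'⁆⁆ = τ.B ⁅c, ⁅b, w⁆⁆ ⁅a, ⁅d, w'⁆⁆ := fun ha hb hc hd => by
    rw [h.B_four_swap hb hd hw hw', τ.B_symm]
  rw [s13 ha hb hc hd, s12 hc hb ha hd, s34 hb hc ha hd, s13 hb hc hd ha, s12 hd hc hb ha,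
    s34 hc hd hb ha]

/-- For a tame triple there are an orthonormal family `w_α` in `[𝔥, 𝔪]` which spans a complement
of the centre, signs `ε_α` and linear forms `λ_α` with `B([x, w_α], [y, w_β]) = ε_α δ_{αβ} λ_α(x)
λ_α(y)`: the operators `ad x ∘ ad y` on `[𝔥, 𝔪]` modulo the centre are self-adjoint and commute,
and the total symmetry of `B([a, [b, w]], [c, [d, w]])` forces their common eigenvalues, as
symmetric bilinear forms in `(x, y)`, to have rank one. -/
theorem IsTame.exists_eigenvectors (h : τ.IsTame) {n : ℕ}
    (hn : finrank ℝ τ.hm = finrank ℝ τ.z + n) :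
    ∃ (w : Fin n → τ.carrier) (ε : Fin n → ℝ) (lam : Fin n → Dual ℝ τ.carrier)
      (x₀ : Fin n → τ.carrier), (∀ α, w α ∈ τ.hm) ∧
      (∀ α β, τ.B (w α) (w β) = if α = β then 1 else 0) ∧
      τ.hm ≤ τ.z ⊔ Submodule.span ℝ (Set.range w) ∧ (∀ α, ε α = 1 ∨ ε α = -1) ∧
      (∀ α, x₀ α ∈ τ.m) ∧ (∀ α, lam α (x₀ α) = 1) ∧
      ∀ x ∈ τ.m, ∀ y ∈ τ.m, ∀ α β, τ.B ⁅x, w α⁆ ⁅y, w β⁆ =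
        if α = β then ε α * (lam α x * lam α y) else 0 := by
  obtain ⟨W, hle, hsup, hdisj, hnn, hd⟩ := h.exists_complement
  have hfr := Submodule.finrank_sup_add_finrank_inf_eq τ.z W
  rw [hsup, hdisj.eq_bot, finrank_bot] at hfr
  have hBW : (τ.B.restrict W).Nondegenerate := by
    constructor
    · intro x hx
      exact Subtype.ext (hd x x.2 (hx x))
    · intro x hx
      exact Subtype.ext (hd x x.2 (hx x))
  let ad : τ.carrier →ₗ[ℝ] End ℝ τ.carrier := LieModule.toEnd ℝ τ.carrier τ.carrier
  let Q : τ.m × τ.m → LinearMap.BilinForm ℝ W := fun p =>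
    -(τ.B.compl₁₂ (ad p.2 ∘ₗ W.subtype) (ad p.1 ∘ₗ W.subtype))
  let T : τ.m × τ.m → W →ₗ[ℝ] W := fun p => (Q p).symmCompOfNondegenerate (τ.B.restrict W) hBW
  have hTQ : ∀ p (w w' : W), τ.B (T p w) w' = -τ.B ⁅(p.2 : τ.carrier), (w : τ.carrier)⁆
      ⁅(p.1 : τ.carrier), (w' : τ.carrier)⁆ := fun p w w' =>
    LinearMap.BilinForm.symmCompOfNondegenerate_left_apply (Q p) hBW w' w
  -- an element of `[𝔥, 𝔪]` that is orthogonal to `W` is central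
  have hperp : ∀ d ∈ τ.hm, (∀ w ∈ W, τ.B d w = 0) → d ∈ τ.z := by
    intro d hd' h0
    refine h.mem_z d hd' ?_
    have hd'' := hd'
    rw [← hsup] at hd''
    obtain ⟨v, hv, w, hw, rfl⟩ := Submodule.mem_sup.1 hd''
    rw [map_add, h0 w hw, τ.B_hm_z hv hd', add_zero]
  have hTz : ∀ p (w : W),
      ⁅(p.1 : τ.carrier), ⁅(p.2 : τ.carrier), (w : τ.carrier)⁆⁆ - T p w ∈ τ.z := by
    intro p w
    refine hperp _ (τ.hm.sub_mem (lie_lie_mem_hm p.1.2 p.2.2 (hle w.2)) (hle (T p w).2))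
      fun w' hw' => ?_
    rw [map_sub, LinearMap.sub_apply, hTQ p w ⟨w', hw'⟩, τ.B_lie_left, sub_self]
  have hTT : ∀ p q (w w' : W), τ.B (T p w) (T q w') =
      τ.B ⁅(p.1 : τ.carrier), ⁅(p.2 : τ.carrier), (w : τ.carrier)⁆⁆
        ⁅(q.1 : τ.carrier), ⁅(q.2 : τ.carrier), (w' : τ.carrier)⁆⁆ := by
    intro p q w w'
    have h1 := τ.B_z_hm (hTz p w) (hle (T q w').2)
    have h2 := τ.B_hm_z (hTz q w') (lie_lie_mem_hm p.1.2 p.2.2 (hle w.2))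
    rw [map_sub, LinearMap.sub_apply] at h1
    rw [map_sub] at h2
    linarith
  have hTs : ∀ p (w w' : W), τ.B (T p w) w' = τ.B w (T p w') := by
    intro p w w'
    rw [τ.B_symm w, hTQ, hTQ, τ.B_symm, h.B_lie_lie_symm p.1.2 p.2.2 (hle w'.2) (hle w.2)]
  have hTC : ∀ p q, Commute (T p) (T q) := by
    intro p q
    refine LinearMap.ext fun w => ?_
    rw [← sub_eq_zero]
    refine hBW.1 _ fun w' => ?_
    show τ.B ((T p (T q w) - T q (T p w) : W) : τ.carrier) w' = 0
    rw [Submodule.coe_sub, map_sub, LinearMap.sub_apply, hTs, hTT, hTs, hTT,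
      h.B_four_comm q.1.2 q.2.2 p.1.2 p.2.2 (hle w.2) (hle w'.2), sub_self]
  obtain ⟨b, hb, hbT⟩ := exists_orthonormal_eigenbasis (τ.B.restrict W)
    (fun x y => τ.B_symm x y) (fun x => hnn x x.2) (fun x hx => Subtype.ext (hd x x.2 hx))
    T hTs hTC (n := n) (by omega)
  have hb' : ∀ α β, τ.B (b α) (b β) = if α = β then 1 else 0 := hb
  have hbm : ∀ α, (b α : τ.carrier) ∈ τ.hm := fun α => hle (b α).2
  choose c hc using hbT
  have hχ : ∀ (x y : τ.m) α β, τ.B ⁅(y : τ.carrier), (b α : τ.carrier)⁆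
      ⁅(x : τ.carrier), (b β : τ.carrier)⁆ = if α = β then -c (x, y) α else 0 := by
    intro x y α β
    have h1 := hTQ (x, y) (b α) (b β)
    rw [hc, Submodule.coe_smul, map_smul, LinearMap.smul_apply, hb'] at h1
    rw [eq_neg_iff_add_eq_zero, add_comm, ← eq_neg_iff_add_eq_zero] at h1
    rw [h1]
    split_ifs <;> simp
  have hcc : ∀ (x y x' y' : τ.m) α, c (x, y) α * c (x', y') α =
      τ.B ⁅(x : τ.carrier), ⁅(y : τ.carrier), (b α : τ.carrier)⁆⁆
        ⁅(x' : τ.carrier), ⁅(y' : τ.carrier), (b α : τ.carrier)⁆⁆ := by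
    intro x y x' y' α
    rw [← hTT (x, y) (x', y'), hc, hc]
    simp [hb', mul_comm]
  have hcs : ∀ (x y x' y' : τ.m) α, c (x, y) α * c (x', y') α = c (x, y') α * c (x', y) α := by
    intro x y x' y' α
    rw [hcc, hcc, h.B_four_swap y.2 y'.2 (hbm α) (hbm α)]
  have hcsymm : ∀ (x y : τ.m) α, c (x, y) α = c (y, x) α := by
    intro x y α
    have h1 := hχ x y α α
    have h2 := hχ y x α α
    rw [h.B_lie_lie_symm y.2 x.2 (hbm α) (hbm α), h2] at h1
    simpa using h1.symm
  have hex : ∀ α, ∃ x : τ.m, c (x, x) α = 1 ∨ c (x, x) α = -1 := by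
    intro α
    obtain ⟨x, y, hxy⟩ : ∃ x y : τ.m, c (x, y) α ≠ 0 := by
      by_contra! h0
      have h1 : (b α : τ.carrier) ∈ τ.z := by
        refine h.leastNilpotent _ (hbm α) fun x hx y hy => ?_
        have := hTz (⟨x, hx⟩, ⟨y, hy⟩) (b α)
        rwa [hc, h0, zero_smul, Submodule.coe_zero, sub_zero] at this
      have h2 := τ.B_z_hm h1 (hbm α)
      rw [hb', if_pos rfl] at h2
      exact one_ne_zero h2
    have hx : c (x, x) α ≠ 0 := by
      intro h0
      have h1 := hcs x y y x α
      rw [hcsymm y x, h0, zero_mul] at h1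
      exact hxy (mul_self_eq_zero.1 h1)
    have hsc : ∀ s : ℝ, c (s • x, s • x) α = s * s * c (x, x) α := by
      intro s
      have h1 := hχ (s • x) (s • x) α α
      have h2 := hχ x x α α
      rw [if_pos rfl] at h1 h2
      rw [Submodule.coe_smul, smul_lie, map_smul, map_smul, LinearMap.smul_apply, h2, smul_eq_mul,
        smul_eq_mul] at h1
      linarith
    refine ⟨(√|c (x, x) α|)⁻¹ • x, ?_⟩
    rw [hsc, ← mul_inv, Real.mul_self_sqrt (abs_nonneg _)]
    rcases lt_or_gt_of_ne hx with h1 | h1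
    · right
      rw [abs_of_neg h1]
      field_simp
    · left
      rw [abs_of_pos h1]
      field_simp
  choose x₀ hx₀ using hex
  have hx₀' : ∀ α, c (x₀ α, x₀ α) α * c (x₀ α, x₀ α) α = 1 := fun α => by
    rcases hx₀ α with h1 | h1 <;> rw [h1] <;> norm_num
  let lam : Fin n → Dual ℝ τ.carrier := fun α =>
    c (x₀ α, x₀ α) α • (τ.B ⁅(x₀ α : τ.carrier), (b α : τ.carrier)⁆ ∘ₗ ad (b α))
  have hlam : ∀ α (x : τ.m), lam α x = c (x₀ α, x₀ α) α * c (x, x₀ α) α := by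
    intro α x
    have h1 := hχ x (x₀ α) α α
    rw [if_pos rfl] at h1
    show c (x₀ α, x₀ α) α * τ.B _ ⁅(b α : τ.carrier), (x : τ.carrier)⁆ = _
    rw [show ⁅(b α : τ.carrier), (x : τ.carrier)⁆ = -⁅(x : τ.carrier), (b α : τ.carrier)⁆ from
      (lie_skew _ _).symm, map_neg, h1, neg_neg]
  refine ⟨fun α => b α, fun α => -c (x₀ α, x₀ α) α, lam, fun α => x₀ α, hbm, hb', ?_, ?_,
    fun α => (x₀ α).2, ?_, ?_⟩
  · rw [← hsup]
    refine sup_le_sup_left (fun x hx => ?_) _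
    have := b.mem_span ⟨x, hx⟩
    have := Submodule.mem_map_of_mem (f := W.subtype) this
    rw [Submodule.map_span, ← Set.range_comp] at this
    exact this
  · intro α
    rcases hx₀ α with h1 | h1 <;> simp [h1]
  · intro α
    rw [hlam, hx₀']
  · intro x hx y hy α β
    rw [hχ ⟨y, hy⟩ ⟨x, hx⟩, hlam α ⟨x, hx⟩, hlam α ⟨y, hy⟩]
    refine if_congr Iff.rfl ?_ rfl
    have h1 := hcs ⟨y, hy⟩ ⟨x, hx⟩ (x₀ α) (x₀ α) α
    rw [hcsymm (x₀ α) ⟨x, hx⟩] at h1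
    linear_combination (-c (x₀ α, x₀ α) α ^ 3) * h1 +
      c (⟨y, hy⟩, ⟨x, hx⟩) α * (c (x₀ α, x₀ α) α ^ 2 + 1) * hx₀' α

end SymmetricTriple

/-! ### Linear maps on the second exterior power -/

section Wedge

variable {V : Type v} [AddCommGroup V] [Module ℝ V]

theorem span_wedge : Submodule.span ℝ {ω : Lambda2 V | ∃ f g, wedge f g = ω} = ⊤ := by
  rw [eq_top_iff, ← exteriorPower.ιMulti_span ℝ 2 (Dual ℝ V)]
  refine Submodule.span_mono ?_
  rintro _ ⟨x, rfl⟩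
  refine ⟨x 0, x 1, ?_⟩
  show exteriorPower.ιMulti ℝ 2 ![x 0, x 1] = _
  congr 1
  ext i; fin_cases i <;> rfl

theorem wedge_hom_ext {M : Type*} [AddCommGroup M] [Module ℝ M] {φ ψ : Lambda2 V →ₗ[ℝ] M}
    (h : ∀ f g, φ (wedge f g) = ψ (wedge f g)) : φ = ψ := by
  refine LinearMap.ext_on span_wedge ?_
  rintro _ ⟨f, g, rfl⟩
  exact h f g

/-- Bilinear forms on `Λ²` agree if they agree on decomposable elements. -/
theorem wedge_form_ext {R R' : LinearMap.BilinForm ℝ (Lambda2 V)}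
    (h : ∀ f g f' g', R (wedge f g) (wedge f' g') = R' (wedge f g) (wedge f' g')) : R = R' :=
  wedge_hom_ext fun f g => wedge_hom_ext fun f' g' => h f g f' g'

/-- The linear map on `Λ²` induced by an alternating bilinear map. -/
def wedgeLift {M : Type*} [AddCommGroup M] [Module ℝ M] (φ : Dual ℝ V →ₗ[ℝ] Dual ℝ V →ₗ[ℝ] M)
    (h : ∀ f, φ f f = 0) : Lambda2 V →ₗ[ℝ] M :=
  exteriorPower.alternatingMapLinearEquiv
    { toFun := fun x => φ (x 0) (x 1)
      map_update_add' := by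
        intro _ x i f g
        fin_cases i <;> simp [Function.update]
      map_update_smul' := by
        intro _ x i c f
        fin_cases i <;> simp [Function.update]
      map_eq_zero_of_eq' := by
        intro x i j hij hne
        fin_cases i <;> fin_cases j
        · exact absurd rfl hne
        · rw [show x 0 = x 1 from hij]; exact h _
        · rw [show x 1 = x 0 from hij]; exact h _
        · exact absurd rfl hne }

@[simp] theorem wedgeLift_wedge {M : Type*} [AddCommGroup M] [Module ℝ M]
    (φ : Dual ℝ V →ₗ[ℝ] Dual ℝ V →ₗ[ℝ] M) (h : ∀ f, φ f f = 0) (f g : Dual ℝ V) :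
    wedgeLift φ h (wedge f g) = φ f g := by
  show exteriorPower.alternatingMapLinearEquiv _ (exteriorPower.ιMulti ℝ 2 ![f, g]) = _
  rw [exteriorPower.alternatingMapLinearEquiv_apply_ιMulti]
  rfl

end Wedge

/-! ### Tame triples are normal forms -/

namespace SymmetricTriple

variable {τ : SymmetricTriple.{u}}

/-- The eigenvectors `w_α` can be chosen, by adding central elements, in such a way that `[x, y] ⊥
[𝔪, w_α]` for all `x, y ∈ 𝔪` that are orthogonal to the `w_α`. The Bianchi identity reduces this
to `B(x, [x₀, [x₀, w_α]]) = 0` for a suitable `x₀`, and `[x₀, [x₀, w_α]]` is a multiple of `w_α`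
modulo the centre, so it can take the role of `w_α`. -/
theorem IsTame.exists_adapted_eigenvectors (h : τ.IsTame) {n : ℕ}
    (hn : finrank ℝ τ.hm = finrank ℝ τ.z + n) :
    ∃ (w : Fin n → τ.carrier) (ε : Fin n → ℝ) (lam : Fin n → Dual ℝ τ.carrier)
      (x₀ : Fin n → τ.carrier), (∀ α, w α ∈ τ.hm) ∧
      (∀ α β, τ.B (w α) (w β) = if α = β then 1 else 0) ∧
      τ.hm ≤ τ.z ⊔ Submodule.span ℝ (Set.range w) ∧ (∀ α, ε α = 1 ∨ ε α = -1) ∧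
      (∀ α, x₀ α ∈ τ.m) ∧ (∀ α, lam α (x₀ α) = 1) ∧
      (∀ x ∈ τ.m, ∀ y ∈ τ.m, ∀ α β, τ.B ⁅x, w α⁆ ⁅y, w β⁆ =
        if α = β then ε α * (lam α x * lam α y) else 0) ∧
      ∀ x ∈ τ.m, ∀ y ∈ τ.m, (∀ α, τ.B x (w α) = 0) → (∀ α, τ.B y (w α) = 0) →
        ∀ k ∈ τ.m, ∀ α, τ.B ⁅x, y⁆ ⁅k, w α⁆ = 0 := by
  obtain ⟨w, ε, lam, x₀, hw, hww, hspan, hε, hx₀, hlam, hB⟩ := h.exists_eigenvectors hn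
  have hεε : ∀ α, ε α * ε α = 1 := fun α => by
    rcases hε α with h1 | h1 <;> rw [h1] <;> norm_num
  have hperp : ∀ d ∈ τ.hm, (∀ α, τ.B d (w α) = 0) → d ∈ τ.z := by
    intro d hd h0
    refine h.mem_z d hd ?_
    have hle : τ.z ⊔ Submodule.span ℝ (Set.range w) ≤ LinearMap.ker (τ.B d) := by
      refine sup_le (fun v hv => τ.B_hm_z hv hd) (Submodule.span_le.2 ?_)
      rintro _ ⟨α, rfl⟩
      exact h0 α
    exact hle (hspan hd)
  have hxyw : ∀ x ∈ τ.m, ∀ y ∈ τ.m, ∀ α,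
      ⁅x, ⁅y, w α⁆⁆ + (ε α * (lam α x * lam α y)) • w α ∈ τ.z := by
    intro x hx y hy α
    refine hperp _ (τ.hm.add_mem (lie_lie_mem_hm hx hy (hw α)) (τ.hm.smul_mem _ (hw α)))
      fun β => ?_
    rw [map_add, LinearMap.add_apply, map_smul, LinearMap.smul_apply, τ.B_lie_left,
      hB y hy x hx, hww]
    split_ifs
    · rw [smul_eq_mul]; ring
    · simp
  set w' : Fin n → τ.carrier := fun α => (-ε α) • ⁅x₀ α, ⁅x₀ α, w α⁆⁆ with hw'
  have hw'm : ∀ α, w' α ∈ τ.hm := fun α =>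
    τ.hm.smul_mem _ (lie_lie_mem_hm (hx₀ α) (hx₀ α) (hw α))
  have hdz : ∀ α, w α - w' α ∈ τ.z := by
    intro α
    have h1 := τ.z.smul_mem (ε α) (hxyw _ (hx₀ α) _ (hx₀ α) α)
    rw [hlam, smul_add, smul_smul, mul_one, mul_one, hεε, one_smul] at h1
    rw [hw']
    simpa [add_comm] using h1
  have hBw' : ∀ y ∈ τ.hm, ∀ α, τ.B y (w' α) = τ.B y (w α) := by
    intro y hy α
    have := τ.B_hm_z (hdz α) hy
    rw [map_sub, sub_eq_zero] at this
    exact this.symm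
  have hlie : ∀ (x : τ.carrier) α, ⁅x, w' α⁆ = ⁅x, w α⁆ := by
    intro x α
    have := τ.lie_z' (y := x) (hdz α)
    rw [lie_sub, sub_eq_zero] at this
    exact this.symm
  refine ⟨w', ε, lam, x₀, hw'm, ?_, ?_, hε, hx₀, hlam, ?_, ?_⟩
  · intro α β
    rw [hBw' _ (hw'm α), τ.B_symm, hBw' _ (hw β), τ.B_symm, hww]
  · refine hspan.trans (sup_le le_sup_left (Submodule.span_le.2 ?_))
    rintro _ ⟨α, rfl⟩
    rw [← sub_add_cancel (w α) (w' α)]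
    exact Submodule.add_mem_sup (hdz α) (Submodule.subset_span ⟨α, rfl⟩)
  · intro x hx y hy α β
    rw [hlie, hlie, hB x hx y hy]
  · intro x hx y hy hxw hyw k hk α
    rw [hlie]
    -- `C(x, y, k) = B([[x, y], k], w_α)` equals `λ_α(k) C(x, y, x₀)`
    have hC : ∀ {x y k : τ.carrier}, x ∈ τ.m → y ∈ τ.m → k ∈ τ.m →
        τ.B ⁅⁅x, y⁆, k⁆ (w α) = lam α k * τ.B ⁅⁅x, y⁆, x₀ α⁆ (w α) := by
      intro x y k hx hy hk
      have hxy := τ.lie_mem_h hx hy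
      have h1 := B_lie_swap (h.lie_lie_hm hxy (hx₀ α) (hw α)) (x₀ α) k
      have h2 := τ.B_hm_z (hxyw k hk _ (hx₀ α) α) (τ.lie_mem_hm hxy (hx₀ α))
      have h3 := τ.B_hm_z (hxyw _ (hx₀ α) _ (hx₀ α) α) (τ.lie_mem_hm hxy hk)
      rw [map_add, map_smul, smul_eq_mul, hlam] at h2 h3
      rw [← lie_skew k, map_neg] at h2
      rw [← lie_skew (x₀ α) ⁅x₀ α, w α⁆, map_neg, τ.B_symm _ ⁅⁅x₀ α, w α⁆, x₀ α⁆, ← h1] at h3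
      have h4 := hεε α
      linear_combination ε α * h3 - ε α * h2 - (τ.B ⁅⁅x, y⁆, k⁆ (w α) -
        lam α k * τ.B ⁅⁅x, y⁆, x₀ α⁆ (w α)) * h4
    have hC0 : ∀ {x : τ.carrier}, (∀ β, τ.B x (w' β) = 0) →
        τ.B ⁅⁅x, x₀ α⁆, x₀ α⁆ (w α) = 0 := by
      intro x hx
      have h1 := hx α
      rw [hw'] at h1
      simp only [map_smul, smul_eq_mul] at h1
      rw [τ.B_lie_assoc, τ.B_lie_assoc]
      have h2 := hεε α
      linear_combination (-ε α) * h1 - τ.B x ⁅x₀ α, ⁅x₀ α, w α⁆⁆ * h2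
    rw [← τ.B_lie_assoc, hC hx hy hk]
    have hjac : ⁅⁅x, y⁆, x₀ α⁆ = ⁅⁅x, x₀ α⁆, y⁆ - ⁅⁅y, x₀ α⁆, x⁆ := by
      rw [lie_lie x y, ← lie_skew ⁅x, x₀ α⁆, ← lie_skew ⁅y, x₀ α⁆]
      abel
    rw [hjac, map_sub, LinearMap.sub_apply, hC hx (hx₀ α) hy, hC hy (hx₀ α) hx, hC0 hxw, hC0 hyw]
    ring

/-- A tame symmetric triple is isomorphic to a normal form. -/
theorem IsTame.exists_normalForm (h : τ.IsTame) {V : Type v} [AddCommGroup V] [Module ℝ V]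
    [FiniteDimensional ℝ V] (hV : finrank ℝ V = finrank ℝ τ.z) {n : ℕ}
    (hn : finrank ℝ τ.hm = finrank ℝ τ.z + n) :
    ∃ D : NormalFormData V n, Nonempty (τ.Iso D.triple) := by
  classical
  obtain ⟨w, ε, lam, x₀, hw, hww, hspan, hε, hx₀, hlam, hB, hperp⟩ :=
    h.exists_adapted_eigenvectors hn
  obtain ⟨F, hF⟩ := exists_frame hV h.z_le_hm w hw hww hspan
  let e : Dual ℝ V →ₗ[ℝ] τ.carrier :=
    F.toLin ∘ₗ LinearMap.inr ℝ V _ ∘ₗ LinearMap.inr ℝ (Fin n → ℝ) _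
  have hem : ∀ f, e f ∈ τ.m := fun f => F.mem_m _
  have hew : ∀ f α, τ.B (e f) (w α) = 0 := fun f α => by
    rw [← hF]
    show τ.B (F.toLin (0, 0, f)) _ = 0
    rw [F.form]
    simp
  have hF' : ∀ x, F.toLin x = F.toLin (x.1, 0, 0) + ∑ α, x.2.1 α • w α + e x.2.2 := by
    intro x
    show _ = _ + F.toLin (0, 0, x.2.2)
    simp only [← hF, ← map_smul, ← map_sum, ← map_add]
    congr 1
    refine Prod.ext ?_ (Prod.ext ?_ ?_)
    · simp [Prod.fst_sum]
    · ext β; simp [Prod.snd_sum, Prod.fst_sum, Pi.single_apply]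
    · simp [Prod.snd_sum]
  have hlamhm : ∀ y ∈ τ.hm, ∀ α, lam α y = 0 := by
    intro y hy α
    have h1 := hB y (τ.hm_le_m hy) _ (hx₀ α) α α
    rw [h.lie_hm_hm hy (hw α), map_zero, LinearMap.zero_apply, if_pos rfl, hlam, mul_one] at h1
    rcases hε α with h2 | h2 <;> rw [h2] at h1 <;> linarith
  let Λ : Fin n → V := fun α => (evalEquiv ℝ V).symm (lam α ∘ₗ e)
  have hΛ : ∀ (f : Dual ℝ V) α, f (Λ α) = lam α (e f) := fun f α =>
    LinearMap.congr_fun (LinearEquiv.apply_symm_apply (evalEquiv ℝ V) (lam α ∘ₗ e)) f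
  have hΛ0 : ∀ α, Λ α ≠ 0 := by
    intro α h0
    obtain ⟨⟨v, x, f⟩, hy⟩ := F.exists_eq (hx₀ α)
    have h1 : lam α (e f) = 1 := by
      have h2 := hlam α
      have h3 : F.toLin (v, x, f) = F.toLin (v, x, 0) + e f := by
        show _ = _ + F.toLin (0, 0, f)
        rw [← map_add]; simp
      rwa [← hy, h3, map_add, hlamhm _ (F.mem_hm v x), zero_add] at h2
    rw [← hΛ, h0, map_zero] at h1
    exact zero_ne_one h1
  -- the form `B([e f, e g], [e f', e g'])` on `Λ²`
  let c : Lambda2 V →ₗ[ℝ] τ.carrier := wedgeLift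
    ((LieModule.toEnd ℝ τ.carrier τ.carrier : τ.carrier →ₗ[ℝ] End ℝ τ.carrier).compl₁₂ e e)
    fun f => lie_self (e f)
  have hc : ∀ f g, c (wedge f g) = ⁅e f, e g⁆ := fun f g => wedgeLift_wedge _ _ f g
  let R : LinearMap.BilinForm ℝ (Lambda2 V) := τ.B.compl₁₂ c c
  have hR : ∀ f g f' g', R (wedge f g) (wedge f' g') = τ.B ⁅e f, e g⁆ ⁅e f', e g'⁆ :=
    fun f g f' g' => by rw [← hc, ← hc]; rfl
  have hRc : IsCurvatureTensor R := by
    refine ⟨fun ω η => τ.B_symm _ _, fun f₁ f₂ f₃ f₄ => ?_⟩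
    rw [hR, hR, hR, ← τ.B_lie_assoc, ← τ.B_lie_assoc, ← τ.B_lie_assoc, ← LinearMap.add_apply,
      ← map_add, ← LinearMap.add_apply, ← map_add]
    have h1 : ⁅⁅e f₁, e f₂⁆, e f₃⁆ + ⁅⁅e f₂, e f₃⁆, e f₁⁆ + ⁅⁅e f₃, e f₁⁆, e f₂⁆ = 0 := by
      rw [lie_lie, ← lie_skew ⁅e f₂, e f₃⁆, ← lie_skew ⁅e f₃, e f₁⁆, ← lie_skew (e f₃) (e f₁),
        lie_neg]
      abel
    rw [h1, map_zero, LinearMap.zero_apply]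
  -- brackets of elements of `𝔪`
  have hlie : ∀ x x', ⁅F.toLin x, F.toLin x'⁆ = ⁅e x.2.2, e x'.2.2⁆ +
      ∑ α, (x'.2.1 α • ⁅e x.2.2, w α⁆ - x.2.1 α • ⁅e x'.2.2, w α⁆) := by
    intro x x'
    have h1 : ∀ y : Fin n → ℝ, ∑ α, y α • w α ∈ τ.hm := fun y =>
      τ.hm.sum_mem fun α _ => τ.hm.smul_mem _ (hw α)
    rw [hF' x, hF' x']
    simp only [add_lie, lie_add, τ.lie_z (F.mem_z _), τ.lie_z' (F.mem_z _),
      h.lie_hm_hm (h1 x.2.1) (h1 x'.2.1), zero_add]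
    rw [← lie_skew (∑ α, x.2.1 α • w α), lie_sum, lie_sum, Finset.sum_sub_distrib]
    simp only [lie_smul]
    abel
  have hquad : ∀ x x' u u', τ.B ⁅F.toLin x, F.toLin x'⁆ ⁅F.toLin u, F.toLin u'⁆ =
      R (wedge x.2.2 x'.2.2) (wedge u.2.2 u'.2.2) +
      ∑ α, ε α * ((x.2.2 (Λ α) * x'.2.1 α - x'.2.2 (Λ α) * x.2.1 α) *
        (u.2.2 (Λ α) * u'.2.1 α - u'.2.2 (Λ α) * u.2.1 α)) := by
    intro x x' u u'
    have h1 : ∀ f g k α, τ.B ⁅e f, e g⁆ ⁅e k, w α⁆ = 0 := fun f g k α =>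
      hperp _ (hem f) _ (hem g) (hew f) (hew g) _ (hem k) α
    have h2 : ∀ f g k α, τ.B ⁅e k, w α⁆ ⁅e f, e g⁆ = 0 := fun f g k α => by rw [τ.B_symm, h1]
    have h3 : ∀ f g α β, τ.B ⁅e f, w α⁆ ⁅e g, w β⁆ =
        if α = β then ε α * (f (Λ α) * g (Λ α)) else 0 := fun f g α β => by
      rw [hB _ (hem f) _ (hem g), hΛ, hΛ]
    rw [hlie, hlie, hR]
    simp only [map_add, LinearMap.add_apply, map_sum, LinearMap.sum_apply, map_sub,
      LinearMap.sub_apply, map_smul, LinearMap.smul_apply, h1, h2, h3, sub_zero,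
      Finset.sum_const_zero, add_zero, zero_add, smul_eq_mul, mul_ite, mul_zero]
    congr 1
    refine Finset.sum_congr rfl fun α _ => ?_
    simp [Finset.sum_sub_distrib]
    ring
  have htop : Submodule.span ℝ {x : V | ∃ y f, curvB R y f = x} ⊔
      Submodule.span ℝ (Set.range Λ) = ⊤ := by
    by_contra hne
    obtain ⟨f, hf0, hf⟩ := Submodule.exists_le_ker_of_lt_top _ (lt_top_iff_ne_top.2 hne)
    have hfb : ∀ y g, f (curvB R y g) = 0 := fun y g =>
      hf (Submodule.mem_sup_left (Submodule.subset_span ⟨y, g, rfl⟩))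
    have hfΛ : ∀ α, f (Λ α) = 0 := fun α =>
      hf (Submodule.mem_sup_right (Submodule.subset_span ⟨α, rfl⟩))
    have hfR : ∀ g ω, R (wedge f g) ω = 0 := by
      intro g ω
      rw [hRc.symm, wedge_swap, map_neg, ← curvLeft_proj, ← apply_curvB, hfb, neg_zero]
    refine hf0 ?_
    have hz : F.toLin (0, 0, f) ∈ τ.z := by
      refine τ.mem_z_of_m fun y hy => τ.eq_zero_of_h' (τ.lie_mem_h (F.mem_m _) hy)
        fun u hu u' hu' => ?_
      obtain ⟨y, rfl⟩ := F.exists_eq hy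
      obtain ⟨u, rfl⟩ := F.exists_eq hu
      obtain ⟨u', rfl⟩ := F.exists_eq hu'
      rw [hquad]
      simp [hfR, hfΛ]
    exact congrArg Prod.snd (F.mem_z_iff.1 hz)
  let D : NormalFormData V n := ⟨R, hRc, ε, hε, Λ, hΛ0, htop⟩
  obtain ⟨Φ, -⟩ := exists_iso_of_parametrizations F.toLin D.incl F.range_eq D.range_incl
    (fun x y => by rw [D.B_incl, F.form]) (fun x y x' y' => by
      rw [hquad, D.B_lie_incl]; rfl)
  exact ⟨D, ⟨Φ⟩⟩

/-- Triples in `𝒯_{p,q}` are isomorphic to normal forms. -/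
theorem IsT.exists_normalForm {p q : ℕ} (h : τ.IsT p q) {V : Type v} [AddCommGroup V] [Module ℝ V]
    [FiniteDimensional ℝ V] (hV : finrank ℝ V = p) :
    ∃ D : NormalFormData V (q - p), Nonempty (τ.Iso D.triple) := by
  refine h.isTame.exists_normalForm (hV.trans h.maximal_center.symm) ?_
  have h1 := h.signature.finrank_m
  have h2 := τ.finrank_hm_add_finrank_z
  have h3 := h.maximal_center
  have h4 := h.le
  omega

end SymmetricTriple

/-! ### Passing to direct summands -/

namespace SymmetricTriple

/-- Tameness passes to a retract `ρ` of `τ` whose complement commutes with it, in particular to the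
summands of a direct sum. -/
theorem IsTame.of_retract {ρ : SymmetricTriple.{u}} {τ : SymmetricTriple.{v}} (h : τ.IsTame)
    (j : ρ.carrier →ₗ⁅ℝ⁆ τ.carrier) (r : τ.carrier →ₗ⁅ℝ⁆ ρ.carrier) (hrj : ∀ x, r (j x) = x)
    (hj : ∀ x, j (ρ.σ x) = τ.σ (j x)) (hr : ∀ x, r (τ.σ x) = ρ.σ (r x))
    (hB : ∀ x y, τ.B (j x) (j y) = ρ.B x y) (hl : ∀ x y, ⁅j x, y⁆ = j ⁅x, r y⁆) : ρ.IsTame := by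
  have jh : ∀ x ∈ ρ.h, j x ∈ τ.h := fun x hx => by rw [mem_h, ← hj, ρ.mem_h.1 hx]
  have jm : ∀ x ∈ ρ.m, j x ∈ τ.m := fun x hx => by rw [mem_m, ← hj, ρ.mem_m.1 hx, map_neg]
  have rh : ∀ x ∈ τ.h, r x ∈ ρ.h := fun x hx => by rw [mem_h, ← hr, τ.mem_h.1 hx]
  have rm : ∀ x ∈ τ.m, r x ∈ ρ.m := fun x hx => by rw [mem_m, ← hr, τ.mem_m.1 hx, map_neg]
  have jz : ∀ x ∈ ρ.z, j x ∈ τ.z := fun x hx => τ.mem_z.2 fun y => by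
    rw [hl, ρ.lie_z hx, map_zero]
  have rz : ∀ x ∈ τ.z, r x ∈ ρ.z := fun x hx => ρ.mem_z.2 fun y => by
    rw [← hrj y, ← LieHom.map_lie, τ.lie_z hx, map_zero]
  have jhm : ∀ x ∈ ρ.hm, j x ∈ τ.hm := fun x hx => by
    refine (ρ.hm_le_iff (N := τ.hm.comap (j : ρ.carrier →ₗ[ℝ] τ.carrier))).2
      (fun a ha y hy => ?_) hx
    show j ⁅a, y⁆ ∈ τ.hm
    rw [LieHom.map_lie]
    exact τ.lie_mem_hm (jh a ha) (jm y hy)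
  have rhm : ∀ x ∈ τ.hm, r x ∈ ρ.hm := fun x hx => by
    refine (τ.hm_le_iff (N := ρ.hm.comap (r : τ.carrier →ₗ[ℝ] ρ.carrier))).2
      (fun a ha y hy => ?_) hx
    show r ⁅a, y⁆ ∈ ρ.hm
    rw [LieHom.map_lie]
    exact ρ.lie_mem_hm (rh a ha) (rm y hy)
  have jz' : ∀ x, j x ∈ τ.z → x ∈ ρ.z := fun x hx => hrj x ▸ rz _ hx
  refine ⟨fun a ha w hw => jz' _ ?_, fun x hx => ?_, fun w hw => ?_, fun w hw h0 => jz' _ ?_,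
    fun w hw hxy => jz' _ ?_⟩
  · rw [LieHom.map_lie]
    exact h.lie_hm _ (jh a ha) _ (jhm w hw)
  · rw [← hrj x]
    exact rhm _ (h.z_le_hm (jz x hx))
  · rw [← hB]
    exact h.nonneg _ (jhm w hw)
  · exact h.mem_z _ (jhm w hw) (by rw [hB, h0])
  · refine h.leastNilpotent _ (jhm w hw) fun x hx y hy => ?_
    rw [← lie_skew y, hl, ← map_neg, lie_skew, ← lie_skew x, hl, ← map_neg, lie_skew]
    exact jz _ (hxy _ (rm x hx) _ (rm y hy))

theorem IsTame.of_iso {ρ : SymmetricTriple.{u}} {τ : SymmetricTriple.{v}} (h : τ.IsTame)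
    (e : τ.Iso ρ) : ρ.IsTame := by
  refine h.of_retract (e.toLieEquiv.symm : ρ.carrier →ₗ⁅ℝ⁆ τ.carrier)
    (e.toLieEquiv : τ.carrier →ₗ⁅ℝ⁆ ρ.carrier) (fun x => e.toLieEquiv.apply_symm_apply x)
    (fun x => ?_) e.map_σ (fun x y => ?_) (fun x y => ?_)
  · apply e.toLieEquiv.injective
    show e.toLieEquiv (e.toLieEquiv.symm _) = e.toLieEquiv (τ.σ (e.toLieEquiv.symm _))
    rw [e.map_σ, e.toLieEquiv.apply_symm_apply, e.toLieEquiv.apply_symm_apply]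
  · show τ.B (e.toLieEquiv.symm x) (e.toLieEquiv.symm y) = _
    rw [← e.map_B, e.toLieEquiv.apply_symm_apply, e.toLieEquiv.apply_symm_apply]
  · show ⁅e.toLieEquiv.symm x, y⁆ = e.toLieEquiv.symm ⁅x, e.toLieEquiv y⁆
    rw [LieEquiv.map_lie, e.toLieEquiv.symm_apply_apply]

section DirectSum

variable {s : ℕ} (t : Fin s → SymmetricTriple.{u})

/-- The inclusion of a summand. -/
def sumSingle (i : Fin s) : (t i).carrier →ₗ⁅ℝ⁆ (directSum t).carrier where
  toLinearMap := LinearMap.single ℝ (fun j => (t j).carrier) i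
  map_lie' {x y} := by
    funext j
    show (Pi.single i ⁅x, y⁆ : ∀ j, (t j).carrier) j =
      ⁅(Pi.single i x : ∀ j, (t j).carrier) j, (Pi.single i y : ∀ j, (t j).carrier) j⁆
    by_cases hj : j = i
    · subst hj; simp
    · simp [Pi.single_eq_of_ne hj]

/-- The projection onto a summand. -/
def sumProj (i : Fin s) : (directSum t).carrier →ₗ⁅ℝ⁆ (t i).carrier where
  toLinearMap := LinearMap.proj (φ := fun j => (t j).carrier) i
  map_lie' := rfl

theorem sumProj_sumSingle (i : Fin s) (x : (t i).carrier) : sumProj t i (sumSingle t i x) = x :=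
  Pi.single_eq_same (M := fun j => (t j).carrier) i x

theorem sumProj_sumSingle_of_ne {i j : Fin s} (h : j ≠ i) (x : (t i).carrier) :
    sumProj t j (sumSingle t i x) = 0 :=
  Pi.single_eq_of_ne (M := fun j => (t j).carrier) h x

theorem directSum_ext {x y : (directSum t).carrier} (h : ∀ i, sumProj t i x = sumProj t i y) :
    x = y := funext h

theorem directSum_B (x y : (directSum t).carrier) :
    (directSum t).B x y = ∑ i, (t i).B (sumProj t i x) (sumProj t i y) := rfl

theorem sumProj_σ (i : Fin s) (x : (directSum t).carrier) :
    sumProj t i ((directSum t).σ x) = (t i).σ (sumProj t i x) := rfl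

theorem IsTame.of_directSum (h : (directSum t).IsTame) (i : Fin s) : (t i).IsTame := by
  refine h.of_retract (sumSingle t i) (sumProj t i) (sumProj_sumSingle t i) (fun x => ?_)
    (sumProj_σ t i) (fun x y => ?_) (fun x y => ?_)
  · refine directSum_ext t fun j => ?_
    rw [sumProj_σ]
    by_cases hj : j = i
    · subst hj; rw [sumProj_sumSingle, sumProj_sumSingle]
    · rw [sumProj_sumSingle_of_ne t hj, sumProj_sumSingle_of_ne t hj, map_zero]
  · rw [directSum_B, Finset.sum_eq_single i]
    · rw [sumProj_sumSingle, sumProj_sumSingle]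
    · intro j _ hj
      rw [sumProj_sumSingle_of_ne t hj, map_zero, LinearMap.zero_apply]
    · simp
  · refine directSum_ext t fun j => ?_
    rw [LieHom.map_lie]
    by_cases hj : j = i
    · subst hj; rw [sumProj_sumSingle, sumProj_sumSingle]
    · rw [sumProj_sumSingle_of_ne t hj, sumProj_sumSingle_of_ne t hj, zero_lie]

end DirectSum

end SymmetricTriple

namespace NormalFormData

variable {V : Type v} [AddCommGroup V] [Module ℝ V] [FiniteDimensional ℝ V] {n : ℕ}
  (D : NormalFormData V n)

/-- The indecomposable summands of a normal form belong to the classes `𝒯_{p',q'}`: they are tame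
and solvable, and they are not zero. -/
theorem isT_of_iso_directSum {s : ℕ} (t : Fin s → SymmetricTriple.{v})
    (e : D.triple.Iso (SymmetricTriple.directSum t)) (i : Fin s) (hi : (t i).Indecomposable)
    (hnt : Nontrivial (t i).carrier) : ∃ p' q', (t i).IsT p' q' := by
  refine (SymmetricTriple.IsTame.of_directSum t (D.isTame.of_iso e) i).isT ?_ hi hnt
  have := D.isSolvable
  let j : (t i).carrier →ₗ⁅ℝ⁆ D.triple.carrier :=
    (e.toLieEquiv.symm : (SymmetricTriple.directSum t).carrier →ₗ⁅ℝ⁆ D.triple.carrier).comp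
      (SymmetricTriple.sumSingle t i)
  have hj : Function.Injective j := by
    refine e.toLieEquiv.symm.injective.comp fun x y h => ?_
    have h' : SymmetricTriple.sumSingle t i x = SymmetricTriple.sumSingle t i y := h
    rw [← SymmetricTriple.sumProj_sumSingle t i x, h', SymmetricTriple.sumProj_sumSingle]
  exact hj.lieAlgebra_isSolvable

end NormalFormData

/-! ### Decomposition into indecomposable triples -/

namespace SymmetricTriple

variable {τ : SymmetricTriple.{u}}

/-- The subspaces of `𝔪` that split off: those on which `B` is non-degenerate and which are
invariant under `ad 𝔥`. -/
structure IsSplit (τ : SymmetricTriple.{u}) (N : Submodule ℝ τ.carrier) : Prop where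
  le_m : N ≤ τ.m
  nondeg : ∀ x ∈ N, (∀ y ∈ N, τ.B x y = 0) → x = 0
  lie_mem : ∀ a ∈ τ.h, ∀ x ∈ N, ⁅a, x⁆ ∈ N

theorem isSplit_m (τ : SymmetricTriple.{u}) : τ.IsSplit τ.m :=
  ⟨le_rfl, fun _ hx h => τ.eq_zero_of_m hx h, fun _ ha _ hx => τ.lie_mem_m ha hx⟩

theorem exists_add_orthogonal {N : Submodule ℝ τ.carrier}
    (hN : ∀ x ∈ N, (∀ y ∈ N, τ.B x y = 0) → x = 0) (x : τ.carrier) :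
    ∃ n ∈ N, ∃ n' ∈ τ.B.orthogonal N, n + n' = x := by
  have h : (τ.B.restrict N).Nondegenerate := by
    have hs : (τ.B.restrict N).IsRefl := fun x y h => (τ.B_symm _ _).trans h
    refine hs.nondegenerate_iff_separatingLeft.2 fun x hx => ?_
    exact Subtype.ext (hN x x.2 fun y hy => hx ⟨y, hy⟩)
  have := (LinearMap.BilinForm.isCompl_orthogonal_of_restrict_nondegenerate τ.B_isRefl h).sup_eq_top
  exact Submodule.mem_sup.1 (this ▸ Submodule.mem_top (x := x))

/-- Orthogonal subspaces, one of which is `ad 𝔥`-invariant, commute. -/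
theorem lie_eq_zero_of_orthogonal {N N' : Submodule ℝ τ.carrier} (hN : τ.IsSplit N) (hN' : N' ≤ τ.m)
    (ho : ∀ x ∈ N, ∀ y ∈ N', τ.B x y = 0) {x y : τ.carrier} (hx : x ∈ N) (hy : y ∈ N') :
    ⁅x, y⁆ = 0 := by
  refine τ.eq_zero_of_h (τ.lie_mem_h (hN.le_m hx) (hN' hy)) fun a ha => ?_
  rw [τ.B_symm, ← τ.B_lie_assoc, ho _ (hN.lie_mem a ha x hx) _ hy]

theorem lie_lie_eq_zero {x y w : τ.carrier} (hx : ⁅x, w⁆ = 0) (hy : ⁅y, w⁆ = 0) :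
    ⁅⁅x, y⁆, w⁆ = 0 := by
  rw [lie_lie, hx, hy, lie_zero, lie_zero, sub_zero]

namespace IsSplit

variable {N N' : Submodule ℝ τ.carrier}

theorem inf_orthogonal (hN : τ.IsSplit N) (hN' : τ.IsSplit N') (hle : N' ≤ N) :
    τ.IsSplit (N ⊓ τ.B.orthogonal N') := by
  refine ⟨inf_le_left.trans hN.le_m, fun x hx h => ?_,
    fun a ha x hx => ⟨hN.lie_mem a ha x hx.1, ?_⟩⟩
  · refine hN.nondeg x hx.1 fun y hy => ?_
    obtain ⟨n, hn, n', hn', rfl⟩ := exists_add_orthogonal hN'.nondeg y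
    have h1 : n' ∈ N := by
      have := N.sub_mem hy (hle hn)
      rwa [add_sub_cancel_left] at this
    have h2 : τ.B n x = 0 := hx.2 n hn
    rw [map_add, h n' ⟨h1, hn'⟩, τ.B_symm, h2, add_zero]
  · intro n hn
    show τ.B n ⁅a, x⁆ = 0
    have h1 := τ.B_lie a n x
    have h2 : τ.B ⁅a, n⁆ x = 0 := hx.2 _ (hN'.lie_mem a ha n hn)
    linarith

variable (N) in
/-- The subspace `[N, N]`. -/
def lieSpan : Submodule ℝ τ.carrier :=
  Submodule.span ℝ {z | ∃ x y : τ.carrier, x ∈ N ∧ y ∈ N ∧ ⁅x, y⁆ = z}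

theorem lie_mem_lieSpan {x y : τ.carrier} (hx : x ∈ N) (hy : y ∈ N) : ⁅x, y⁆ ∈ lieSpan N :=
  Submodule.subset_span ⟨x, y, hx, hy, rfl⟩

theorem lieSpan_le {K : Submodule ℝ τ.carrier} (h : ∀ x ∈ N, ∀ y ∈ N, ⁅x, y⁆ ∈ K) :
    lieSpan N ≤ K := by
  refine Submodule.span_le.2 ?_
  rintro _ ⟨x, y, hx, hy, rfl⟩
  exact h x hx y hy

theorem lieSpan_le_h (hN : τ.IsSplit N) : lieSpan N ≤ τ.h :=
  lieSpan_le fun _ hx _ hy => τ.lie_mem_h (hN.le_m hx) (hN.le_m hy)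

theorem lie_mem_lieSpan_of_h (hN : τ.IsSplit N) {a k : τ.carrier} (ha : a ∈ τ.h)
    (hk : k ∈ lieSpan N) : ⁅a, k⁆ ∈ lieSpan N := by
  refine lieSpan_le (K := (lieSpan N).comap (LieModule.toEnd ℝ τ.carrier τ.carrier a))
    (fun x hx y hy => ?_) hk
  show ⁅a, ⁅x, y⁆⁆ ∈ lieSpan N
  rw [leibniz_lie]
  exact Submodule.add_mem _ (lie_mem_lieSpan (hN.lie_mem a ha x hx) hy)
    (lie_mem_lieSpan hx (hN.lie_mem a ha y hy))

/-- The Lie subalgebra `[N, N] + N`. -/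
def subalgebra (hN : τ.IsSplit N) : LieSubalgebra ℝ τ.carrier where
  toSubmodule := lieSpan N ⊔ N
  lie_mem' {x y} hx hy := by
    obtain ⟨k, hk, n, hn, rfl⟩ := Submodule.mem_sup.1 hx
    obtain ⟨k', hk', n', hn', rfl⟩ := Submodule.mem_sup.1 hy
    have h1 := hN.lieSpan_le_h hk
    have h2 := hN.lieSpan_le_h hk'
    rw [add_lie, lie_add, lie_add]
    refine Submodule.add_mem _ (Submodule.add_mem _ ?_ ?_) (Submodule.add_mem _ ?_ ?_)
    · exact Submodule.mem_sup_left (hN.lie_mem_lieSpan_of_h h1 hk')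
    · exact Submodule.mem_sup_right (hN.lie_mem k h1 n' hn')
    · rw [← lie_skew]
      exact Submodule.mem_sup_right (N.neg_mem (hN.lie_mem k' h2 n hn))
    · exact Submodule.mem_sup_left (lie_mem_lieSpan hn hn')

theorem mem_subalgebra (hN : τ.IsSplit N) {x : τ.carrier} :
    x ∈ hN.subalgebra ↔ ∃ k ∈ lieSpan N, ∃ n ∈ N, k + n = x := Submodule.mem_sup

theorem mem_subalgebra_of_mem (hN : τ.IsSplit N) {x : τ.carrier} (hx : x ∈ N) :
    x ∈ hN.subalgebra := Submodule.mem_sup_right (S := lieSpan N) hx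

theorem mem_subalgebra_of_mem_lieSpan (hN : τ.IsSplit N) {x : τ.carrier} (hx : x ∈ lieSpan N) :
    x ∈ hN.subalgebra := Submodule.mem_sup_left (T := N) hx

theorem σ_add (hN : τ.IsSplit N) {k n : τ.carrier} (hk : k ∈ lieSpan N) (hn : n ∈ N) :
    τ.σ (k + n) = k - n := by
  rw [map_add, τ.mem_h.1 (hN.lieSpan_le_h hk), τ.mem_m.1 (hN.le_m hn), sub_eq_add_neg]

theorem σ_mem_subalgebra (hN : τ.IsSplit N) {x : τ.carrier} (hx : x ∈ hN.subalgebra) :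
    τ.σ x ∈ hN.subalgebra := by
  obtain ⟨k, hk, n, hn, rfl⟩ := hN.mem_subalgebra.1 hx
  rw [hN.σ_add hk hn]
  exact sub_mem (hN.mem_subalgebra_of_mem_lieSpan hk) (hN.mem_subalgebra_of_mem hn)

theorem mem_of_σ_eq_neg (hN : τ.IsSplit N) {x : τ.carrier} (hx : x ∈ hN.subalgebra)
    (h : τ.σ x = -x) : x ∈ N := by
  obtain ⟨k, hk, n, hn, rfl⟩ := hN.mem_subalgebra.1 hx
  rw [hN.σ_add hk hn, neg_add, sub_eq_add_neg, add_left_inj] at h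
  rw [eq_zero_of_eq_neg h, zero_add]
  exact hn

theorem mem_lieSpan_of_σ_eq (hN : τ.IsSplit N) {x : τ.carrier} (hx : x ∈ hN.subalgebra)
    (h : τ.σ x = x) : x ∈ lieSpan N := by
  obtain ⟨k, hk, n, hn, rfl⟩ := hN.mem_subalgebra.1 hx
  rw [hN.σ_add hk hn, sub_eq_add_neg, add_right_inj] at h
  rw [eq_zero_of_eq_neg h.symm, add_zero]
  exact hk

/-- The subalgebras of orthogonal subspaces commute. -/
theorem lie_eq_zero (hN : τ.IsSplit N) (hN' : τ.IsSplit N') (ho : ∀ x ∈ N, ∀ y ∈ N', τ.B x y = 0)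
    {x y : τ.carrier} (hx : x ∈ hN.subalgebra) (hy : y ∈ hN'.subalgebra) : ⁅x, y⁆ = 0 := by
  have h1 : ∀ x ∈ N, ∀ y ∈ N', ⁅x, y⁆ = 0 := fun x hx y hy =>
    lie_eq_zero_of_orthogonal hN hN'.le_m ho hx hy
  have h2 : ∀ x ∈ hN.subalgebra, ∀ y ∈ N', ⁅y, x⁆ = 0 := by
    intro x hx y hy
    refine (sup_le (lieSpan_le fun u hu w hw => ?_) fun u hu => ?_ :
      lieSpan N ⊔ N ≤ LinearMap.ker (LieModule.toEnd ℝ τ.carrier τ.carrier y)) hx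
    · show ⁅y, ⁅u, w⁆⁆ = 0
      rw [← lie_skew, lie_lie_eq_zero (h1 u hu y hy) (h1 w hw y hy), neg_zero]
    · show ⁅y, u⁆ = 0
      rw [← lie_skew, h1 u hu y hy, neg_zero]
  refine (sup_le (lieSpan_le fun u hu w hw => ?_) fun u hu => ?_ :
      lieSpan N' ⊔ N' ≤ LinearMap.ker (LieModule.toEnd ℝ τ.carrier τ.carrier x)) hy
  · show ⁅x, ⁅u, w⁆⁆ = 0
    rw [← lie_skew, lie_lie_eq_zero (h2 x hx u hu) (h2 x hx w hw), neg_zero]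
  · show ⁅x, u⁆ = 0
    rw [← lie_skew, h2 x hx u hu, neg_zero]

/-- The subalgebras of orthogonal subspaces are orthogonal. -/
theorem B_eq_zero (hN : τ.IsSplit N) (hN' : τ.IsSplit N') (ho : ∀ x ∈ N, ∀ y ∈ N', τ.B x y = 0)
    {x y : τ.carrier} (hx : x ∈ hN.subalgebra) (hy : y ∈ hN'.subalgebra) : τ.B x y = 0 := by
  have hl : ∀ {x y}, x ∈ hN.subalgebra → y ∈ hN'.subalgebra → ⁅x, y⁆ = 0 :=
    fun hx hy => hN.lie_eq_zero hN' ho hx hy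
  obtain ⟨k, hk, n, hn, rfl⟩ := hN.mem_subalgebra.1 hx
  obtain ⟨k', hk', n', hn', rfl⟩ := hN'.mem_subalgebra.1 hy
  have h1 : lieSpan N' ≤ LinearMap.ker (τ.B k) := lieSpan_le fun u hu w hw => by
    show τ.B k ⁅u, w⁆ = 0
    rw [← τ.B_lie_assoc, hl (hN.mem_subalgebra_of_mem_lieSpan hk) (hN'.mem_subalgebra_of_mem hu),
      map_zero, LinearMap.zero_apply]
  have h2 : τ.B k k' = 0 := h1 hk'
  rw [map_add, map_add, LinearMap.add_apply, LinearMap.add_apply, h2, ho n hn n' hn',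
    τ.B_h_m (hN.lieSpan_le_h hk) (hN'.le_m hn'), τ.B_symm n k',
    τ.B_h_m (hN'.lieSpan_le_h hk') (hN.le_m hn)]
  norm_num

/-- The symmetric triple on `[N, N] + N`. -/
def triple (hN : τ.IsSplit N) : SymmetricTriple.{u} where
  carrier := hN.subalgebra
  σ :=
    { toFun := fun x => ⟨τ.σ x, hN.σ_mem_subalgebra x.2⟩
      map_add' := fun x y => Subtype.ext (map_add τ.σ _ _)
      map_smul' := fun c x => Subtype.ext (map_smul τ.σ _ _)
      map_lie' := fun {x y} => Subtype.ext (LieHom.map_lie τ.σ _ _) }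
  σ_σ x := Subtype.ext (τ.σ_σ x)
  B := τ.B.restrict hN.subalgebra.toSubmodule
  B_symm x y := τ.B_symm x y
  B_nondeg x hx := by
    have hx' : ∀ y ∈ hN.subalgebra, τ.B x y = 0 := fun y hy => hx ⟨y, hy⟩
    obtain ⟨x, hxN⟩ := x
    refine Subtype.ext ?_
    obtain ⟨k, hk, n, hn, rfl⟩ := hN.mem_subalgebra.1 hxN
    change ∀ y ∈ hN.subalgebra, τ.B (k + n) y = 0 at hx'
    have hkh := hN.lieSpan_le_h hk
    obtain rfl : n = 0 := hN.nondeg n hn fun y hy => by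
      have := hx' y (hN.mem_subalgebra_of_mem hy)
      rwa [map_add, LinearMap.add_apply, τ.B_h_m hkh (hN.le_m hy), zero_add] at this
    rw [add_zero] at hx'
    have hkN : ∀ y ∈ N, ⁅k, y⁆ = 0 := fun y hy => by
      refine hN.nondeg _ (hN.lie_mem k hkh y hy) fun w hw => ?_
      rw [τ.B_lie_assoc]
      exact hx' _ (hN.mem_subalgebra_of_mem_lieSpan (lie_mem_lieSpan hy hw))
    -- `k` also kills the orthogonal complement of `N` in `𝔪`, hence all of `𝔪`
    have hk0 : k = 0 := τ.eq_zero_of_lie_m hkh fun y hy => by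
      obtain ⟨w, hw, w', hw', rfl⟩ := exists_add_orthogonal hN.nondeg y
      have hwm : w' ∈ τ.m ⊓ τ.B.orthogonal N := by
        refine ⟨?_, hw'⟩
        have := τ.m.sub_mem hy (hN.le_m hw)
        rwa [add_sub_cancel_left] at this
      rw [lie_add, hkN w hw, zero_add]
      exact hN.lie_eq_zero ((isSplit_m τ).inf_orthogonal hN hN.le_m) (fun a ha b hb => hb.2 a ha)
        (hN.mem_subalgebra_of_mem_lieSpan hk) (mem_subalgebra_of_mem _ hwm)
    show k + 0 = 0
    rw [hk0, zero_add]
  B_σ x y := τ.B_σ x y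
  B_lie x y z := τ.B_lie x y z
  fixed_mem_span x hx := by
    have hk := hN.mem_lieSpan_of_σ_eq x.2 (congrArg Subtype.val hx)
    have hle : lieSpan N ≤ (Submodule.span ℝ {z : hN.subalgebra |
        ∃ a b : hN.subalgebra, (⟨τ.σ a, hN.σ_mem_subalgebra a.2⟩ : hN.subalgebra) = -a ∧
          (⟨τ.σ b, hN.σ_mem_subalgebra b.2⟩ : hN.subalgebra) = -b ∧ ⁅a, b⁆ = z}).map
        hN.subalgebra.toSubmodule.subtype := by
      refine lieSpan_le fun u hu w hw => ?_
      exact ⟨⁅⟨u, hN.mem_subalgebra_of_mem hu⟩, ⟨w, hN.mem_subalgebra_of_mem hw⟩⁆,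
        Submodule.subset_span ⟨_, _, Subtype.ext (τ.mem_m.1 (hN.le_m hu)),
          Subtype.ext (τ.mem_m.1 (hN.le_m hw)), rfl⟩, rfl⟩
    obtain ⟨y, hy, hyx⟩ := hle hk
    have : y = x := Subtype.ext hyx
    rw [← this]
    exact hy

theorem mem_triple_m (hN : τ.IsSplit N) {x : hN.triple.carrier} :
    x ∈ hN.triple.m ↔ (show hN.subalgebra from x).1 ∈ N :=
  ⟨fun hx => hN.mem_of_σ_eq_neg (show hN.subalgebra from x).2 (congrArg Subtype.val hx),
    fun hx => Subtype.ext (τ.mem_m.1 (hN.le_m hx))⟩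

end IsSplit

end SymmetricTriple

namespace SymmetricTriple

variable {τ : SymmetricTriple.{u}}

/-- The minimal non-zero subspaces of `𝔪` that split off. -/
structure IsMinimalSplit (τ : SymmetricTriple.{u}) (N : Submodule ℝ τ.carrier) : Prop
    extends τ.IsSplit N where
  ne_bot : N ≠ ⊥
  eq_of_le : ∀ M ≤ N, τ.IsSplit M → M ≠ ⊥ → M = N

theorem IsMinimalSplit.indecomposable {N : Submodule ℝ τ.carrier} (h : τ.IsMinimalSplit N) :
    h.triple.Indecomposable := by
  have hN := h.toIsSplit
  rintro ⟨M, hM0, hMlt, hMn, hMi⟩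
  let i : h.triple.carrier →ₗ[ℝ] τ.carrier := hN.subalgebra.toSubmodule.subtype
  have hi : Function.Injective i := Subtype.val_injective
  have hiM : M.map i ≤ N := by
    rintro _ ⟨x, hx, rfl⟩
    exact hN.mem_triple_m.1 (hMlt.le hx)
  have hMsplit : τ.IsSplit (M.map i) := by
    refine ⟨hiM.trans hN.le_m, ?_, ?_⟩
    · rintro _ ⟨x, hx, rfl⟩ h0
      rw [hMn x hx fun y hy => h0 _ (Submodule.mem_map_of_mem hy), map_zero]
    · -- `𝔥` is the sum of `[N, N]` and of an ideal that commutes with `N`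
      have hle : τ.h ≤ (⨅ x : M, (M.map i).comap
          (LieModule.toEnd ℝ τ.carrier τ.carrier (i x))) := by
        refine τ.h_induction fun x hx y hy => ?_
        obtain ⟨n, hn, n', hn', rfl⟩ := exists_add_orthogonal hN.nondeg x
        obtain ⟨k, hk, k', hk', rfl⟩ := exists_add_orthogonal hN.nondeg y
        have hO := (isSplit_m τ).inf_orthogonal hN hN.le_m
        have hn'' : n' ∈ τ.m ⊓ τ.B.orthogonal N := by
          refine ⟨?_, hn'⟩
          have := τ.m.sub_mem hx (hN.le_m hn)
          rwa [add_sub_cancel_left] at this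
        have hk'' : k' ∈ τ.m ⊓ τ.B.orthogonal N := by
          refine ⟨?_, hk'⟩
          have := τ.m.sub_mem hy (hN.le_m hk)
          rwa [add_sub_cancel_left] at this
        have hz : ∀ a ∈ N, ∀ b ∈ τ.m ⊓ τ.B.orthogonal N, ⁅a, b⁆ = 0 := fun a ha b hb =>
          lie_eq_zero_of_orthogonal hN hO.le_m (fun a ha b hb => hb.2 a ha) ha hb
        have hz' : ∀ a ∈ N, ∀ b ∈ τ.m ⊓ τ.B.orthogonal N, ⁅b, a⁆ = 0 := fun a ha b hb => by
          rw [← lie_skew, hz a ha b hb, neg_zero]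
        rw [Submodule.mem_iInf]
        intro w
        have hw : i w ∈ N := hiM (Submodule.mem_map_of_mem w.2)
        show ⁅i w, ⁅n + n', k + k'⁆⁆ ∈ M.map i
        rw [← lie_skew, neg_mem_iff, lie_add, add_lie n n' k, hz' k hk n' hn'', add_lie n n' k',
          hz n hn k' hk'', add_zero, zero_add,
          add_lie, lie_lie_eq_zero (hz' _ hw _ hn'') (hz' _ hw _ hk''), add_zero]
        have hnm : (⟨n, hN.mem_subalgebra_of_mem hn⟩ : hN.subalgebra) ∈ h.triple.m :=
          hN.mem_triple_m.2 hn
        have hkm : (⟨k, hN.mem_subalgebra_of_mem hk⟩ : hN.subalgebra) ∈ h.triple.m :=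
          hN.mem_triple_m.2 hk
        exact Submodule.mem_map_of_mem (f := i) (hMi _ (h.triple.lie_mem_h hnm hkm) w w.2)
      rintro a ha _ ⟨x, hx, rfl⟩
      rw [← lie_skew, neg_mem_iff]
      exact (Submodule.mem_iInf _).1 (hle ha) ⟨x, hx⟩
  have heq := h.eq_of_le _ hiM hMsplit
    (fun h0 => hM0 (Submodule.map_injective_of_injective hi (h0.trans (Submodule.map_bot i).symm)))
  refine hMlt.not_ge fun x hx => ?_
  obtain ⟨y, hy, hyx⟩ := heq.ge (hN.mem_triple_m.1 hx)
  rwa [← (hi hyx : y = x)]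

theorem IsMinimalSplit.nontrivial {N : Submodule ℝ τ.carrier} (h : τ.IsMinimalSplit N) :
    Nontrivial h.triple.carrier := by
  obtain ⟨x, hx, hx0⟩ := N.ne_bot_iff.1 h.ne_bot
  exact ⟨⟨⟨x, h.mem_subalgebra_of_mem hx⟩, 0, fun h => hx0 (congrArg Subtype.val h)⟩⟩

/-- Every split subspace is an orthogonal sum of minimal ones. -/
theorem IsSplit.exists_list {N : Submodule ℝ τ.carrier} (hN : τ.IsSplit N) :
    ∃ l : List (Submodule ℝ τ.carrier), (∀ M ∈ l, τ.IsMinimalSplit M ∧ M ≤ N) ∧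
      l.Pairwise (fun M M' => ∀ x ∈ M, ∀ y ∈ M', τ.B x y = 0) ∧
      ∀ K : Submodule ℝ τ.carrier, (∀ M ∈ l, M ≤ K) → N ≤ K := by
  induction hd : finrank ℝ N using Nat.strong_induction_on generalizing N with
  | _ d ih =>
    by_cases h0 : N = ⊥
    · exact ⟨[], by simp, List.Pairwise.nil, fun K _ => h0 ▸ bot_le⟩
    by_cases hmin : ∀ M ≤ N, τ.IsSplit M → M ≠ ⊥ → M = N
    · exact ⟨[N], by simpa using ⟨hN, h0, hmin⟩, List.pairwise_singleton _ _, by simp⟩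
    push Not at hmin
    obtain ⟨M, hMN, hM, hM0, hne⟩ := hmin
    have hM' := hN.inf_orthogonal hM hMN
    have hlt : M < N := lt_of_le_of_ne hMN hne
    have hlt' : N ⊓ τ.B.orthogonal M < N := by
      refine lt_of_le_of_ne inf_le_left fun h => hM0 ?_
      rw [eq_bot_iff]
      intro x hx
      refine hM.nondeg x hx fun y hy => ?_
      have : y ∈ N ⊓ τ.B.orthogonal M := h.ge (hMN hy)
      exact this.2 x hx
    obtain ⟨l, h1, h2, h3⟩ := ih _ (hd ▸ Submodule.finrank_lt_finrank_of_lt hlt) hM rfl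
    obtain ⟨l', h1', h2', h3'⟩ := ih _ (hd ▸ Submodule.finrank_lt_finrank_of_lt hlt') hM' rfl
    refine ⟨l ++ l', ?_, List.pairwise_append.2 ⟨h2, h2', ?_⟩, fun K hK => ?_⟩
    · intro A hA
      rcases List.mem_append.1 hA with hA | hA
      · exact ⟨(h1 A hA).1, (h1 A hA).2.trans hMN⟩
      · exact ⟨(h1' A hA).1, (h1' A hA).2.trans inf_le_left⟩
    · intro A hA A' hA' x hx y hy
      exact ((h1' A' hA').2 hy).2 x ((h1 A hA).2 hx)
    · have hMK := h3 K fun A hA => hK A (List.mem_append_left _ hA)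
      have hMK' := h3' K fun A hA => hK A (List.mem_append_right _ hA)
      intro x hx
      obtain ⟨n, hn, n', hn', rfl⟩ := exists_add_orthogonal hM.nondeg x
      have : n' ∈ N := by
        have := N.sub_mem hx (hMN hn)
        rwa [add_sub_cancel_left] at this
      exact K.add_mem (hMK hn) (hMK' ⟨this, hn'⟩)

/-- A symmetric triple whose space `𝔪` is the orthogonal sum of split subspaces is isomorphic to the
direct sum of the corresponding triples. -/
theorem nonempty_iso_directSum {s : ℕ} (N : Fin s → Submodule ℝ τ.carrier)
    (hN : ∀ i, τ.IsSplit (N i)) (ho : ∀ i j, i ≠ j → ∀ x ∈ N i, ∀ y ∈ N j, τ.B x y = 0)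
    (htop : ∀ K : Submodule ℝ τ.carrier, (∀ i, N i ≤ K) → τ.m ≤ K) :
    Nonempty (τ.Iso (directSum fun i => (hN i).triple)) := by
  set t := fun i => (hN i).triple
  let inc : ∀ i, (t i).carrier →ₗ[ℝ] τ.carrier := fun i => (hN i).subalgebra.toSubmodule.subtype
  have hincmem : ∀ i x, inc i x ∈ (hN i).subalgebra := fun i x =>
    (show (hN i).subalgebra from x).2
  let Ψ : (directSum t).carrier →ₗ⁅ℝ⁆ τ.carrier :=
    { toFun := fun x => ∑ i, inc i (sumProj t i x)
      map_add' := fun x y => by simp [Finset.sum_add_distrib]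
      map_smul' := fun c x => by simp [Finset.smul_sum]
      map_lie' := fun {x y} => by
        rw [sum_lie]
        refine Finset.sum_congr rfl fun i _ => ?_
        rw [lie_sum]
        rw [Finset.sum_eq_single i]
        · exact congrArg (inc i) (LieHom.map_lie (sumProj t i) x y)
        · intro j _ hj
          exact (hN i).lie_eq_zero (hN j) (ho i j hj.symm) (hincmem i _) (hincmem j _)
        · simp }
  have hΨ : ∀ x, Ψ x = ∑ i, inc i (sumProj t i x) := fun _ => rfl
  have hΨB : ∀ x y, τ.B (Ψ x) (Ψ y) = (directSum t).B x y := by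
    intro x y
    rw [hΨ, hΨ, directSum_B, map_sum τ.B, LinearMap.sum_apply]
    refine Finset.sum_congr rfl fun i _ => ?_
    rw [map_sum, Finset.sum_eq_single i]
    · rfl
    · intro j _ hj
      exact (hN i).B_eq_zero (hN j) (ho i j hj.symm) (hincmem i _) (hincmem j _)
    · simp
  have hΨσ : ∀ x, Ψ ((directSum t).σ x) = τ.σ (Ψ x) := by
    intro x
    rw [hΨ, hΨ, map_sum]
    rfl
  have hinj : Function.Injective Ψ := by
    rw [injective_iff_map_eq_zero]
    intro x hx
    refine (directSum t).B_nondeg x fun y => ?_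
    rw [← hΨB, hx, map_zero, LinearMap.zero_apply]
  have hm : τ.m ≤ Ψ.range.toSubmodule := by
    refine htop _ fun i x hx => ?_
    obtain ⟨x, rfl⟩ : ∃ x' : (t i).carrier, inc i x' = x :=
      ⟨⟨x, (hN i).mem_subalgebra_of_mem hx⟩, rfl⟩
    refine ⟨sumSingle t i x, ?_⟩
    show ∑ j, inc j (sumProj t j _) = inc i x
    rw [Finset.sum_eq_single i]
    · rw [sumProj_sumSingle]
    · intro j _ hj
      rw [sumProj_sumSingle_of_ne t hj, map_zero]
    · simp
  have hh : τ.h ≤ Ψ.range.toSubmodule := τ.h_induction fun x hx y hy =>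
    Ψ.range.lie_mem (hm hx) (hm hy)
  have hsurj : Function.Surjective Ψ := fun x => by
    obtain ⟨a, ha, y, hy, rfl⟩ := τ.exists_h_add_m x
    exact Ψ.range.toSubmodule.add_mem (hh ha) (hm hy)
  let e := LieEquiv.ofBijective Ψ ⟨hinj, hsurj⟩
  have he : ∀ x, e x = Ψ x := fun _ => rfl
  refine ⟨⟨e.symm, fun x => ?_, fun x y => ?_⟩⟩
  · apply e.injective
    show e (e.symm _) = e _
    rw [e.apply_symm_apply, he, hΨσ, ← he, e.apply_symm_apply]
  · rw [← hΨB, ← he, ← he, e.apply_symm_apply, e.apply_symm_apply]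

/-- Every symmetric triple is isomorphic to a direct sum of non-zero indecomposable ones. -/
theorem exists_iso_directSum (τ : SymmetricTriple.{u}) :
    ∃ (s : ℕ) (t : Fin s → SymmetricTriple.{u}),
      (∀ i, (t i).Indecomposable ∧ Nontrivial (t i).carrier) ∧
        Nonempty (τ.Iso (directSum t)) := by
  obtain ⟨l, h1, h2, h3⟩ := (isSplit_m τ).exists_list
  have hmin : ∀ i, τ.IsMinimalSplit (l.get i) := fun i => (h1 _ (l.get_mem i)).1
  refine ⟨l.length, fun i => (hmin i).triple,
    fun i => ⟨(hmin i).indecomposable, (hmin i).nontrivial⟩,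
    nonempty_iso_directSum l.get (fun i => (hmin i).toIsSplit) (fun i j hij x hx y hy => ?_)
      fun K hK => h3 K fun M hM => ?_⟩
  · rcases lt_or_gt_of_ne hij with h | h
    · exact List.pairwise_iff_get.1 h2 i j h x hx y hy
    · rw [τ.B_symm]
      exact List.pairwise_iff_get.1 h2 j i h y hy x hx
  · obtain ⟨i, rfl⟩ := List.get_of_mem hM
    exact hK i

end SymmetricTriple

namespace NormalFormData

variable {V : Type v} [AddCommGroup V] [Module ℝ V] [FiniteDimensional ℝ V] {n : ℕ}
  (D : NormalFormData V n)

theorem exists_iso_directSum_isT :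
    ∃ (s : ℕ) (t : Fin s → SymmetricTriple.{v}) (p' q' : Fin s → ℕ),
      (∀ i, (t i).IsT (p' i) (q' i)) ∧ Nonempty (D.triple.Iso (SymmetricTriple.directSum t)) := by
  obtain ⟨s, t, ht, ⟨e⟩⟩ := D.triple.exists_iso_directSum
  choose p' q' hpq using fun i => D.isT_of_iso_directSum t e i (ht i).1 (ht i).2
  exact ⟨s, t, p', q', hpq, ⟨e⟩⟩

end NormalFormData

/-! ### A dimension criterion for indecomposability -/

namespace NormalFormData

variable {V : Type v} [AddCommGroup V] [Module ℝ V] [FiniteDimensional ℝ V] {n : ℕ}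
  (D : NormalFormData V n)

/-- The projection of the Lie algebra of the triple to `𝔷^*`. -/
def projZs : D.triple.carrier →ₗ[ℝ] Dual ℝ V := D.czs

theorem mem_hm_of_czs {x : D.triple.carrier} (hx : x ∈ D.triple.m) (h : D.projZs x = 0) :
    x ∈ D.triple.hm := by
  obtain ⟨y, rfl⟩ := D.exists_incl hx
  exact D.incl_mem_hm_iff.2 h

theorem czs_of_mem_hm {x : D.triple.carrier} (hx : x ∈ D.triple.hm) : D.projZs x = 0 := by
  obtain ⟨v, w, rfl⟩ := D.exists_incl_of_mem_hm hx
  rfl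

/-- A non-zero subspace of `𝔪` that splits off has a non-zero projection to `𝔷^*`: otherwise it
would lie in `[𝔥, 𝔪]`, so it would be central, and the centre is isotropic. -/
theorem map_czs_ne_bot {N : Submodule ℝ D.triple.carrier} (hN : D.triple.IsSplit N) (h0 : N ≠ ⊥) :
    N.map D.projZs ≠ ⊥ := by
  intro h
  have hle : N ≤ D.triple.hm := fun x hx => by
    refine D.mem_hm_of_czs (hN.le_m hx) ?_
    have : D.projZs x ∈ N.map D.projZs := Submodule.mem_map_of_mem hx
    rwa [h, Submodule.mem_bot] at this
  have hz : ∀ x ∈ N, x ∈ D.triple.z → x = 0 := fun x hx hxz =>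
    hN.nondeg x hx fun y hy => D.triple.B_z_hm hxz (hle hy)
  refine h0 (eq_bot_iff.2 fun x hx => hz x hx ?_)
  refine D.triple.mem_z_of_lie_h (hN.le_m hx) fun a ha => ?_
  exact hz _ (hN.lie_mem a ha x hx) (D.isTame.lie_hm a ha x (hle hx))

theorem curvProj_wedge_eq_zero {x y : D.triple.carrier} (h : ⁅x, y⁆ = 0) :
    curvProj D.R (wedge (D.projZs x) (D.projZs y)) = 0 :=
  congrArg D.cY h

/-- The part of `Y` spanned by the `π(f ∧ g)` with `f, g ∈ A`. -/
def wedgeSpan (A : Submodule ℝ (Dual ℝ V)) : Submodule ℝ D.Y :=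
  Submodule.span ℝ {y | ∃ f ∈ A, ∃ g ∈ A, curvProj D.R (wedge f g) = y}

theorem finrank_wedgeSpan_le (A : Submodule ℝ (Dual ℝ V)) :
    finrank ℝ (D.wedgeSpan A) ≤ (finrank ℝ A).choose 2 := by
  have hA1 : Module.Free ℝ A := Module.Free.of_divisionRing ℝ A
  let T : ⋀[ℝ]^2 A →ₗ[ℝ] D.Y := curvProj D.R ∘ₗ exteriorPower.map 2 A.subtype
  have hle : D.wedgeSpan A ≤ LinearMap.range T := by
    refine Submodule.span_le.2 ?_
    rintro _ ⟨f, hf, g, hg, rfl⟩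
    refine ⟨exteriorPower.ιMulti ℝ 2 ![⟨f, hf⟩, ⟨g, hg⟩], ?_⟩
    refine congrArg (curvProj D.R) ((exteriorPower.map_apply_ιMulti _ _).trans ?_)
    refine congrArg (exteriorPower.ιMulti ℝ 2) ?_
    ext i; fin_cases i <;> rfl
  exact ((Submodule.finrank_mono hle).trans (LinearMap.finrank_range_le T)).trans_eq
    (exteriorPower.finrank_eq (R := ℝ) (M := A) (n := 2))

theorem finrank_Y_le {A A' : Submodule ℝ (Dual ℝ V)} (hA : A ⊔ A' = ⊤)
    (h : ∀ f ∈ A, ∀ g ∈ A', curvProj D.R (wedge f g) = 0) :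
    finrank ℝ D.Y ≤ (finrank ℝ A).choose 2 + (finrank ℝ A').choose 2 := by
  have htop : D.wedgeSpan A ⊔ D.wedgeSpan A' = ⊤ := by
    rw [eq_top_iff]
    intro y _
    obtain ⟨ω, rfl⟩ := Submodule.mkQ_surjective _ y
    have hle : Submodule.span ℝ {ω : Lambda2 V | ∃ f g, wedge f g = ω} ≤
        (D.wedgeSpan A ⊔ D.wedgeSpan A').comap (curvProj D.R) := by
      refine Submodule.span_le.2 ?_
      rintro _ ⟨f, g, rfl⟩
      obtain ⟨f, hf, f', hf', rfl⟩ := Submodule.mem_sup.1 (hA.ge (Submodule.mem_top (x := f)))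
      obtain ⟨g, hg, g', hg', rfl⟩ := Submodule.mem_sup.1 (hA.ge (Submodule.mem_top (x := g)))
      have h1 : curvProj D.R (wedge (f + f') (g + g')) =
          curvProj D.R (wedge f g) + curvProj D.R (wedge f' g') := by
        simp only [map_add, LinearMap.add_apply, h f hf g' hg']
        rw [wedge_swap f' g, map_neg, h g hg f' hf', neg_zero, add_zero, zero_add]
      show curvProj D.R (wedge (f + f') (g + g')) ∈ D.wedgeSpan A ⊔ D.wedgeSpan A'
      rw [h1]
      exact Submodule.add_mem_sup (Submodule.subset_span ⟨f, hf, g, hg, rfl⟩)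
        (Submodule.subset_span ⟨f', hf', g', hg', rfl⟩)
    rw [span_wedge] at hle
    exact hle Submodule.mem_top
  have := Submodule.finrank_add_le_finrank_add_finrank (D.wedgeSpan A) (D.wedgeSpan A')
  rw [htop, finrank_top] at this
  exact this.trans (add_le_add (D.finrank_wedgeSpan_le A) (D.finrank_wedgeSpan_le A'))

/-- A decomposition of the triple induces a decomposition `𝔷^* = A ⊕ A'` such that `π` vanishes on
`A ∧ A'`, which bounds the dimension of `Y`. -/
theorem indecomposable_of_finrank_Y
    (h : (finrank ℝ V : ℝ) * ((finrank ℝ V : ℝ) - 2) / 2 < finrank ℝ D.Y) :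
    D.triple.Indecomposable := by
  rintro ⟨N, hN0, hNlt, hNn, hNi⟩
  have hN : D.triple.IsSplit N := ⟨hNlt.le, hNn, hNi⟩
  have hN' := (SymmetricTriple.isSplit_m D.triple).inf_orthogonal hN hN.le_m
  set N' := D.triple.m ⊓ D.triple.B.orthogonal N
  have hdec : ∀ x ∈ D.triple.m, ∃ y ∈ N, ∃ y' ∈ N', y + y' = x := by
    intro x hx
    obtain ⟨y, hy, y', hy', rfl⟩ := SymmetricTriple.exists_add_orthogonal hN.nondeg x
    refine ⟨y, hy, y', ⟨?_, hy'⟩, rfl⟩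
    have := D.triple.m.sub_mem hx (hN.le_m hy)
    rwa [add_sub_cancel_left] at this
  have hdisj : ∀ x ∈ N, x ∈ N' → x = 0 := fun x hx hx' => hN.nondeg x hx fun y hy => by
    rw [D.triple.B_symm]
    exact hx'.2 y hy
  have hN'0 : N' ≠ ⊥ := by
    intro h0
    refine hNlt.not_ge fun x hx => ?_
    obtain ⟨y, hy, y', hy', rfl⟩ := hdec x hx
    rw [h0, Submodule.mem_bot] at hy'
    rwa [hy', add_zero]
  have hhm : D.triple.hm ≤ (D.triple.hm ⊓ N) ⊔ (D.triple.hm ⊓ N') := by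
    refine D.triple.hm_le_iff.2 fun a ha x hx => ?_
    obtain ⟨y, hy, y', hy', rfl⟩ := hdec x hx
    rw [lie_add]
    exact Submodule.add_mem_sup ⟨D.triple.lie_mem_hm ha (hN.le_m hy), hN.lie_mem a ha y hy⟩
      ⟨D.triple.lie_mem_hm ha (hN'.le_m hy'), hN'.lie_mem a ha y' hy'⟩
  have htop : N.map D.projZs ⊔ N'.map D.projZs = ⊤ := by
    refine eq_top_iff.2 fun f _ => ?_
    obtain ⟨y, hy, y', hy', he⟩ := hdec _ (D.incl_mem_m (0, 0, f))
    have : f = D.projZs y + D.projZs y' := by rw [← map_add, he]; rfl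
    rw [this]
    exact Submodule.add_mem_sup (Submodule.mem_map_of_mem hy) (Submodule.mem_map_of_mem hy')
  have hbot : N.map D.projZs ⊓ N'.map D.projZs = ⊥ := by
    rw [eq_bot_iff]
    rintro _ ⟨⟨x, hx, rfl⟩, ⟨x', hx', he⟩⟩
    have h1 : x - x' ∈ D.triple.hm := by
      refine D.mem_hm_of_czs (D.triple.m.sub_mem (hN.le_m hx) (hN'.le_m hx')) ?_
      exact (map_sub D.projZs x x').trans (sub_eq_zero.2 he.symm)
    obtain ⟨w, hw, w', hw', hww⟩ := Submodule.mem_sup.1 (hhm h1)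
    have h2 : x - w = x' + w' := by
      rw [sub_eq_iff_eq_add, add_assoc, add_comm w', hww, add_sub_cancel]
    have h3 : x - w = 0 :=
      hdisj _ (N.sub_mem hx hw.2) (h2 ▸ N'.add_mem hx' hw'.2)
    rw [Submodule.mem_bot]
    exact D.czs_of_mem_hm (sub_eq_zero.1 h3 ▸ hw.1)
  have hY := D.finrank_Y_le htop fun f hf g hg => by
    obtain ⟨x, hx, rfl⟩ := hf
    obtain ⟨y, hy, rfl⟩ := hg
    exact D.curvProj_wedge_eq_zero (SymmetricTriple.lie_eq_zero_of_orthogonal hN hN'.le_m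
      (fun a ha b hb => hb.2 a ha) hx hy)
  have hdim := Submodule.finrank_sup_add_finrank_inf_eq (N.map D.projZs) (N'.map D.projZs)
  rw [htop, hbot, finrank_top, finrank_bot, add_zero, Subspace.dual_finrank_eq] at hdim
  have ha := Submodule.one_le_finrank_iff.2 (D.map_czs_ne_bot hN hN0)
  have ha' := Submodule.one_le_finrank_iff.2 (D.map_czs_ne_bot hN' hN'0)
  generalize finrank ℝ (N.map D.projZs) = a at *
  generalize finrank ℝ (N'.map D.projZs) = c at *
  have hY' : (finrank ℝ D.Y : ℝ) ≤ (a.choose 2 : ℕ) + (c.choose 2 : ℕ) := by exact_mod_cast hY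
  rw [Nat.cast_choose_two, Nat.cast_choose_two] at hY'
  rw [hdim] at h
  push_cast at h
  have h1 : (1 : ℝ) ≤ a := by exact_mod_cast ha
  have h2 : (1 : ℝ) ≤ c := by exact_mod_cast ha'
  nlinarith [mul_nonneg (sub_nonneg.2 h1) (sub_nonneg.2 h2)]

end NormalFormData

/-! ### Isometries of `V ⊕ ℝ^n ⊕ V^*` -/

section Isometries

variable {V : Type v} [AddCommGroup V] [Module ℝ V] {n : ℕ}

/-- The canonical pairing of `V` and `V^*` plus the Euclidean form of `ℝ^n`. -/
def stdForm (x x' : V × (Fin n → ℝ) × Dual ℝ V) : ℝ :=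
  x.2.2 x'.1 + x'.2.2 x.1 + ∑ α, x.2.1 α * x'.2.1 α

/-- The map `P ⊕ Q ⊕ (P^*)⁻¹`. -/
def diagMap (P : V ≃ₗ[ℝ] V) (Q : (Fin n → ℝ) ≃ₗ[ℝ] (Fin n → ℝ)) :
    (V × (Fin n → ℝ) × Dual ℝ V) ≃ₗ[ℝ] (V × (Fin n → ℝ) × Dual ℝ V) :=
  P.prodCongr (Q.prodCongr P.dualMap.symm)

theorem diagMap_apply (P : V ≃ₗ[ℝ] V) (Q : (Fin n → ℝ) ≃ₗ[ℝ] (Fin n → ℝ))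
    (x : V × (Fin n → ℝ) × Dual ℝ V) :
    diagMap P Q x = (P x.1, Q x.2.1, x.2.2 ∘ₗ (P.symm : V →ₗ[ℝ] V)) := rfl

theorem rho_apply (L : (Fin n → ℝ) →ₗ[ℝ] V) (S : Dual ℝ V →ₗ[ℝ] V)
    (x : V × (Fin n → ℝ) × Dual ℝ V) :
    rho L S x = (x.1 + L x.2.1 + S x.2.2 - (1 / 2 : ℝ) • L (homTranspose L x.2.2),
      x.2.1 - homTranspose L x.2.2, x.2.2) := rfl

theorem sum_single (w : Fin n → ℝ) : ∑ α, w α • (Pi.single α 1 : Fin n → ℝ) = w := by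
  ext β
  simp [Finset.sum_apply, Pi.single_apply]

theorem sum_homTranspose (L : (Fin n → ℝ) →ₗ[ℝ] V) (f : Dual ℝ V) (w : Fin n → ℝ) :
    ∑ α, homTranspose L f α * w α = f (L w) := by
  conv_rhs => rw [← sum_single w]
  simp [homTranspose, mul_comm]

theorem stdForm_eq_zero_iff {x : V × (Fin n → ℝ) × Dual ℝ V} :
    (∀ y : V × (Fin n → ℝ) × Dual ℝ V, y.2 = 0 → stdForm x y = 0) ↔ x.2.2 = 0 := by
  constructor
  · intro h
    ext v
    simpa [stdForm] using h (v, 0, 0) rfl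
  · rintro h ⟨v, w, f⟩ ⟨⟩
    simp [stdForm, h]

theorem stdForm_rho {L : (Fin n → ℝ) →ₗ[ℝ] V} {S : Dual ℝ V →ₗ[ℝ] V} (hS : IsSkewMap S)
    (x x' : V × (Fin n → ℝ) × Dual ℝ V) : stdForm (rho L S x) (rho L S x') = stdForm x x' := by
  have h1 := sum_homTranspose L x.2.2 x'.2.1
  have h2 := sum_homTranspose L x'.2.2 x.2.1
  have h3 := sum_homTranspose L x.2.2 (homTranspose L x'.2.2)
  have h4 := sum_homTranspose L x'.2.2 (homTranspose L x.2.2)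
  have h5 := hS x.2.2 x'.2.2
  have h6 : ∑ α, (x.2.1 α - homTranspose L x.2.2 α) * (x'.2.1 α - homTranspose L x'.2.2 α) =
      ∑ α, x.2.1 α * x'.2.1 α - ∑ α, homTranspose L x.2.2 α * x'.2.1 α
        - ∑ α, homTranspose L x'.2.2 α * x.2.1 α
        + ∑ α, homTranspose L x.2.2 α * homTranspose L x'.2.2 α := by
    rw [← Finset.sum_sub_distrib, ← Finset.sum_sub_distrib, ← Finset.sum_add_distrib]
    exact Finset.sum_congr rfl fun α _ => by ring
  have h7 : ∑ α, homTranspose L x'.2.2 α * homTranspose L x.2.2 α =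
      ∑ α, homTranspose L x.2.2 α * homTranspose L x'.2.2 α :=
    Finset.sum_congr rfl fun α _ => mul_comm _ _
  simp only [stdForm, rho_apply, Pi.sub_apply, map_add, map_sub, map_smul, smul_eq_mul, h6]
  linarith

theorem stdForm_diagMap {P : V ≃ₗ[ℝ] V} {Q : (Fin n → ℝ) ≃ₗ[ℝ] (Fin n → ℝ)}
    (hQ : IsOrthogonalMap Q) (x x' : V × (Fin n → ℝ) × Dual ℝ V) :
    stdForm (diagMap P Q x) (diagMap P Q x') = stdForm x x' := by
  simp [stdForm, diagMap_apply, hQ x.2.1 x'.2.1]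

/-- An isometry that is the identity on `V`, on `(V ⊕ ℝ^n) / V` and modulo `V ⊕ ℝ^n` is of the form
`ρ_L ∘ ρ_S`. -/
theorem exists_eq_rho
    (ψ : (V × (Fin n → ℝ) × Dual ℝ V) ≃ₗ[ℝ] (V × (Fin n → ℝ) × Dual ℝ V))
    (hψ : ∀ x x', stdForm (ψ x) (ψ x') = stdForm x x') (h1 : ∀ v, ψ (v, 0, 0) = (v, 0, 0))
    (h2 : ∀ w, (ψ (0, w, 0)).2 = (w, 0)) (h3 : ∀ f, (ψ (0, 0, f)).2.2 = f) :
    ∃ L S, IsSkewMap S ∧ ψ = rho L S := by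
  classical
  let L : (Fin n → ℝ) →ₗ[ℝ] V := LinearMap.fst ℝ V _ ∘ₗ ψ.toLinearMap ∘ₗ
    LinearMap.inr ℝ V _ ∘ₗ LinearMap.inl ℝ _ _
  let S' : Dual ℝ V →ₗ[ℝ] V := LinearMap.fst ℝ V _ ∘ₗ ψ.toLinearMap ∘ₗ
    LinearMap.inr ℝ V _ ∘ₗ LinearMap.inr ℝ _ _
  let T : Dual ℝ V →ₗ[ℝ] V := L ∘ₗ homTranspose L
  let S : Dual ℝ V →ₗ[ℝ] V := S' + (1 / 2 : ℝ) • T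
  have hw : ∀ w, ψ (0, w, 0) = (L w, w, 0) := fun w => Prod.ext rfl (h2 w)
  have hf : ∀ f, (ψ (0, 0, f)).2.1 = -homTranspose L f := by
    intro f
    ext α
    have := hψ (0, Pi.single α 1, 0) (0, 0, f)
    rw [hw] at this
    simp only [stdForm, h3] at this
    simp [Pi.single_apply] at this
    simp only [homTranspose, LinearMap.pi_apply, Dual.eval_apply, Pi.neg_apply]
    linarith
  have hf' : ∀ f, ψ (0, 0, f) = (S' f, -homTranspose L f, f) := fun f =>
    Prod.ext rfl (Prod.ext (hf f) (h3 f))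
  refine ⟨L, S, fun f g => ?_, ?_⟩
  · have h4 := hψ (0, 0, f) (0, 0, g)
    rw [hf', hf'] at h4
    simp only [stdForm, Pi.neg_apply, neg_mul_neg, map_zero, Pi.zero_apply, mul_zero,
      Finset.sum_const_zero, add_zero] at h4
    have h5 := sum_homTranspose L f (homTranspose L g)
    have h6 := sum_homTranspose L g (homTranspose L f)
    have h7 : ∑ α, homTranspose L g α * homTranspose L f α =
        ∑ α, homTranspose L f α * homTranspose L g α :=
      Finset.sum_congr rfl fun α _ => mul_comm _ _
    simp only [S, T, LinearMap.add_apply, LinearMap.smul_apply, LinearMap.comp_apply, map_add,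
      map_smul, smul_eq_mul]
    linarith
  · ext1 ⟨v, w, f⟩
    have h4 : ((v, w, f) : V × (Fin n → ℝ) × Dual ℝ V) = (v, 0, 0) + (0, w, 0) + (0, 0, f) := by
      simp
    rw [h4, map_add, map_add, h1, hw, hf', ← h4, rho_apply]
    refine Prod.ext ?_ (Prod.ext ?_ ?_)
    · simp only [S, T, LinearMap.add_apply, LinearMap.smul_apply, LinearMap.comp_apply,
        Prod.fst_add]
      abel
    · simp [sub_eq_add_neg]
    · simp

theorem rho_injective {L L' : (Fin n → ℝ) →ₗ[ℝ] V} {S S' : Dual ℝ V →ₗ[ℝ] V}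
    (h : rho L S = rho L' S') : L = L' ∧ S = S' := by
  obtain rfl : L = L' := by
    refine LinearMap.ext fun w => ?_
    have := congrArg Prod.fst (LinearEquiv.congr_fun h (0, w, 0))
    simpa [rho_apply] using this
  refine ⟨rfl, LinearMap.ext fun f => ?_⟩
  have := congrArg Prod.fst (LinearEquiv.congr_fun h (0, 0, f))
  simpa [rho_apply] using this

theorem diagMap_injective {P P' : V ≃ₗ[ℝ] V} {Q Q' : (Fin n → ℝ) ≃ₗ[ℝ] (Fin n → ℝ)}
    (h : diagMap P Q = diagMap P' Q') : P = P' ∧ Q = Q' := by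
  constructor
  · ext1 x
    exact congrArg Prod.fst (LinearEquiv.congr_fun h (x, 0, 0))
  · ext1 w
    exact congrArg (fun x => x.2.1) (LinearEquiv.congr_fun h (0, w, 0))

/-- The isometries that preserve `V ⊕ ℝ^n` are the products of a `ρ_L ∘ ρ_S` and a
`P ⊕ Q ⊕ (P^*)⁻¹` with orthogonal `Q`. -/
theorem exists_eq_rho_diagMap [FiniteDimensional ℝ V]
    (ψ : (V × (Fin n → ℝ) × Dual ℝ V) ≃ₗ[ℝ] (V × (Fin n → ℝ) × Dual ℝ V))
    (hψ : ∀ x x', stdForm (ψ x) (ψ x') = stdForm x x')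
    (h0 : ∀ x, (ψ x).2.2 = 0 ↔ x.2.2 = 0) :
    ∃ L S P Q, IsSkewMap S ∧ IsOrthogonalMap Q ∧ ψ = diagMap P Q ≪≫ₗ rho L S := by
  classical
  -- `V` is the orthogonal complement of `V ⊕ ℝ^n`, so it is preserved as well
  have hV : ∀ v, (ψ (v, 0, 0)).2 = 0 := by
    intro v
    have h1 : (ψ (v, 0, 0)).2.2 = 0 := (h0 _).2 rfl
    refine Prod.ext ?_ h1
    ext α
    obtain ⟨y, hy⟩ := ψ.surjective (0, Pi.single α 1, 0)
    have h2 : y.2.2 = 0 := by rw [← h0, hy]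
    have h3 := hψ (v, 0, 0) y
    rw [hy] at h3
    simpa [stdForm, Pi.single_apply, h1, h2] using h3
  let P₀ : V →ₗ[ℝ] V := LinearMap.fst ℝ V _ ∘ₗ ψ.toLinearMap ∘ₗ LinearMap.inl ℝ V _
  let Q₀ : (Fin n → ℝ) →ₗ[ℝ] (Fin n → ℝ) := LinearMap.fst ℝ _ _ ∘ₗ LinearMap.snd ℝ V _ ∘ₗ
    ψ.toLinearMap ∘ₗ LinearMap.inr ℝ V _ ∘ₗ LinearMap.inl ℝ _ _
  have hP : ∀ v, ψ (v, 0, 0) = (P₀ v, 0, 0) := fun v => Prod.ext rfl (hV v)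
  have hQ : ∀ w, (ψ (0, w, 0)).2 = (Q₀ w, 0) := fun w => Prod.ext rfl ((h0 _).2 rfl)
  have hP₀ : Function.Injective P₀ := by
    intro v v' h
    have : ψ (v, 0, 0) = ψ (v', 0, 0) := by rw [hP, hP, h]
    exact congrArg Prod.fst (ψ.injective this)
  have hQo : ∀ w w', ∑ α, Q₀ w α * Q₀ w' α = ∑ α, w α * w' α := by
    intro w w'
    have := hψ (0, w, 0) (0, w', 0)
    simpa [stdForm, hQ] using this
  have hQ₀ : Function.Injective Q₀ := by
    rw [injective_iff_map_eq_zero]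
    intro w hw
    have := hQo w w
    rw [hw] at this
    have h1 : ∑ α, w α * w α = 0 := by simpa using this.symm
    rw [Finset.sum_eq_zero_iff_of_nonneg fun α _ => mul_self_nonneg (w α)] at h1
    exact funext fun α => mul_self_eq_zero.1 (h1 α (Finset.mem_univ α))
  let P := LinearEquiv.ofInjectiveEndo P₀ hP₀
  let Q := LinearEquiv.ofInjectiveEndo Q₀ hQ₀
  have hPa : ∀ v, P v = P₀ v := fun _ => rfl
  have hQa : ∀ w, Q w = Q₀ w := fun _ => rfl
  have hQ' : IsOrthogonalMap Q := hQo
  have hZ : ∀ f v, (ψ (0, 0, f)).2.2 (P₀ v) = f v := by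
    intro f v
    have := hψ (v, 0, 0) (0, 0, f)
    rw [hP] at this
    simpa [stdForm] using this
  have hdV : ∀ v, (diagMap P Q).symm (v, 0, 0) = (P.symm v, 0, 0) := fun v => by
    rw [LinearEquiv.symm_apply_eq, diagMap_apply]
    simp
  have hdW : ∀ w, (diagMap P Q).symm (0, w, 0) = (0, Q.symm w, 0) := fun w => by
    rw [LinearEquiv.symm_apply_eq, diagMap_apply]
    simp
  have hdZ : ∀ f, (diagMap P Q).symm (0, 0, f) = (0, 0, f ∘ₗ (P : V →ₗ[ℝ] V)) := fun f => by
    rw [LinearEquiv.symm_apply_eq, diagMap_apply]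
    refine Prod.ext (map_zero P).symm (Prod.ext (map_zero Q).symm ?_)
    ext v
    simp
  obtain ⟨L, S, hS, hLS⟩ := exists_eq_rho ((diagMap P Q).symm ≪≫ₗ ψ) (fun x x' => by
      have h1 := stdForm_diagMap (P := P) hQ' ((diagMap P Q).symm x) ((diagMap P Q).symm x')
      rw [LinearEquiv.apply_symm_apply, LinearEquiv.apply_symm_apply] at h1
      rw [h1, LinearEquiv.trans_apply, LinearEquiv.trans_apply, hψ])
    (fun v => by
      rw [LinearEquiv.trans_apply, hdV, hP, ← hPa, P.apply_symm_apply])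
    (fun w => by
      rw [LinearEquiv.trans_apply, hdW, hQ, ← hQa, Q.apply_symm_apply])
    (fun f => by
      rw [LinearEquiv.trans_apply, hdZ]
      ext v
      obtain ⟨v, rfl⟩ := P.surjective v
      rw [hPa, hZ]
      rfl)
  refine ⟨L, S, P, Q, hS, hQ', ?_⟩
  rw [← hLS]
  ext1 x
  rw [LinearEquiv.trans_apply, LinearEquiv.trans_apply, LinearEquiv.symm_apply_apply]

theorem pullbackCurv_wedge (P : V ≃ₗ[ℝ] V) (R : LinearMap.BilinForm ℝ (Lambda2 V))
    (f g f' g' : Dual ℝ V) :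
    pullbackCurv P R (wedge f g) (wedge f' g') =
      R (wedge (f ∘ₗ (P : V →ₗ[ℝ] V)) (g ∘ₗ (P : V →ₗ[ℝ] V)))
        (wedge (f' ∘ₗ (P : V →ₗ[ℝ] V)) (g' ∘ₗ (P : V →ₗ[ℝ] V))) := by
  have h : ∀ f g : Dual ℝ V, exteriorPower.map 2 (P : V →ₗ[ℝ] V).dualMap (wedge f g) =
      wedge (f ∘ₗ (P : V →ₗ[ℝ] V)) (g ∘ₗ (P : V →ₗ[ℝ] V)) := by
    intro f g
    refine (exteriorPower.map_apply_ιMulti _ _).trans (congrArg (exteriorPower.ιMulti ℝ 2) ?_)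
    ext i; fin_cases i <;> rfl
  rw [pullbackCurv, LinearMap.compl₁₂_apply, h, h]

theorem pullbackCurv_eq_iff {P : V ≃ₗ[ℝ] V} {R R' : LinearMap.BilinForm ℝ (Lambda2 V)} :
    pullbackCurv P R = R' ↔ ∀ f g f' g' : Dual ℝ V,
      R' (wedge (f ∘ₗ (P.symm : V →ₗ[ℝ] V)) (g ∘ₗ (P.symm : V →ₗ[ℝ] V)))
        (wedge (f' ∘ₗ (P.symm : V →ₗ[ℝ] V)) (g' ∘ₗ (P.symm : V →ₗ[ℝ] V))) =
      R (wedge f g) (wedge f' g') := by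
  have h1 : ∀ f : Dual ℝ V, (f ∘ₗ (P.symm : V →ₗ[ℝ] V)) ∘ₗ (P : V →ₗ[ℝ] V) = f := fun f => by
    ext v; simp
  have h2 : ∀ f : Dual ℝ V, (f ∘ₗ (P : V →ₗ[ℝ] V)) ∘ₗ (P.symm : V →ₗ[ℝ] V) = f := fun f => by
    ext v; simp
  constructor
  · rintro rfl f g f' g'
    rw [pullbackCurv_wedge, h1, h1, h1, h1]
  · intro h
    refine wedge_form_ext fun f g f' g' => ?_
    rw [pullbackCurv_wedge, ← h, h2, h2, h2, h2]

theorem sum_mul_orthogonal_single {Q : (Fin n → ℝ) ≃ₗ[ℝ] (Fin n → ℝ)} (hQ : IsOrthogonalMap Q)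
    (α β : Fin n) : Q.symm (Pi.single β 1) α = Q (Pi.single α 1) β := by
  classical
  have := hQ (Q.symm (Pi.single β 1)) (Pi.single α 1)
  rw [Q.apply_symm_apply] at this
  simpa [Pi.single_apply] using this.symm

end Isometries

/-! ### Isometries that preserve the quadrilinear form -/

namespace NormalFormData

variable {V : Type v} [AddCommGroup V] [Module ℝ V] [FiniteDimensional ℝ V] {n : ℕ}
  (D D' : NormalFormData V n)

/-- The product `ε_α f(Λ_α) g(Λ_α)`, by which `-ad(f) ∘ ad(g)` acts on `W_α`. -/
def weight (f g : Dual ℝ V) (α : Fin n) : ℝ := D.ε α * (f (D.Λ α) * g (D.Λ α))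

theorem stdForm_eq (x x') : D.triple.B (D.incl x) (D.incl x') = stdForm x x' := D.B_incl x x'

theorem quad_eq_zero_iff {x} : (∀ y u u', D.quad x y u u' = 0) ↔ x.2 = 0 := by
  rw [← D.incl_mem_z_iff]
  constructor
  · intro h
    refine D.triple.mem_z_of_m fun y hy => ?_
    obtain ⟨y, rfl⟩ := D.exists_incl hy
    refine D.triple.eq_zero_of_h' (D.triple.lie_mem_h (D.incl_mem_m _) (D.incl_mem_m _)) ?_
    intro u hu u' hu'
    obtain ⟨u, rfl⟩ := D.exists_incl hu
    obtain ⟨u', rfl⟩ := D.exists_incl hu'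
    rw [B_lie_incl, h]
  · intro h y u u'
    rw [← B_lie_incl, D.triple.lie_z h, map_zero, LinearMap.zero_apply]

variable {D D'}

/-- An isometry that carries one quadrilinear form to the other maps centre to centre, hence its
orthogonal complement `[𝔥, 𝔪]` to `[𝔥, 𝔪]`. -/
theorem snd_snd_eq_zero_iff
    (ψ : (V × (Fin n → ℝ) × Dual ℝ V) ≃ₗ[ℝ] (V × (Fin n → ℝ) × Dual ℝ V))
    (hψ : ∀ x x', stdForm (ψ x) (ψ x') = stdForm x x')
    (hq : ∀ x x' u u', D'.quad (ψ x) (ψ x') (ψ u) (ψ u') = D.quad x x' u u') (x) :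
    (ψ x).2.2 = 0 ↔ x.2.2 = 0 := by
  have h1 : ∀ x, (ψ x).2 = 0 ↔ x.2 = 0 := by
    intro x
    rw [← D'.quad_eq_zero_iff, ← D.quad_eq_zero_iff]
    constructor
    · intro h y u u'
      rw [← hq, h]
    · intro h y u u'
      have := h (ψ.symm y) (ψ.symm u) (ψ.symm u')
      rwa [← hq, ψ.apply_symm_apply, ψ.apply_symm_apply, ψ.apply_symm_apply] at this
  rw [← stdForm_eq_zero_iff, ← stdForm_eq_zero_iff]
  constructor
  · intro h y hy
    rw [← hψ, h _ ((h1 y).2 hy)]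
  · intro h y hy
    have h2 := h (ψ.symm y) ((h1 _).1 (by rwa [ψ.apply_symm_apply]))
    rwa [← hψ, ψ.apply_symm_apply] at h2

theorem mu_rho (L : (Fin n → ℝ) →ₗ[ℝ] V) (S : Dual ℝ V →ₗ[ℝ] V) (x x') (α : Fin n) :
    D.mu (rho L S x) (rho L S x') α = D.mu x x' α -
      (x.2.2 (D.Λ α) * x'.2.2 (L (Pi.single α 1)) -
        x'.2.2 (D.Λ α) * x.2.2 (L (Pi.single α 1))) := by
  simp only [mu, rho_apply, Pi.sub_apply, homTranspose, LinearMap.pi_apply, Dual.eval_apply]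
  ring

theorem mu_rho_of_isΛHom {L : (Fin n → ℝ) →ₗ[ℝ] V} (hL : D.IsΛHom L) (S : Dual ℝ V →ₗ[ℝ] V)
    (x x') : D.mu (rho L S x) (rho L S x') = D.mu x x' := by
  obtain ⟨c, hc⟩ := hL
  ext α
  rw [mu_rho, hc, map_smul, map_smul]
  simp only [smul_eq_mul]
  ring

theorem quad_rho {L : (Fin n → ℝ) →ₗ[ℝ] V} (hL : D.IsΛHom L) (S : Dual ℝ V →ₗ[ℝ] V) (x x' u u') :
    D.quad (rho L S x) (rho L S x') (rho L S u) (rho L S u') = D.quad x x' u u' := by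
  rw [quad, quad, mu_rho_of_isΛHom hL, mu_rho_of_isΛHom hL]
  rfl

/-- Evaluating the quadrilinear forms on `f`, `f'`, `W_α`, `g` forces `L W_α` to be a multiple of
`Λ_α`. -/
theorem isΛHom_of_quad {L : (Fin n → ℝ) →ₗ[ℝ] V} {S : Dual ℝ V →ₗ[ℝ] V} {P : V ≃ₗ[ℝ] V}
    {Q : (Fin n → ℝ) ≃ₗ[ℝ] (Fin n → ℝ)}
    (hq : ∀ x x' u u', D'.quad ((diagMap P Q ≪≫ₗ rho L S) x) ((diagMap P Q ≪≫ₗ rho L S) x')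
      ((diagMap P Q ≪≫ₗ rho L S) u) ((diagMap P Q ≪≫ₗ rho L S) u') = D.quad x x' u u') :
    D'.IsΛHom L := by
  classical
  have hdW : ∀ w, diagMap P Q (0, Q.symm w, 0) = (0, w, 0) := fun w => by
    rw [diagMap_apply]; simp
  have hdZ : ∀ f : Dual ℝ V, diagMap P Q (0, 0, f ∘ₗ (P : V →ₗ[ℝ] V)) = (0, 0, f) := fun f => by
    rw [diagMap_apply]
    refine Prod.ext (map_zero P) (Prod.ext (map_zero Q) ?_)
    ext v
    simp
  have key : ∀ α (f f' : Dual ℝ V),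
      f (D'.Λ α) * f' (L (Pi.single α 1)) - f' (D'.Λ α) * f (L (Pi.single α 1)) = 0 := by
    intro α f f'
    obtain ⟨g, hg⟩ := D'.exists_dual_Λ α
    have h := hq (0, 0, f ∘ₗ (P : V →ₗ[ℝ] V)) (0, 0, f' ∘ₗ (P : V →ₗ[ℝ] V))
      (0, Q.symm (Pi.single α 1), 0) (0, 0, g ∘ₗ (P : V →ₗ[ℝ] V))
    simp only [LinearEquiv.trans_apply, hdW, hdZ] at h
    simp only [quad, mu_rho] at h
    simp only [rho_apply, mu, map_zero, LinearMap.zero_apply, Pi.zero_apply, mul_zero, sub_zero,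
      zero_sub, zero_mul, Finset.sum_const_zero, add_zero, zero_add] at h
    rw [Finset.sum_eq_single α] at h
    · rw [Pi.single_eq_same, hg] at h
      have h3 := D'.ε_mul_self α
      have h4 : D'.ε α ≠ 0 := fun h0 => by simp [h0] at h3
      have h5 := (mul_eq_zero.1 h).resolve_left h4
      linarith
    · intro β _ hβ
      simp [hβ]
    · simp
  choose f hf using D'.exists_dual_Λ
  refine ⟨fun α => f α (L (Pi.single α 1)), fun α => ?_⟩
  rw [← sub_eq_zero, ← Module.forall_dual_apply_eq_zero_iff ℝ]
  intro g
  have := key α (f α) g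
  rw [hf] at this
  rw [map_sub, map_smul, smul_eq_mul]
  linarith

theorem quad_diagMap_of_quad {L : (Fin n → ℝ) →ₗ[ℝ] V} {S : Dual ℝ V →ₗ[ℝ] V} {P : V ≃ₗ[ℝ] V}
    {Q : (Fin n → ℝ) ≃ₗ[ℝ] (Fin n → ℝ)}
    (hq : ∀ x x' u u', D'.quad ((diagMap P Q ≪≫ₗ rho L S) x) ((diagMap P Q ≪≫ₗ rho L S) x')
      ((diagMap P Q ≪≫ₗ rho L S) u) ((diagMap P Q ≪≫ₗ rho L S) u') = D.quad x x' u u') (x x' u u') :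
    D'.quad (diagMap P Q x) (diagMap P Q x') (diagMap P Q u) (diagMap P Q u') =
      D.quad x x' u u' := by
  rw [← hq, ← quad_rho (isΛHom_of_quad hq) S]
  rfl

variable (D D') in
/-- `Q` intertwines the products of weights of `D` and `D'`, where the latter are transported by
`P`: the non-zero matrix entries of `Q` connect only basis vectors on which they agree. -/
def Intertwines (P : V ≃ₗ[ℝ] V) (Q : (Fin n → ℝ) ≃ₗ[ℝ] (Fin n → ℝ)) : Prop :=
  ∀ (f g : Dual ℝ V) (α β : Fin n),
    D'.weight (f ∘ₗ (P.symm : V →ₗ[ℝ] V)) (g ∘ₗ (P.symm : V →ₗ[ℝ] V)) β * Q (Pi.single α 1) β =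
      D.weight f g α * Q (Pi.single α 1) β

theorem mu_diagMap (P : V ≃ₗ[ℝ] V) (Q : (Fin n → ℝ) ≃ₗ[ℝ] (Fin n → ℝ)) (x x') (β : Fin n) :
    D'.mu (diagMap P Q x) (diagMap P Q x') β =
      (x.2.2 ∘ₗ (P.symm : V →ₗ[ℝ] V)) (D'.Λ β) * Q x'.2.1 β -
        (x'.2.2 ∘ₗ (P.symm : V →ₗ[ℝ] V)) (D'.Λ β) * Q x.2.1 β := rfl

theorem Intertwines.apply {P : V ≃ₗ[ℝ] V} {Q : (Fin n → ℝ) ≃ₗ[ℝ] (Fin n → ℝ)}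
    (h : D.Intertwines D' P Q) (f g : Dual ℝ V) (w : Fin n → ℝ) (β : Fin n) :
    D'.weight (f ∘ₗ (P.symm : V →ₗ[ℝ] V)) (g ∘ₗ (P.symm : V →ₗ[ℝ] V)) β * Q w β =
      Q (fun α => D.weight f g α * w α) β := by
  have h1 : ∀ w : Fin n → ℝ, Q w β = ∑ α, w α * Q (Pi.single α 1) β := fun w => by
    conv_lhs => rw [← sum_single w]
    simp
  rw [h1, h1, Finset.mul_sum]
  refine Finset.sum_congr rfl fun α _ => ?_
  linear_combination w α * h f g α β

theorem Intertwines.sum_eq {P : V ≃ₗ[ℝ] V} {Q : (Fin n → ℝ) ≃ₗ[ℝ] (Fin n → ℝ)}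
    (hQ : IsOrthogonalMap Q) (h : D.Intertwines D' P Q) (f g : Dual ℝ V) (w w' : Fin n → ℝ) :
    ∑ β, D'.weight (f ∘ₗ (P.symm : V →ₗ[ℝ] V)) (g ∘ₗ (P.symm : V →ₗ[ℝ] V)) β * (Q w β * Q w' β) =
      ∑ α, D.weight f g α * (w α * w' α) := by
  simp only [← mul_assoc, h.apply, hQ (fun α => D.weight f g α * w α) w']

/-- The isometry `P ⊕ Q ⊕ (P^*)⁻¹` carries the quadrilinear form of `D` to that of `D'` if and
only if `P` carries `R` to `R'` and `Q` intertwines the weights. -/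
theorem quad_diagMap_iff {P : V ≃ₗ[ℝ] V} {Q : (Fin n → ℝ) ≃ₗ[ℝ] (Fin n → ℝ)}
    (hQ : IsOrthogonalMap Q) :
    (∀ x x' u u', D'.quad (diagMap P Q x) (diagMap P Q x') (diagMap P Q u) (diagMap P Q u') =
      D.quad x x' u u') ↔ pullbackCurv P D.R = D'.R ∧ D.Intertwines D' P Q := by
  classical
  constructor
  · intro h
    constructor
    · rw [pullbackCurv_eq_iff]
      intro f g f' g'
      have := h (0, 0, f) (0, 0, g) (0, 0, f') (0, 0, g')
      simpa [quad, mu, diagMap_apply] using this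
    · intro f g α β
      have := h (0, 0, f) (0, Pi.single α 1, 0) (0, 0, g) (0, Q.symm (Pi.single β 1), 0)
      simp only [quad, mu_diagMap] at this
      simp only [diagMap_apply, mu, map_zero, LinearMap.zero_apply, LinearMap.zero_comp,
        Pi.zero_apply, zero_mul, sub_zero, zero_add, LinearEquiv.apply_symm_apply] at this
      rw [Finset.sum_eq_single β, Finset.sum_eq_single α, sum_mul_orthogonal_single hQ] at this
      · simp only [Pi.single_eq_same] at this
        simp only [weight]
        linear_combination this
      · intro γ _ hγ; simp [hγ]
      · simp
      · intro γ _ hγ; simp [hγ]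
      · simp
  · rintro ⟨hR, hI⟩ x x' u u'
    have h1 := pullbackCurv_eq_iff.1 hR x.2.2 x'.2.2 u.2.2 u'.2.2
    have hs := fun f g w w' => hI.sum_eq hQ f g w w'
    have h2 : ∑ β, D'.ε β * (D'.mu (diagMap P Q x) (diagMap P Q x') β *
        D'.mu (diagMap P Q u) (diagMap P Q u') β) =
        ∑ α, D.ε α * (D.mu x x' α * D.mu u u' α) := by
      have e1 : ∀ β, D'.ε β * (D'.mu (diagMap P Q x) (diagMap P Q x') β *
          D'.mu (diagMap P Q u) (diagMap P Q u') β) =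
          D'.weight (x.2.2 ∘ₗ (P.symm : V →ₗ[ℝ] V)) (u.2.2 ∘ₗ (P.symm : V →ₗ[ℝ] V)) β *
            (Q x'.2.1 β * Q u'.2.1 β)
          - D'.weight (x.2.2 ∘ₗ (P.symm : V →ₗ[ℝ] V)) (u'.2.2 ∘ₗ (P.symm : V →ₗ[ℝ] V)) β *
            (Q x'.2.1 β * Q u.2.1 β)
          - D'.weight (x'.2.2 ∘ₗ (P.symm : V →ₗ[ℝ] V)) (u.2.2 ∘ₗ (P.symm : V →ₗ[ℝ] V)) β *
            (Q x.2.1 β * Q u'.2.1 β)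
          + D'.weight (x'.2.2 ∘ₗ (P.symm : V →ₗ[ℝ] V)) (u'.2.2 ∘ₗ (P.symm : V →ₗ[ℝ] V)) β *
            (Q x.2.1 β * Q u.2.1 β) := fun β => by
        rw [mu_diagMap, mu_diagMap]
        simp only [weight]
        ring
      have e2 : ∀ α, D.ε α * (D.mu x x' α * D.mu u u' α) =
          D.weight x.2.2 u.2.2 α * (x'.2.1 α * u'.2.1 α)
          - D.weight x.2.2 u'.2.2 α * (x'.2.1 α * u.2.1 α)
          - D.weight x'.2.2 u.2.2 α * (x.2.1 α * u'.2.1 α)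
          + D.weight x'.2.2 u'.2.2 α * (x.2.1 α * u.2.1 α) := fun α => by
        simp only [mu, weight]
        ring
      simp only [e1, e2, Finset.sum_add_distrib, Finset.sum_sub_distrib, hs]
    exact congrArg₂ (· + ·) h1 h2

end NormalFormData

namespace NormalFormData

variable {V : Type v} [AddCommGroup V] [Module ℝ V] [FiniteDimensional ℝ V] {n : ℕ}
  {D D' : NormalFormData V n}

/-- An invertible matrix has a non-zero term in the Leibniz expansion of its determinant. -/
theorem exists_perm_ne_zero (Q : (Fin n → ℝ) ≃ₗ[ℝ] (Fin n → ℝ)) :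
    ∃ π : Equiv.Perm (Fin n), ∀ α, Q (Pi.single α 1) (π α) ≠ 0 := by
  classical
  have hdet : (LinearMap.toMatrix' (Q : (Fin n → ℝ) →ₗ[ℝ] (Fin n → ℝ))).det ≠ 0 := by
    rw [LinearMap.det_toMatrix']
    exact (LinearEquiv.isUnit_det' Q).ne_zero
  rw [Matrix.det_apply] at hdet
  obtain ⟨π, -, hπ⟩ := Finset.exists_ne_zero_of_sum_ne_zero hdet
  refine ⟨π, fun α h0 => hπ ?_⟩
  rw [Finset.prod_eq_zero (Finset.mem_univ α), smul_zero]
  rw [LinearMap.toMatrix'_apply]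
  exact h0

/-- A vector is determined up to sign by the products of the values of linear forms on it. -/
theorem eq_or_eq_neg_of_mul {x y : V} (hx : x ≠ 0) {ε ε' : ℝ} (hε : ε = 1 ∨ ε = -1)
    (hε' : ε' = 1 ∨ ε' = -1)
    (h : ∀ f g : Dual ℝ V, ε' * (f y * g y) = ε * (f x * g x)) : ε = ε' ∧ (y = x ∨ y = -x) := by
  have h0 := (Module.forall_dual_apply_eq_zero_iff ℝ x).not.2 hx
  push Not at h0
  obtain ⟨f₀, hf₀⟩ := h0
  set f : Dual ℝ V := (f₀ x)⁻¹ • f₀ with hf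
  have hfx : f x = 1 := inv_mul_cancel₀ hf₀
  have h1 := h f f
  rw [hfx] at h1
  have hsq : 0 ≤ f y * f y := mul_self_nonneg _
  have hεε : ε = ε' := by
    rcases hε with rfl | rfl <;> rcases hε' with rfl | rfl <;> first | rfl | linarith
  refine ⟨hεε, ?_⟩
  subst hεε
  have hε0 : ε ≠ 0 := by rcases hε with rfl | rfl <;> norm_num
  have h2 : f y * f y = 1 := by
    have := mul_left_cancel₀ hε0 h1
    rw [this]; norm_num
  have h3 : f y • y = x := by
    rw [← sub_eq_zero, ← Module.forall_dual_apply_eq_zero_iff ℝ]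
    intro g
    have := mul_left_cancel₀ hε0 (h f g)
    rw [hfx] at this
    rw [map_sub, map_smul, smul_eq_mul]
    linarith
  rcases mul_self_eq_one_iff.1 h2 with h4 | h4
  · left
    rw [h4, one_smul] at h3
    exact h3
  · right
    rw [h4, neg_smul, one_smul] at h3
    rw [← h3, neg_neg]

theorem isoCond_of_perm {P : V ≃ₗ[ℝ] V} (hR : pullbackCurv P D.R = D'.R)
    {π : Equiv.Perm (Fin n)}
    (h : ∀ (f g : Dual ℝ V) α,
      D'.weight (f ∘ₗ (P.symm : V →ₗ[ℝ] V)) (g ∘ₗ (P.symm : V →ₗ[ℝ] V)) (π α) = D.weight f g α) :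
    IsoCond D D' P π := by
  have h1 := fun α => eq_or_eq_neg_of_mul (y := P.symm (D'.Λ (π α))) (D.Λ_ne_zero α) (D.ε_sign α)
    (D'.ε_sign (π α)) fun f g => h f g α
  refine ⟨hR, fun α => (h1 α).1, fun α => ?_⟩
  rcases (h1 α).2 with h2 | h2
  · left
    rw [← h2, P.apply_symm_apply]
  · right
    have h3 := congrArg P h2
    rw [P.apply_symm_apply, map_neg] at h3
    rw [h3, neg_neg]

theorem _root_.IsoCond.weight_eq {P : V ≃ₗ[ℝ] V} {π : Equiv.Perm (Fin n)}
    (h : IsoCond D D' P π) (f g : Dual ℝ V) (α : Fin n) :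
    D'.weight (f ∘ₗ (P.symm : V →ₗ[ℝ] V)) (g ∘ₗ (P.symm : V →ₗ[ℝ] V)) (π α) = D.weight f g α := by
  have h1 : ∀ f : Dual ℝ V, (f ∘ₗ (P.symm : V →ₗ[ℝ] V)) (P (D.Λ α)) = f (D.Λ α) := fun f => by simp
  rw [weight, weight, ← h.sign]
  rcases h.vector α with h2 | h2
  · rw [← h2, h1, h1]
  · rw [← neg_eq_iff_eq_neg] at h2
    rw [← h2, map_neg, map_neg, h1, h1, neg_mul_neg]

theorem Intertwines.exists_isoCond {P : V ≃ₗ[ℝ] V} {Q : (Fin n → ℝ) ≃ₗ[ℝ] (Fin n → ℝ)}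
    (hR : pullbackCurv P D.R = D'.R) (h : D.Intertwines D' P Q) : ∃ π, IsoCond D D' P π := by
  obtain ⟨π, hπ⟩ := exists_perm_ne_zero Q
  exact ⟨π, isoCond_of_perm hR fun f g α => mul_right_cancel₀ (hπ α) (h f g α (π α))⟩

theorem mem_simEigenspace_iff {χ : Dual ℝ V → ℝ} {w : Fin n → ℝ} :
    w ∈ D.simEigenspace χ ↔ ∀ f α, -D.weight f f α * w α = χ f * w α := by
  have h : ∀ f : Dual ℝ V, D.cW ⁅D.elt 0 0 0 0 f, ⁅D.elt 0 0 0 0 f, D.elt 0 0 0 w 0⁆⁆ =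
      fun α => -D.weight f f α * w α := by
    intro f
    rw [D.lie_def, D.lie_def]
    ext α
    simp [bracket, weight]
    ring
  show (∀ f, _ = χ f • w) ↔ _
  simp only [h]
  exact forall_congr' fun f => funext_iff

/-- An orthogonal map preserves the simultaneous eigenspaces if and only if its non-zero matrix
entries connect only basis vectors with equal weights. The weights `f ↦ ε_α f(Λ_α)²` determine the
products `ε_α f(Λ_α) g(Λ_α)` by polarization. -/
theorem isEigenOrthogonal_iff {Q : (Fin n → ℝ) ≃ₗ[ℝ] (Fin n → ℝ)} :
    D.IsEigenOrthogonal Q ↔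
      IsOrthogonalMap Q ∧ D.Intertwines D (LinearEquiv.refl ℝ V) Q := by
  classical
  refine and_congr_right fun _ => ⟨fun h f g α β => ?_, fun h χ w hw => ?_⟩
  · have h1 : ∀ f, D.weight f f β * Q (Pi.single α 1) β =
        D.weight f f α * Q (Pi.single α 1) β := by
      have h2 : Pi.single α 1 ∈ D.simEigenspace fun f => -D.weight f f α := by
        rw [mem_simEigenspace_iff]
        intro f γ
        by_cases hγ : γ = α
        · rw [hγ]
        · simp [hγ]
      intro f
      have := mem_simEigenspace_iff.1 (h _ _ h2) f β
      linarith
    have h2 := h1 f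
    have h3 := h1 g
    have h4 := h1 (f + g)
    show D.weight f g β * _ = _
    simp only [weight, LinearMap.add_apply] at h2 h3 h4 ⊢
    linear_combination (h4 - h2 - h3) / 2
  · rw [mem_simEigenspace_iff] at hw ⊢
    intro f β
    have h1 := h.apply f f w β
    have h2 : (fun α => D.weight f f α * w α) = (-χ f) • w := by
      ext α
      have := hw f α
      rw [Pi.smul_apply, smul_eq_mul]
      linarith
    rw [h2, map_smul, Pi.smul_apply, smul_eq_mul] at h1
    have h3 : D.weight f f β * Q w β = -χ f * Q w β := h1
    linarith

theorem isOrthogonalMap_permMap (π : Equiv.Perm (Fin n)) : IsOrthogonalMap (permMap π) :=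
  fun w w' => Equiv.sum_comp π.symm fun α => w α * w' α

theorem permMap_apply (π : Equiv.Perm (Fin n)) (w : Fin n → ℝ) (α : Fin n) :
    permMap π w α = w (π.symm α) := rfl

theorem _root_.IsoCond.intertwines {P : V ≃ₗ[ℝ] V} {π : Equiv.Perm (Fin n)}
    (h : IsoCond D D' P π) {O Q : (Fin n → ℝ) ≃ₗ[ℝ] (Fin n → ℝ)} (hO : D.IsEigenOrthogonal O)
    (hQ : ∀ w, Q w = permMap π (O w)) : IsOrthogonalMap Q ∧ D.Intertwines D' P Q := by
  rw [isEigenOrthogonal_iff] at hO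
  refine ⟨fun w w' => ?_, fun f g α β => ?_⟩
  · rw [hQ, hQ, isOrthogonalMap_permMap, hO.1]
  · obtain ⟨β, rfl⟩ := π.surjective β
    rw [hQ, permMap_apply, π.symm_apply_apply, h.weight_eq]
    exact hO.2 f g α β

/-- The orthogonal maps that intertwine the weights are, up to the permutation `π`, those which
preserve the simultaneous eigenspaces. -/
theorem _root_.IsoCond.exists_eigenOrthogonal {P : V ≃ₗ[ℝ] V} {π : Equiv.Perm (Fin n)}
    (h : IsoCond D D' P π) {Q : (Fin n → ℝ) ≃ₗ[ℝ] (Fin n → ℝ)} (hQ : IsOrthogonalMap Q)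
    (hI : D.Intertwines D' P Q) :
    ∃ O : (Fin n → ℝ) ≃ₗ[ℝ] (Fin n → ℝ), D.IsEigenOrthogonal O ∧ ∀ w, Q w = permMap π (O w) := by
  refine ⟨Q ≪≫ₗ (permMap π).symm, isEigenOrthogonal_iff.2 ⟨fun w w' => ?_, fun f g α β => ?_⟩,
    fun w => ((permMap π).apply_symm_apply _).symm⟩
  · rw [LinearEquiv.trans_apply, LinearEquiv.trans_apply, ← isOrthogonalMap_permMap π,
      LinearEquiv.apply_symm_apply, LinearEquiv.apply_symm_apply, hQ]
  · have h1 := hI f g α (π β)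
    rw [h.weight_eq] at h1
    exact h1

theorem isEigenOrthogonal_refl : D.IsEigenOrthogonal (LinearEquiv.refl ℝ _) :=
  ⟨fun _ _ => rfl, fun _ _ hw => hw⟩

/-- An orthogonal map that intertwines the weights transported by `P` and preserves the simultaneous
eigenspaces shows that `P` fixes all weights, hence all `Λ_α` up to sign. -/
theorem Intertwines.apply_Λ {P : V ≃ₗ[ℝ] V} {Q : (Fin n → ℝ) ≃ₗ[ℝ] (Fin n → ℝ)}
    (hR : pullbackCurv P D.R = D.R) (h : D.Intertwines D P Q) (hQ : D.IsEigenOrthogonal Q) :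
    IsoCond D D P (Equiv.refl _) := by
  refine isoCond_of_perm hR fun f g β => ?_
  have hβ : ∃ α, Q (Pi.single α 1) β ≠ 0 := by
    by_contra h0
    push Not at h0
    have h1 : Q (Q.symm (Pi.single β 1)) β = 0 := by
      conv_lhs => rw [← sum_single (Q.symm (Pi.single β 1))]
      simp [h0]
    rw [Q.apply_symm_apply, Pi.single_eq_same] at h1
    exact one_ne_zero h1
  obtain ⟨α, hα⟩ := hβ
  have h1 := mul_right_cancel₀ hα (h f g α β)
  have h2 := mul_right_cancel₀ hα ((isEigenOrthogonal_iff.1 hQ).2 f g α β)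
  exact h1.trans h2.symm

end NormalFormData

/-! ### Isomorphisms of normal forms -/

namespace NormalFormData

variable {V : Type v} [AddCommGroup V] [Module ℝ V] [FiniteDimensional ℝ V] {n : ℕ}
  {D D' : NormalFormData V n}

/-- An isomorphism restricts to an isometry of the spaces `𝔪` that carries one quadrilinear form
to the other. -/
theorem exists_isometry_of_iso (Φ : D.triple.Iso D'.triple) :
    ∃ ψ : (V × (Fin n → ℝ) × Dual ℝ V) ≃ₗ[ℝ] (V × (Fin n → ℝ) × Dual ℝ V),
      (∀ x x', stdForm (ψ x) (ψ x') = stdForm x x') ∧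
      ∀ x x' u u', D'.quad (ψ x) (ψ x') (ψ u) (ψ u') = D.quad x x' u u' := by
  have hm : ∀ x, Φ.toLieEquiv (D.incl x) ∈ D'.triple.m := fun x => by
    rw [D'.triple.mem_m, ← Φ.map_σ, D.triple.mem_m.1 (D.incl_mem_m x), map_neg]
  let e : D.triple.carrier →ₗ[ℝ] D'.triple.carrier := Φ.toLieEquiv.toLieHom
  let ψ₀ : (V × (Fin n → ℝ) × Dual ℝ V) →ₗ[ℝ] (V × (Fin n → ℝ) × Dual ℝ V) :=
    D'.mEquiv.symm.toLinearMap ∘ₗ (e ∘ₗ D.incl).codRestrict D'.triple.m hm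
  have hψ₀ : ∀ x, D'.incl (ψ₀ x) = Φ.toLieEquiv (D.incl x) := fun x =>
    congrArg Subtype.val (D'.mEquiv.apply_symm_apply ⟨_, hm x⟩)
  have hinj : Function.Injective ψ₀ := fun x x' h => by
    apply D.incl_injective
    apply Φ.toLieEquiv.injective
    show Φ.toLieEquiv (D.incl x) = Φ.toLieEquiv (D.incl x')
    rw [← hψ₀, ← hψ₀, h]
  refine ⟨LinearEquiv.ofInjectiveEndo ψ₀ hinj, fun x x' => ?_, fun x x' u u' => ?_⟩
  · show stdForm (ψ₀ x) (ψ₀ x') = _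
    rw [← D'.stdForm_eq, hψ₀, hψ₀, Φ.map_B, D.stdForm_eq]
  · show D'.quad (ψ₀ x) (ψ₀ x') (ψ₀ u) (ψ₀ u') = _
    rw [← B_lie_incl, hψ₀, hψ₀, hψ₀, hψ₀, ← LieEquiv.map_lie, ← LieEquiv.map_lie, Φ.map_B,
      B_lie_incl]

theorem nonempty_iso_iff : Nonempty (D.triple.Iso D'.triple) ↔
    ∃ (P : V ≃ₗ[ℝ] V) (π : Equiv.Perm (Fin n)), IsoCond D D' P π := by
  constructor
  · rintro ⟨Φ⟩
    obtain ⟨ψ, hψ, hq⟩ := exists_isometry_of_iso Φ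
    obtain ⟨L, S, P, Q, -, hQ, rfl⟩ := exists_eq_rho_diagMap ψ hψ (snd_snd_eq_zero_iff ψ hψ hq)
    obtain ⟨hR, hI⟩ := (quad_diagMap_iff hQ).1 (quad_diagMap_of_quad hq)
    exact ⟨P, hI.exists_isoCond hR⟩
  · rintro ⟨P, π, h⟩
    obtain ⟨hQ, hI⟩ := h.intertwines isEigenOrthogonal_refl (Q := permMap π) fun _ => rfl
    have hq := (quad_diagMap_iff hQ).2 ⟨h.curvature, hI⟩
    refine (SymmetricTriple.exists_iso_of_parametrizations D.incl
      (D'.incl ∘ₗ (diagMap P (permMap π)).toLinearMap) D.range_incl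
      (by rw [LinearMap.range_comp, LinearEquiv.range, Submodule.map_top, D'.range_incl])
      (fun x x' => ?_) (fun x x' u u' => ?_)).elim fun Φ _ => ⟨Φ⟩
    · show D'.triple.B (D'.incl (diagMap _ _ _)) (D'.incl (diagMap _ _ _)) = D.triple.B _ _
      rw [D.stdForm_eq, D'.stdForm_eq, stdForm_diagMap hQ]
    · show D'.triple.B ⁅D'.incl (diagMap _ _ _), D'.incl (diagMap _ _ _)⁆
        ⁅D'.incl (diagMap _ _ _), D'.incl (diagMap _ _ _)⁆ = D.triple.B _ _
      rw [B_lie_incl, B_lie_incl, hq]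

end NormalFormData

/-! ### Automorphisms of normal forms -/

namespace SymmetricTriple

variable {τ : SymmetricTriple.{u}}

theorem apply_mem_hmPerp_iff {γ : τ.m ≃ₗ[ℝ] τ.m} (hγ : γ ∈ τ.Γ) (x : τ.m) :
    (γ x : τ.carrier) ∈ τ.hmPerp ↔ (x : τ.carrier) ∈ τ.hmPerp := by
  have h : ∀ {γ : τ.m ≃ₗ[ℝ] τ.m}, γ ∈ τ.Γ → ∀ x : τ.m, (x : τ.carrier) ∈ τ.hmPerp →
      (γ x : τ.carrier) ∈ τ.hmPerp := by
    intro γ hγ x hx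
    refine ⟨(γ x).2, fun w hw => ?_⟩
    obtain ⟨y, hy⟩ := γ.surjective ⟨w, τ.hm_le_m hw⟩
    have h1 : (y : τ.carrier) ∈ τ.hm := by rw [← hγ.2, hy]; exact hw
    have h2 : τ.B y x = 0 := hx.2 _ h1
    rw [← hγ.1, hy] at h2
    exact h2
  refine ⟨fun hx => ?_, h hγ x⟩
  have := h (inv_mem hγ) _ hx
  rwa [← LinearEquiv.mul_apply, inv_mul_cancel] at this

/-- `Γ_decomp` is a normal subgroup of `Γ`. -/
theorem conj_mem_ΓDecomp {γ δ : τ.m ≃ₗ[ℝ] τ.m} (hγ : γ ∈ τ.Γ) (hδ : δ ∈ τ.ΓDecomp) :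
    γ * δ * γ⁻¹ ∈ τ.ΓDecomp := by
  have hi := inv_mem hγ
  have key : ∀ x, γ (γ⁻¹ x) = x := fun x => by
    rw [← LinearEquiv.mul_apply, mul_inv_cancel]; rfl
  have hsub : ∀ x, (γ * δ * γ⁻¹) x - x = γ (δ (γ⁻¹ x) - γ⁻¹ x) := fun x => by
    rw [map_sub, key]; rfl
  have hE : ∀ {γ : τ.m ≃ₗ[ℝ] τ.m}, γ ∈ τ.Γ → ∀ x : τ.m, (x : τ.carrier) ∈ τ.hm ⊓ τ.hmPerp →
      (γ x : τ.carrier) ∈ τ.hm ⊓ τ.hmPerp := fun hγ x hx =>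
    ⟨(hγ.2 x).2 hx.1, (apply_mem_hmPerp_iff hγ x).2 hx.2⟩
  refine ⟨mul_mem (mul_mem hγ hδ.1) hi, fun x hx => ?_, fun x hx => ?_, fun x hx => ?_⟩
  · show γ (δ (γ⁻¹ x)) = x
    rw [hδ.2.1 _ (hE hi x hx), key]
  · rw [hsub]
    exact hE hγ _ (hδ.2.2.1 _ ((hi.2 x).2 hx))
  · rw [hsub]
    exact hE hγ _ (hδ.2.2.2 _ ((apply_mem_hmPerp_iff hi x).2 hx))

theorem IsTame.hm_inf_hmPerp (h : τ.IsTame) : τ.hm ⊓ τ.hmPerp = τ.z := by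
  rw [hmPerp_eq_z]
  exact inf_eq_right.2 h.z_le_hm

theorem IsTame.mem_ΓDecomp_iff (h : τ.IsTame) {γ : τ.m ≃ₗ[ℝ] τ.m} : γ ∈ τ.ΓDecomp ↔ γ ∈ τ.Γ ∧
    (∀ x : τ.m, (x : τ.carrier) ∈ τ.z → γ x = x) ∧
    (∀ x : τ.m, (x : τ.carrier) ∈ τ.hm → ((γ x - x : τ.m) : τ.carrier) ∈ τ.z) ∧
    (∀ x : τ.m, (x : τ.carrier) ∈ τ.z → ((γ x - x : τ.m) : τ.carrier) ∈ τ.z) := by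
  have h0 : γ ∈ τ.ΓDecomp ↔ γ ∈ τ.Γ ∧
      (∀ x : τ.m, (x : τ.carrier) ∈ τ.hm ⊓ τ.hmPerp → γ x = x) ∧
      (∀ x : τ.m, (x : τ.carrier) ∈ τ.hm →
        ((γ x - x : τ.m) : τ.carrier) ∈ τ.hm ⊓ τ.hmPerp) ∧
      (∀ x : τ.m, (x : τ.carrier) ∈ τ.hmPerp →
        ((γ x - x : τ.m) : τ.carrier) ∈ τ.hm ⊓ τ.hmPerp) := Iff.rfl
  rw [h0, h.hm_inf_hmPerp, hmPerp_eq_z]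

end SymmetricTriple

namespace NormalFormData

variable {V : Type v} [AddCommGroup V] [Module ℝ V] [FiniteDimensional ℝ V] {n : ℕ}
  (D : NormalFormData V n)

/-- The automorphism of `𝔪` that corresponds to an automorphism of `V ⊕ ℝ^n ⊕ V^*`. -/
def transport (ψ : (V × (Fin n → ℝ) × Dual ℝ V) ≃ₗ[ℝ] (V × (Fin n → ℝ) × Dual ℝ V)) :
    D.triple.m ≃ₗ[ℝ] D.triple.m :=
  D.mEquiv.symm ≪≫ₗ ψ ≪≫ₗ D.mEquiv

variable {D} {ψ : (V × (Fin n → ℝ) × Dual ℝ V) ≃ₗ[ℝ] (V × (Fin n → ℝ) × Dual ℝ V)}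

theorem transport_apply (x) : D.transport ψ (D.mEquiv x) = D.mEquiv (ψ x) := by
  show D.mEquiv (ψ (D.mEquiv.symm (D.mEquiv x))) = _
  rw [LinearEquiv.symm_apply_apply]

theorem coe_transport_apply (x) : (D.transport ψ (D.mEquiv x) : D.triple.carrier) = D.incl (ψ x) :=
  congrArg Subtype.val (transport_apply x)

theorem exists_transport (γ : D.triple.m ≃ₗ[ℝ] D.triple.m) : ∃ ψ, D.transport ψ = γ := by
  refine ⟨D.mEquiv ≪≫ₗ γ ≪≫ₗ D.mEquiv.symm, ?_⟩
  ext1 x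
  show D.mEquiv (D.mEquiv.symm (γ (D.mEquiv (D.mEquiv.symm x)))) = _
  rw [LinearEquiv.apply_symm_apply, LinearEquiv.apply_symm_apply]

theorem transport_injective : Function.Injective D.transport := by
  intro ψ ψ' h
  ext1 x
  apply D.mEquiv.injective
  rw [← transport_apply, h, transport_apply]

theorem transport_trans
    (φ ψ : (V × (Fin n → ℝ) × Dual ℝ V) ≃ₗ[ℝ] (V × (Fin n → ℝ) × Dual ℝ V)) :
    D.transport (φ ≪≫ₗ ψ) = D.transport ψ * D.transport φ := by
  ext1 x
  obtain ⟨x, rfl⟩ := D.mEquiv.surjective x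
  rw [LinearEquiv.mul_apply, transport_apply, transport_apply, transport_apply]
  rfl

theorem decompMap_eq (L : (Fin n → ℝ) →ₗ[ℝ] V) (S : Dual ℝ V →ₗ[ℝ] V) :
    D.decompMap L S = D.transport (rho L S) := rfl

theorem forall_m {p : D.triple.m → Prop} : (∀ x, p x) ↔ ∀ x, p (D.mEquiv x) :=
  D.mEquiv.surjective.forall

theorem transport_mem_Γ : D.transport ψ ∈ D.triple.Γ ↔
    (∀ x x', stdForm (ψ x) (ψ x') = stdForm x x') ∧ ∀ x, (ψ x).2.2 = 0 ↔ x.2.2 = 0 := by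
  have h : D.transport ψ ∈ D.triple.Γ ↔
      (∀ x x' : D.triple.m, D.triple.B (D.transport ψ x) (D.transport ψ x') = D.triple.B x x') ∧
      ∀ x : D.triple.m, (D.transport ψ x : D.triple.carrier) ∈ D.triple.hm ↔
        (x : D.triple.carrier) ∈ D.triple.hm := Iff.rfl
  rw [h]
  simp only [forall_m, coe_transport_apply, mEquiv_coe, stdForm_eq, incl_mem_hm_iff]

/-- By non-degeneracy of `B`, an isometry preserves the triple bracket if and only if it preserves
`B([[x, y], u], v) = B([x, y], [u, v])`. -/
theorem transport_mem_Aut : D.transport ψ ∈ D.triple.Aut ↔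
    (∀ x x', stdForm (ψ x) (ψ x') = stdForm x x') ∧
      ∀ x x' u u', D.quad (ψ x) (ψ x') (ψ u) (ψ u') = D.quad x x' u u' := by
  have h : D.transport ψ ∈ D.triple.Aut ↔
      (∀ x x' : D.triple.m, D.triple.B (D.transport ψ x) (D.transport ψ x') = D.triple.B x x') ∧
      ∀ x y w x' : D.triple.m,
        ⁅⁅(x : D.triple.carrier), (y : D.triple.carrier)⁆, (w : D.triple.carrier)⁆ = x' →
        ⁅⁅(D.transport ψ x : D.triple.carrier), (D.transport ψ y : D.triple.carrier)⁆,
          (D.transport ψ w : D.triple.carrier)⁆ = D.transport ψ x' := Iff.rfl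
  rw [h]
  simp only [forall_m, coe_transport_apply, mEquiv_coe, stdForm_eq]
  refine and_congr_right fun hψ => ⟨fun h x x' u u' => ?_, fun h x y w x' hx' => ?_⟩
  · have h1 : ⁅⁅D.incl x, D.incl x'⁆, D.incl u⁆ ∈ D.triple.m := D.triple.lie_mem_m
      (D.triple.lie_mem_h (D.incl_mem_m x) (D.incl_mem_m x')) (D.incl_mem_m u)
    obtain ⟨y, hy⟩ := D.exists_incl h1
    rw [← B_lie_incl, ← B_lie_incl, ← D.triple.B_lie_assoc, ← D.triple.B_lie_assoc,
      h _ _ _ _ hy.symm, ← hy, stdForm_eq, stdForm_eq, hψ]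
  · have h1 : ⁅⁅D.incl (ψ x), D.incl (ψ y)⁆, D.incl (ψ w)⁆ ∈ D.triple.m := D.triple.lie_mem_m
      (D.triple.lie_mem_h (D.incl_mem_m _) (D.incl_mem_m _)) (D.incl_mem_m _)
    rw [← sub_eq_zero]
    refine D.triple.eq_zero_of_m (D.triple.m.sub_mem h1 (D.incl_mem_m _)) fun v hv => ?_
    obtain ⟨v, rfl⟩ := D.exists_incl hv
    obtain ⟨v, rfl⟩ := ψ.surjective v
    rw [map_sub, LinearMap.sub_apply, D.triple.B_lie_assoc, B_lie_incl, h, stdForm_eq, hψ,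
      ← B_lie_incl, ← D.triple.B_lie_assoc, hx', stdForm_eq, sub_self]

theorem aut_le_Γ : D.triple.Aut ≤ D.triple.Γ := by
  intro γ hγ
  obtain ⟨ψ, rfl⟩ := exists_transport γ
  obtain ⟨h1, h2⟩ := transport_mem_Aut.1 hγ
  exact transport_mem_Γ.2 ⟨h1, snd_snd_eq_zero_iff ψ h1 h2⟩

theorem transport_mem_ΓDecomp : D.transport ψ ∈ D.triple.ΓDecomp ↔
    ∃ L S, IsSkewMap S ∧ ψ = rho L S := by
  rw [D.isTame.mem_ΓDecomp_iff]
  simp only [forall_m, transport_apply, ← map_sub, mEquiv_coe, incl_mem_z_iff, incl_mem_hm_iff,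
    D.mEquiv.injective.eq_iff, transport_mem_Γ]
  constructor
  · rintro ⟨⟨h1, -⟩, h2, h3, -⟩
    refine exists_eq_rho ψ h1 (fun v => h2 _ rfl) (fun w => ?_) fun f => ?_
    · exact sub_eq_zero.1 (h3 (0, w, 0) rfl)
    · ext v
      have h4 := h1 (v, 0, 0) (0, 0, f)
      rw [h2 (v, 0, 0) rfl] at h4
      simpa [stdForm] using h4
  · rintro ⟨L, S, hS, rfl⟩
    refine ⟨⟨stdForm_rho hS, fun x => Iff.rfl⟩, ?_, ?_, ?_⟩
    · rintro ⟨v, y⟩ rfl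
      simp [rho_apply]
    · rintro ⟨v, w, f⟩ hf
      obtain rfl : f = 0 := hf
      simp [rho_apply]
    · rintro ⟨v, y⟩ rfl
      simp [rho_apply]

theorem incl_mem_zSub {x} : D.incl x ∈ D.zSub ↔ x.2 = 0 := by
  constructor
  · rintro ⟨v, hv⟩
    rw [← D.incl_injective hv]
    rfl
  · obtain ⟨v, y⟩ := x
    rintro rfl
    exact ⟨v, rfl⟩

theorem incl_mem_wSub {x} : D.incl x ∈ D.wSub ↔ x.1 = 0 ∧ x.2.2 = 0 := by
  constructor
  · rintro ⟨v, hv⟩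
    rw [← D.incl_injective hv]
    exact ⟨rfl, rfl⟩
  · obtain ⟨v, w, f⟩ := x
    rintro ⟨rfl, rfl⟩
    exact ⟨w, rfl⟩

theorem incl_mem_zsSub {x} : D.incl x ∈ D.zsSub ↔ x.1 = 0 ∧ x.2.1 = 0 := by
  constructor
  · rintro ⟨v, hv⟩
    rw [← D.incl_injective hv]
    exact ⟨rfl, rfl⟩
  · obtain ⟨v, w, f⟩ := x
    rintro ⟨rfl, rfl⟩
    exact ⟨f, rfl⟩

theorem transport_mem_ΓBasis : D.transport ψ ∈ D.ΓBasis ↔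
    ∃ P Q, IsOrthogonalMap Q ∧ ψ = diagMap P Q := by
  have h : D.transport ψ ∈ D.ΓBasis ↔ D.transport ψ ∈ D.triple.Γ ∧
      (∀ x : D.triple.m, (D.transport ψ x : D.triple.carrier) ∈ D.zSub ↔
        (x : D.triple.carrier) ∈ D.zSub) ∧
      (∀ x : D.triple.m, (D.transport ψ x : D.triple.carrier) ∈ D.wSub ↔
        (x : D.triple.carrier) ∈ D.wSub) ∧
      (∀ x : D.triple.m, (D.transport ψ x : D.triple.carrier) ∈ D.zsSub ↔
        (x : D.triple.carrier) ∈ D.zsSub) := Iff.rfl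
  rw [h]
  simp only [forall_m, coe_transport_apply, mEquiv_coe, incl_mem_zSub, incl_mem_wSub,
    incl_mem_zsSub, transport_mem_Γ]
  constructor
  · rintro ⟨⟨h1, h2⟩, -, h4, h5⟩
    obtain ⟨L, S, P, Q, hS, hQ, rfl⟩ := exists_eq_rho_diagMap ψ h1 h2
    have hL : L = 0 := by
      refine LinearMap.ext fun w => ?_
      obtain ⟨w, rfl⟩ := Q.surjective w
      simpa [rho_apply, diagMap_apply] using ((h4 (0, w, 0)).2 ⟨rfl, rfl⟩).1
    subst hL
    have hS : S = 0 := by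
      refine LinearMap.ext fun f => ?_
      have := ((h5 (0, 0, f ∘ₗ (P : V →ₗ[ℝ] V))).2 ⟨rfl, rfl⟩).1
      simpa [rho_apply, diagMap_apply, LinearMap.comp_assoc] using this
    subst hS
    refine ⟨P, Q, hQ, ?_⟩
    ext1 x
    rw [LinearEquiv.trans_apply, rho_apply]
    refine Prod.ext (by simp) (Prod.ext ?_ rfl)
    ext α
    simp [homTranspose]
  · rintro ⟨P, Q, hQ, rfl⟩
    have h0 : ∀ f : Dual ℝ V, f ∘ₗ (P.symm : V →ₗ[ℝ] V) = 0 ↔ f = 0 := fun f =>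
      LinearEquiv.map_eq_zero_iff P.dualMap.symm
    refine ⟨⟨stdForm_diagMap hQ, ?_⟩, ?_, ?_, ?_⟩
    all_goals
      rintro ⟨v, w, f⟩
      simp [diagMap_apply, h0, Prod.ext_iff]

end NormalFormData

namespace NormalFormData

variable {V : Type v} [AddCommGroup V] [Module ℝ V] [FiniteDimensional ℝ V] {n : ℕ}
  (D : NormalFormData V n)

theorem ΓDecomp_inf_ΓBasis : D.triple.ΓDecomp ⊓ D.ΓBasis = ⊥ := by
  rw [eq_bot_iff]
  rintro γ ⟨h1, h2⟩
  obtain ⟨ψ, rfl⟩ := exists_transport γ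
  obtain ⟨L, S, -, rfl⟩ := transport_mem_ΓDecomp.1 h1
  obtain ⟨P, Q, -, h⟩ := transport_mem_ΓBasis.1 h2
  have hL : L = 0 := LinearMap.ext fun w => by
    simpa [rho_apply, diagMap_apply] using congrArg Prod.fst (LinearEquiv.congr_fun h (0, w, 0))
  subst hL
  have hS : S = 0 := LinearMap.ext fun f => by
    simpa [rho_apply, diagMap_apply] using congrArg Prod.fst (LinearEquiv.congr_fun h (0, 0, f))
  subst hS
  rw [Subgroup.mem_bot]
  ext1 x
  obtain ⟨x, rfl⟩ := D.mEquiv.surjective x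
  rw [transport_apply]
  refine congrArg D.mEquiv ?_
  rw [rho_apply]
  refine Prod.ext (by simp) (Prod.ext ?_ rfl)
  ext α
  simp [homTranspose]

theorem ΓDecomp_sup_ΓBasis : D.triple.ΓDecomp ⊔ D.ΓBasis = D.triple.Γ := by
  refine le_antisymm (sup_le (fun γ h => h.1) fun γ h => h.1) fun γ hγ => ?_
  obtain ⟨ψ, rfl⟩ := exists_transport γ
  obtain ⟨h1, h2⟩ := transport_mem_Γ.1 hγ
  obtain ⟨L, S, P, Q, hS, hQ, rfl⟩ := exists_eq_rho_diagMap ψ h1 h2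
  rw [transport_trans]
  exact Subgroup.mul_mem_sup (transport_mem_ΓDecomp.2 ⟨L, S, hS, rfl⟩)
    (transport_mem_ΓBasis.2 ⟨P, Q, hQ, rfl⟩)

variable {D}

theorem transport_rho_mem_Aut {L : (Fin n → ℝ) →ₗ[ℝ] V} {S : Dual ℝ V →ₗ[ℝ] V} (hL : D.IsΛHom L)
    (hS : IsSkewMap S) : D.transport (rho L S) ∈ D.triple.Aut :=
  transport_mem_Aut.2 ⟨stdForm_rho hS, quad_rho hL S⟩

theorem transport_diagMap_mem_Aut_iff {P : V ≃ₗ[ℝ] V} {Q : (Fin n → ℝ) ≃ₗ[ℝ] (Fin n → ℝ)}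
    (hQ : IsOrthogonalMap Q) : D.transport (diagMap P Q) ∈ D.triple.Aut ↔
      pullbackCurv P D.R = D.R ∧ D.Intertwines D P Q := by
  rw [transport_mem_Aut, quad_diagMap_iff hQ]
  exact and_iff_right (stdForm_diagMap hQ)

variable (D)

theorem aut_eq_sup :
    (D.triple.Aut ⊓ D.triple.ΓDecomp) ⊔ (D.triple.Aut ⊓ D.ΓBasis) = D.triple.Aut := by
  refine le_antisymm (sup_le inf_le_left inf_le_left) fun γ hγ => ?_
  obtain ⟨ψ, rfl⟩ := exists_transport γ
  obtain ⟨h1, h2⟩ := transport_mem_Aut.1 hγ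
  obtain ⟨L, S, P, Q, hS, hQ, rfl⟩ := exists_eq_rho_diagMap ψ h1 (snd_snd_eq_zero_iff ψ h1 h2)
  rw [transport_trans]
  exact Subgroup.mul_mem_sup
    ⟨transport_rho_mem_Aut (isΛHom_of_quad h2) hS, transport_mem_ΓDecomp.2 ⟨L, S, hS, rfl⟩⟩
    ⟨transport_mem_Aut.2 ⟨stdForm_diagMap hQ, quad_diagMap_of_quad h2⟩,
      transport_mem_ΓBasis.2 ⟨P, Q, hQ, rfl⟩⟩

theorem bijOn_decompMap :
    Set.BijOn (fun x : ((Fin n → ℝ) →ₗ[ℝ] V) × (Dual ℝ V →ₗ[ℝ] V) => D.decompMap x.1 x.2)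
      {x | D.IsΛHom x.1 ∧ IsSkewMap x.2} {γ | γ ∈ D.triple.Aut ∧ γ ∈ D.triple.ΓDecomp} := by
  refine ⟨?_, ?_, ?_⟩
  · rintro ⟨L, S⟩ ⟨hL, hS⟩
    exact ⟨transport_rho_mem_Aut hL hS, transport_mem_ΓDecomp.2 ⟨L, S, hS, rfl⟩⟩
  · rintro ⟨L, S⟩ - ⟨L', S'⟩ - h
    obtain ⟨h1, h2⟩ := rho_injective (transport_injective h)
    exact Prod.ext h1 h2
  · rintro γ ⟨h1, h2⟩
    obtain ⟨ψ, rfl⟩ := exists_transport γ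
    obtain ⟨L, S, hS, rfl⟩ := transport_mem_ΓDecomp.1 h2
    have h3 : diagMap (LinearEquiv.refl ℝ V) (LinearEquiv.refl ℝ (Fin n → ℝ)) ≪≫ₗ rho L S =
        rho L S := by
      ext1 x
      rfl
    rw [← h3] at h1
    exact ⟨(L, S), ⟨isΛHom_of_quad (transport_mem_Aut.1 h1).2, hS⟩, rfl⟩

theorem basisMap_injective :
    Function.Injective fun x : (V ≃ₗ[ℝ] V) × ((Fin n → ℝ) ≃ₗ[ℝ] (Fin n → ℝ)) =>
      D.basisMap x.1 x.2 := by
  rintro ⟨P, Q⟩ ⟨P', Q'⟩ h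
  obtain ⟨h1, h2⟩ := diagMap_injective (transport_injective h)
  exact Prod.ext h1 h2

theorem bijOn_basisMap :
    Set.BijOn (fun x : (V ≃ₗ[ℝ] V) × ((Fin n → ℝ) ≃ₗ[ℝ] (Fin n → ℝ)) => D.basisMap x.1 x.2)
      {x | ∃ π : Equiv.Perm (Fin n), IsoCond D D x.1 π ∧
        ∃ O : (Fin n → ℝ) ≃ₗ[ℝ] (Fin n → ℝ),
          D.IsEigenOrthogonal O ∧ ∀ w, x.2 w = permMap π (O w)}
      {γ | γ ∈ D.triple.Aut ∧ γ ∈ D.ΓBasis} := by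
  refine ⟨?_, D.basisMap_injective.injOn, ?_⟩
  · rintro ⟨P, Q⟩ ⟨π, hπ, O, hO, hQ⟩
    obtain ⟨hQ', hI⟩ := hπ.intertwines hO hQ
    exact ⟨(transport_diagMap_mem_Aut_iff hQ').2 ⟨hπ.curvature, hI⟩,
      transport_mem_ΓBasis.2 ⟨P, Q, hQ', rfl⟩⟩
  · rintro γ ⟨h1, h2⟩
    obtain ⟨ψ, rfl⟩ := exists_transport γ
    obtain ⟨P, Q, hQ, rfl⟩ := transport_mem_ΓBasis.1 h2
    obtain ⟨hR, hI⟩ := (transport_diagMap_mem_Aut_iff hQ).1 h1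
    obtain ⟨π, hπ⟩ := hI.exists_isoCond hR
    exact ⟨(P, Q), ⟨π, hπ, hπ.exists_eigenOrthogonal hQ hI⟩, rfl⟩

theorem preservesEigenspaces_iff {P : V ≃ₗ[ℝ] V} {Q : (Fin n → ℝ) ≃ₗ[ℝ] (Fin n → ℝ)} :
    D.PreservesEigenspaces (D.transport (diagMap P Q)) ↔
      ∀ χ, ∀ w ∈ D.simEigenspace χ, Q w ∈ D.simEigenspace χ := by
  have h : ∀ w w', D.transport (diagMap P Q) (D.mEquiv (0, w, 0)) = D.mEquiv (0, w', 0) ↔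
      Q w = w' := by
    intro w w'
    rw [transport_apply, D.mEquiv.injective.eq_iff, diagMap_apply]
    simp
  refine forall_congr' fun χ => forall_congr' fun w => forall_congr' fun _ => ?_
  simp only [h]
  exact ⟨fun ⟨w', hw', e⟩ => e ▸ hw', fun hw => ⟨_, hw, rfl⟩⟩

theorem isoCond_refl_iff {P : V ≃ₗ[ℝ] V} : IsoCond D D P (Equiv.refl _) ↔
    (∀ α, P (D.Λ α) = D.Λ α ∨ P (D.Λ α) = -D.Λ α) ∧ pullbackCurv P D.R = D.R :=
  ⟨fun h => ⟨h.vector, h.curvature⟩, fun h => ⟨h.2, fun _ => rfl, h.1⟩⟩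

theorem bijOn_basisMap_preservesEigenspaces :
    Set.BijOn (fun x : (V ≃ₗ[ℝ] V) × ((Fin n → ℝ) ≃ₗ[ℝ] (Fin n → ℝ)) => D.basisMap x.1 x.2)
      {x | ((∀ α, x.1 (D.Λ α) = D.Λ α ∨ x.1 (D.Λ α) = -D.Λ α) ∧ pullbackCurv x.1 D.R = D.R) ∧
        D.IsEigenOrthogonal x.2}
      {γ | γ ∈ D.triple.Aut ∧ γ ∈ D.ΓBasis ∧ D.PreservesEigenspaces γ} := by
  refine ⟨?_, D.basisMap_injective.injOn, ?_⟩
  · rintro ⟨P, Q⟩ ⟨hP, hQ⟩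
    obtain ⟨hQ', hI⟩ := ((D.isoCond_refl_iff).2 hP).intertwines hQ (Q := Q) fun _ => rfl
    exact ⟨(transport_diagMap_mem_Aut_iff hQ').2 ⟨hP.2, hI⟩,
      transport_mem_ΓBasis.2 ⟨P, Q, hQ', rfl⟩, D.preservesEigenspaces_iff.2 hQ.2⟩
  · rintro γ ⟨h1, h2, h3⟩
    obtain ⟨ψ, rfl⟩ := exists_transport γ
    obtain ⟨P, Q, hQ, rfl⟩ := transport_mem_ΓBasis.1 h2
    obtain ⟨hR, hI⟩ := (transport_diagMap_mem_Aut_iff hQ).1 h1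
    have hO : D.IsEigenOrthogonal Q := ⟨hQ, D.preservesEigenspaces_iff.1 h3⟩
    exact ⟨(P, Q), ⟨D.isoCond_refl_iff.1 (hI.apply_Λ hR hO), hO⟩, rfl⟩

end NormalFormData

/-! ### The holonomy action -/

theorem nilExp_of_pow_three {M : Type*} [AddCommGroup M] [Module ℝ M] {A : Module.End ℝ M}
    (h : A ^ 3 = 0) : nilExp A = 1 + A + (1 / 2 : ℝ) • A ^ 2 := by
  have hs : (Function.support fun k : ℕ => ((k.factorial : ℝ)⁻¹) • A ^ k) ⊆
      (Finset.range 3 : Set ℕ) := by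
    intro k hk
    rw [Finset.coe_range, Set.mem_Iio]
    by_contra hlt
    refine hk ?_
    obtain ⟨j, rfl⟩ := Nat.exists_eq_add_of_le (not_lt.1 hlt)
    show _ • A ^ (3 + j) = 0
    rw [pow_add, h, zero_mul, smul_zero]
  rw [nilExp, finsum_eq_sum_of_support_subset _ hs]
  simp [Finset.sum_range_succ, Nat.factorial]

namespace NormalFormData

variable {V : Type v} [AddCommGroup V] [Module ℝ V] [FiniteDimensional ℝ V] {n : ℕ}
  (D : NormalFormData V n)

theorem adm_mEquiv (y : D.Y) (c : Fin n → ℝ) (x) :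
    D.triple.adm (D.hElt y c) (D.mEquiv x) =
      D.mEquiv (D.b y x.2.2 - ∑ α, (D.ε α * (c α * x.2.1 α)) • D.Λ α,
        fun α => D.ε α * (c α * x.2.2 (D.Λ α)), 0) :=
  Subtype.ext (D.hIncl_lie_incl (y, c) x)

theorem adm_sq (y : D.Y) (c : Fin n → ℝ) (x) :
    (D.triple.adm (D.hElt y c) ^ 2) (D.mEquiv x) =
      D.mEquiv (-∑ α, (c α * (c α * x.2.2 (D.Λ α))) • D.Λ α, 0, 0) := by
  rw [pow_two, Module.End.mul_apply, adm_mEquiv, adm_mEquiv]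
  refine congrArg D.mEquiv (Prod.ext ?_ (Prod.ext ?_ rfl))
  · simp only [map_zero, zero_sub]
    refine congrArg _ (Finset.sum_congr rfl fun α _ => ?_)
    congr 1
    linear_combination (c α * (c α * x.2.2 (D.Λ α))) * D.ε_mul_self α
  · ext α
    simp

theorem adm_pow_three (y : D.Y) (c : Fin n → ℝ) : D.triple.adm (D.hElt y c) ^ 3 = 0 := by
  ext1 x
  obtain ⟨x, rfl⟩ := D.mEquiv.surjective x
  rw [pow_succ, Module.End.mul_apply, adm_mEquiv, adm_sq]
  simp only [LinearMap.zero_apply, mul_zero, zero_smul, Finset.sum_const_zero, neg_zero]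
  exact map_zero D.mEquiv

theorem isNilpotent_adm (a : D.triple.h) : IsNilpotent (D.triple.adm a) := by
  obtain ⟨x, hx⟩ := D.exists_hIncl a.2
  have : D.hElt x.1 x.2 = a := Subtype.ext hx
  exact ⟨3, this ▸ D.adm_pow_three x.1 x.2⟩

theorem nilExp_adm (y : D.Y) (c : Fin n → ℝ) (x) :
    nilExp (D.triple.adm (D.hElt y c)) (D.mEquiv x) =
      D.mEquiv (x.1 + (D.b y x.2.2 - ∑ α, (D.ε α * (c α * x.2.1 α)) • D.Λ α)
        - (1 / 2 : ℝ) • ∑ α, (c α * (c α * x.2.2 (D.Λ α))) • D.Λ α,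
        fun α => x.2.1 α + D.ε α * (c α * x.2.2 (D.Λ α)), x.2.2) := by
  rw [nilExp_of_pow_three (D.adm_pow_three y c), LinearMap.add_apply, LinearMap.add_apply,
    LinearMap.smul_apply, adm_sq, adm_mEquiv, Module.End.one_apply, ← map_smul, ← map_add,
    ← map_add]
  refine congrArg D.mEquiv (Prod.ext ?_ (Prod.ext ?_ ?_))
  · simp [sub_eq_add_neg]
  · ext α
    simp
  · simp

theorem isSkewMap_b (y : D.Y) : IsSkewMap (D.b y) := fun f g => by
  rw [D.b_skew y g f, neg_add_cancel]

theorem coe_transport_injective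
    {ψ ψ' : (V × (Fin n → ℝ) × Dual ℝ V) ≃ₗ[ℝ] (V × (Fin n → ℝ) × Dual ℝ V)}
    (h : (D.transport ψ : D.triple.m →ₗ[ℝ] D.triple.m) = D.transport ψ') : ψ = ψ' :=
  transport_injective (LinearEquiv.toLinearMap_injective h)

theorem expY_eq (y : D.Y) :
    D.expY y = (D.transport (rho 0 (D.b y)) : D.triple.m →ₗ[ℝ] D.triple.m) := by
  ext1 x
  obtain ⟨x, rfl⟩ := D.mEquiv.surjective x
  refine (D.nilExp_adm y 0 x).trans (Eq.trans ?_ (transport_apply x).symm)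
  refine congrArg D.mEquiv (Prod.ext ?_ (Prod.ext ?_ rfl))
  · simp [rho_apply]
  · ext α
    simp [rho_apply, homTranspose]

theorem finrank_lambda2 : finrank ℝ (Lambda2 V) = (finrank ℝ V).choose 2 := by
  rw [← Subspace.dual_finrank_eq (K := ℝ) (V := V)]
  exact exteriorPower.finrank_eq (R := ℝ) (M := Dual ℝ V) (n := 2)

theorem finrank_Y_eq_iff :
    2 * finrank ℝ D.Y = finrank ℝ V * (finrank ℝ V - 1) ↔ LinearMap.ker D.R = ⊥ := by
  have h1 : finrank ℝ D.Y + finrank ℝ (LinearMap.ker D.R) = (finrank ℝ V).choose 2 :=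
    (LinearMap.ker D.R).finrank_quotient_add_finrank.trans finrank_lambda2
  have h2 : 2 * (finrank ℝ V).choose 2 = finrank ℝ V * (finrank ℝ V - 1) := by
    rw [Nat.choose_two_right]
    exact Nat.mul_div_cancel' (Nat.even_mul_pred_self _).two_dvd
  rw [← Submodule.finrank_eq_zero (R := ℝ), ← h2]
  omega

/-- The holonomy `exp(ad Y)` exhausts all `ρ_S` if and only if every skew map is of the form `b(y,
·)`. Skew maps are the functionals on `Λ²`, so this says that `R` is non-degenerate. -/
theorem forall_exists_b_iff :
    (∀ S : Dual ℝ V →ₗ[ℝ] V, IsSkewMap S → ∃ y, D.b y = S) ↔ LinearMap.ker D.R = ⊥ := by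
  constructor
  · intro h
    rw [eq_bot_iff]
    intro ω hω
    rw [Submodule.mem_bot, ← Module.forall_dual_apply_eq_zero_iff ℝ]
    intro φ
    let S : Dual ℝ V →ₗ[ℝ] V :=
      { toFun := fun f => (evalEquiv ℝ V).symm (φ ∘ₗ wedge f)
        map_add' := fun f g => by rw [map_add, LinearMap.comp_add, map_add]
        map_smul' := fun c f => by
          rw [map_smul, LinearMap.comp_smul, map_smul, RingHom.id_apply] }
    have hS : ∀ f g : Dual ℝ V, g (S f) = φ (wedge f g) := fun f g =>
      LinearMap.congr_fun (LinearEquiv.apply_symm_apply (evalEquiv ℝ V) (φ ∘ₗ wedge f)) g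
    obtain ⟨y, hy⟩ := h S fun f g => by
      rw [hS, hS, wedge_swap, map_neg, neg_add_cancel]
    obtain ⟨η, rfl⟩ := Submodule.mkQ_surjective _ y
    have h1 : D.R η = φ := wedge_hom_ext fun f g => by
      rw [← hS, ← hy, apply_curvB]
      exact (LinearMap.congr_fun (curvLeft_proj D.R η) _).symm
    rw [← h1, D.isCurvatureTensor.symm, LinearMap.mem_ker.1 hω, LinearMap.zero_apply]
  · intro h S hS
    have hinj : Function.Injective D.R := LinearMap.ker_eq_bot.1 h
    have hsurj : Function.Surjective D.R :=
      (LinearMap.injective_iff_surjective_of_finrank_eq_finrank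
        (Subspace.dual_finrank_eq (K := ℝ) (V := Lambda2 V)).symm).1 hinj
    let B : Dual ℝ V →ₗ[ℝ] Dual ℝ V →ₗ[ℝ] ℝ := LinearMap.mk₂ ℝ (fun f g => g (S f))
      (fun f f' g => by rw [map_add, map_add]) (fun c f g => by rw [map_smul, map_smul])
      (fun f g g' => rfl) (fun c f g => rfl)
    have hB : ∀ f, B f f = 0 := fun f => by
      have := hS f f
      show f (S f) = 0
      linarith
    obtain ⟨η, hη⟩ := hsurj (wedgeLift B hB)
    refine ⟨curvProj D.R η, LinearMap.ext fun f => ?_⟩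
    rw [← sub_eq_zero, ← Module.forall_dual_apply_eq_zero_iff ℝ]
    intro g
    rw [map_sub, apply_curvB, curvLeft_proj, hη, wedgeLift_wedge]
    exact sub_self _

theorem range_expY_subset : Set.range D.expY ⊆ {g | ∃ S : Dual ℝ V →ₗ[ℝ] V, IsSkewMap S ∧
    g = (D.decompMap 0 S : D.triple.m →ₗ[ℝ] D.triple.m)} := by
  rintro _ ⟨y, rfl⟩
  exact ⟨D.b y, D.isSkewMap_b y, D.expY_eq y⟩

theorem range_expY_eq_iff : Set.range D.expY = {g | ∃ S : Dual ℝ V →ₗ[ℝ] V, IsSkewMap S ∧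
    g = (D.decompMap 0 S : D.triple.m →ₗ[ℝ] D.triple.m)} ↔
      2 * finrank ℝ D.Y = finrank ℝ V * (finrank ℝ V - 1) := by
  rw [finrank_Y_eq_iff, ← forall_exists_b_iff]
  constructor
  · intro h S hS
    obtain ⟨y, hy⟩ := h.ge ⟨S, hS, rfl⟩
    rw [expY_eq, decompMap_eq] at hy
    exact ⟨y, (rho_injective (D.coe_transport_injective hy)).2⟩
  · refine fun h => D.range_expY_subset.antisymm ?_
    rintro _ ⟨S, hS, rfl⟩
    obtain ⟨y, rfl⟩ := h S hS
    exact ⟨y, D.expY_eq y⟩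

/-- The map `W → 𝔷` with `W_α ↦ -ε_α c_α Λ_α`. -/
def wsHom (c : Fin n → ℝ) : (Fin n → ℝ) →ₗ[ℝ] V :=
  ∑ α, (LinearMap.proj α : (Fin n → ℝ) →ₗ[ℝ] ℝ).smulRight (-(D.ε α * c α) • D.Λ α)

theorem wsHom_apply (c w : Fin n → ℝ) :
    D.wsHom c w = -∑ α, (D.ε α * (c α * w α)) • D.Λ α := by
  simp only [wsHom, LinearMap.sum_apply, LinearMap.smulRight_apply, LinearMap.proj_apply,
    smul_smul, ← Finset.sum_neg_distrib, ← neg_smul]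
  refine Finset.sum_congr rfl fun α _ => ?_
  congr 1
  ring

theorem wsHom_single (c : Fin n → ℝ) (α : Fin n) :
    D.wsHom c (Pi.single α 1) = -(D.ε α * c α) • D.Λ α := by
  classical
  simp [wsHom_apply, Pi.single_apply]

theorem homTranspose_wsHom (c : Fin n → ℝ) (f : Dual ℝ V) (α : Fin n) :
    homTranspose (D.wsHom c) f α = -(D.ε α * (c α * f (D.Λ α))) := by
  show f (D.wsHom c (Pi.single α 1)) = _
  rw [wsHom_single, map_smul, smul_eq_mul]
  ring

theorem wsHom_homTranspose (c c' : Fin n → ℝ) (f : Dual ℝ V) :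
    D.wsHom c (homTranspose (D.wsHom c') f) = ∑ α, (c α * (c' α * f (D.Λ α))) • D.Λ α := by
  rw [wsHom_apply, ← Finset.sum_neg_distrib]
  refine Finset.sum_congr rfl fun α _ => ?_
  rw [homTranspose_wsHom, ← neg_smul]
  congr 1
  linear_combination (c α * (c' α * f (D.Λ α))) * D.ε_mul_self α

theorem isΛHom_wsHom (c : Fin n → ℝ) : D.IsΛHom (D.wsHom c) := ⟨_, D.wsHom_single c⟩

theorem exists_wsHom_eq {L : (Fin n → ℝ) →ₗ[ℝ] V} (hL : D.IsΛHom L) : ∃ c, D.wsHom c = L := by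
  obtain ⟨c, hc⟩ := hL
  refine ⟨fun α => -(D.ε α * c α), LinearMap.pi_ext' fun α => LinearMap.ext_ring ?_⟩
  show D.wsHom _ (Pi.single α 1) = L (Pi.single α 1)
  rw [wsHom_single, hc]
  congr 1
  linear_combination c α * D.ε_mul_self α

theorem expWs_eq (c : Fin n → ℝ) :
    D.expWs c = (D.transport (rho (D.wsHom c) 0) : D.triple.m →ₗ[ℝ] D.triple.m) := by
  ext1 x
  obtain ⟨x, rfl⟩ := D.mEquiv.surjective x
  refine (D.nilExp_adm 0 c x).trans (Eq.trans ?_ (transport_apply x).symm)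
  refine congrArg D.mEquiv (Prod.ext ?_ (Prod.ext ?_ rfl))
  · rw [rho_apply, wsHom_homTranspose, wsHom_apply]
    simp [sub_eq_add_neg]
  · ext α
    rw [rho_apply]
    simp only [Pi.sub_apply, homTranspose_wsHom, sub_neg_eq_add]

theorem expWs_injective : Function.Injective D.expWs := by
  intro c c' h
  rw [expWs_eq, expWs_eq] at h
  have h1 := (rho_injective (D.coe_transport_injective h)).1
  ext α
  have h2 := LinearMap.congr_fun h1 (Pi.single α 1)
  rw [wsHom_single, wsHom_single] at h2
  have h3 := smul_left_injective ℝ (D.Λ_ne_zero α) h2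
  have h4 : D.ε α * c α = D.ε α * c' α := neg_injective h3
  have h5 := D.ε_mul_self α
  linear_combination D.ε α * h4 - (c α - c' α) * h5

theorem expWs_add (c c' : Fin n → ℝ) : D.expWs (c + c') = D.expWs c * D.expWs c' := by
  have h : rho (D.wsHom (c + c')) (0 : Dual ℝ V →ₗ[ℝ] V) =
      rho (D.wsHom c') 0 ≪≫ₗ rho (D.wsHom c) 0 := by
    ext1 x
    rw [LinearEquiv.trans_apply, rho_apply, rho_apply (D.wsHom c), rho_apply (D.wsHom c')]
    refine Prod.ext ?_ (Prod.ext ?_ rfl)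
    · have h1 : ∀ w, D.wsHom (c + c') w = D.wsHom c w + D.wsHom c' w := fun w => by
        simp only [wsHom_apply, ← neg_add, ← Finset.sum_add_distrib, ← add_smul, Pi.add_apply]
        congr 1
        refine Finset.sum_congr rfl fun α _ => ?_
        congr 1
        ring
      have h2 : D.wsHom (c + c') (homTranspose (D.wsHom (c + c')) x.2.2) =
          D.wsHom c (homTranspose (D.wsHom c) x.2.2)
          + (2 : ℝ) • D.wsHom c (homTranspose (D.wsHom c') x.2.2)
          + D.wsHom c' (homTranspose (D.wsHom c') x.2.2) := by
        simp only [wsHom_homTranspose, Finset.smul_sum, ← Finset.sum_add_distrib, smul_smul,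
          ← add_smul, Pi.add_apply]
        refine Finset.sum_congr rfl fun α _ => ?_
        congr 1
        ring
      rw [h1, h2]
      simp only [map_sub, LinearMap.zero_apply]
      module
    · ext α
      simp only [Pi.sub_apply, homTranspose_wsHom, Pi.add_apply]
      ring
  rw [expWs_eq, expWs_eq, expWs_eq, h, transport_trans]
  rfl

theorem range_expWs : Set.range D.expWs = {g | ∃ L : (Fin n → ℝ) →ₗ[ℝ] V, D.IsΛHom L ∧
    g = (D.decompMap L 0 : D.triple.m →ₗ[ℝ] D.triple.m)} := by
  apply Set.Subset.antisymm
  · rintro _ ⟨c, rfl⟩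
    exact ⟨D.wsHom c, D.isΛHom_wsHom c, D.expWs_eq c⟩
  · rintro _ ⟨L, hL, rfl⟩
    obtain ⟨c, rfl⟩ := D.exists_wsHom_eq hL
    exact ⟨c, D.expWs_eq c⟩

end NormalFormData

end

theorem mainTheorem1 {V : Type v} [AddCommGroup V] [Module ℝ V] [FiniteDimensional ℝ V]
    (p q : ℕ) (hp : 1 ≤ p) (hpq : p ≤ q) (hV : Module.finrank ℝ V = p) :
    -- (i)
    (∀ τ : SymmetricTriple.{u}, τ.IsT p q →
      ∃ D : NormalFormData V (q - p), Nonempty (τ.Iso D.triple)) ∧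
    -- (ii)
    (∀ D : NormalFormData V (q - p),
      (∃ (s : ℕ) (t : Fin s → SymmetricTriple.{v}) (p' q' : Fin s → ℕ),
        (∀ i, (t i).IsT (p' i) (q' i)) ∧
          Nonempty (D.triple.Iso (SymmetricTriple.directSum t))) ∧
      (∀ (s : ℕ) (t : Fin s → SymmetricTriple.{v}),
        (∀ i, (t i).Indecomposable ∧ Nontrivial (t i).carrier) →
        Nonempty (D.triple.Iso (SymmetricTriple.directSum t)) →
        ∀ i, ∃ p' q' : ℕ, (t i).IsT p' q') ∧
      ((p : ℝ) * ((p : ℝ) - 2) / 2 < Module.finrank ℝ D.Y → D.triple.Indecomposable)) ∧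
    -- (iii)
    (∀ D D' : NormalFormData V (q - p), D.triple.Indecomposable → D'.triple.Indecomposable →
      (Nonempty (D.triple.Iso D'.triple) ↔
        ∃ (P : V ≃ₗ[ℝ] V) (π : Equiv.Perm (Fin (q - p))), IsoCond D D' P π)) ∧
    -- (iv)
    (∀ D : NormalFormData V (q - p),
      -- `Aut(τ) ⊆ Γ = Γ_decomp ⋊ Γ_basis`
      D.triple.Aut ≤ D.triple.Γ ∧
      (D.triple.ΓDecomp ⊓ D.ΓBasis = ⊥ ∧ D.triple.ΓDecomp ⊔ D.ΓBasis = D.triple.Γ ∧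
        ∀ γ ∈ D.triple.Γ, ∀ δ ∈ D.triple.ΓDecomp, γ * δ * γ⁻¹ ∈ D.triple.ΓDecomp) ∧
      -- `Aut(τ)` is generated by its intersections with the two factors
      (D.triple.Aut ⊓ D.triple.ΓDecomp) ⊔ (D.triple.Aut ⊓ D.ΓBasis) = D.triple.Aut ∧
      -- `Aut(τ) ∩ Γ_decomp`
      Set.BijOn (fun x : ((Fin (q - p) → ℝ) →ₗ[ℝ] V) × (Module.Dual ℝ V →ₗ[ℝ] V) =>
          D.decompMap x.1 x.2)
        {x | D.IsΛHom x.1 ∧ IsSkewMap x.2} {γ | γ ∈ D.triple.Aut ∧ γ ∈ D.triple.ΓDecomp} ∧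
      -- `Aut(τ) ∩ Γ_basis`
      Set.BijOn (fun x : (V ≃ₗ[ℝ] V) × ((Fin (q - p) → ℝ) ≃ₗ[ℝ] (Fin (q - p) → ℝ)) =>
          D.basisMap x.1 x.2)
        {x | ∃ π : Equiv.Perm (Fin (q - p)), IsoCond D D x.1 π ∧
          ∃ O : (Fin (q - p) → ℝ) ≃ₗ[ℝ] (Fin (q - p) → ℝ),
            D.IsEigenOrthogonal O ∧ ∀ w, x.2 w = permMap π (O w)}
        {γ | γ ∈ D.triple.Aut ∧ γ ∈ D.ΓBasis} ∧
      -- the subgroup of `Aut(τ) ∩ Γ_basis` that preserves each simultaneous eigenspace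
      Set.BijOn (fun x : (V ≃ₗ[ℝ] V) × ((Fin (q - p) → ℝ) ≃ₗ[ℝ] (Fin (q - p) → ℝ)) =>
          D.basisMap x.1 x.2)
        {x | ((∀ α, x.1 (D.Λ α) = D.Λ α ∨ x.1 (D.Λ α) = -D.Λ α) ∧
            pullbackCurv x.1 D.R = D.R) ∧ D.IsEigenOrthogonal x.2}
        {γ | γ ∈ D.triple.Aut ∧ γ ∈ D.ΓBasis ∧ D.PreservesEigenspaces γ} ∧
      -- the holonomy action
      (∀ a : D.triple.h, IsNilpotent (D.triple.adm a)) ∧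
      (Set.range D.expY ⊆ {g | ∃ S : Module.Dual ℝ V →ₗ[ℝ] V, IsSkewMap S ∧
          g = (D.decompMap 0 S : D.triple.m →ₗ[ℝ] D.triple.m)} ∧
        (Set.range D.expY = {g | ∃ S : Module.Dual ℝ V →ₗ[ℝ] V, IsSkewMap S ∧
          g = (D.decompMap 0 S : D.triple.m →ₗ[ℝ] D.triple.m)} ↔
            2 * Module.finrank ℝ D.Y = p * (p - 1))) ∧
      (Function.Injective D.expWs ∧ (∀ c c', D.expWs (c + c') = D.expWs c * D.expWs c') ∧
        Set.range D.expWs = {g | ∃ L : (Fin (q - p) → ℝ) →ₗ[ℝ] V, D.IsΛHom L ∧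
          g = (D.decompMap L 0 : D.triple.m →ₗ[ℝ] D.triple.m)})) := by
  subst hV
  refine ⟨fun τ h => h.exists_normalForm rfl, fun D => ⟨D.exists_iso_directSum_isT, ?_,
    D.indecomposable_of_finrank_Y⟩, fun D D' _ _ => NormalFormData.nonempty_iso_iff, fun D =>
    ⟨NormalFormData.aut_le_Γ, ⟨D.ΓDecomp_inf_ΓBasis, D.ΓDecomp_sup_ΓBasis,
      fun γ hγ δ hδ => SymmetricTriple.conj_mem_ΓDecomp hγ hδ⟩, D.aut_eq_sup, D.bijOn_decompMap,
      D.bijOn_basisMap, D.bijOn_basisMap_preservesEigenspaces, D.isNilpotent_adm,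
      ⟨D.range_expY_subset, D.range_expY_eq_iff⟩, D.expWs_injective, D.expWs_add, D.range_expWs⟩⟩
  rintro s t ht ⟨e⟩ i
  exact D.isT_of_iso_directSum t e i (ht i).1 (ht i).2
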